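/- **Setting.** Let $G$ be a planar graph diagram in $\mathbb{R}^2$ (no crossings, blackboard framing): an oriented trivalent graph without source or sink, possibly disconnected and possibly with closed components without vertices (which also count as edges), with edge set $E$ and vertex set $V$. A coloring assigns to each edge $e$ a pair (multiplicity $c(e)\in\mathbb{Z}\setminus\{0\}$, weight $J(e)\in\mathbb{Z}$) such that at every vertex, with $\epsilon_i=1$ if the $i$-th edge points out of the vertex and $\epsilon_i=-1$ otherwise, $\sum_{i=1}^3\epsilon_i c(e_i)=0$ and $\sum_{i=1}^3\epsilon_iJ(e_i)=-\prod_{i=1}^3\epsilon_i$. Assume that all multiplicities are positive. Put $\{k\}_q=q^k-q^{-k}$. **Viro's polynomial.** $\underline{\Delta}(G,c)\in\mathbb{Q}(q)$ is defined as follows. Put $G$ in Morse position, cut an edge on the boundary of the unbounded region, of multiplicity $j_0$ (with $G$ in Morse position: at a point with no point of $G$ to its left on the same horizontal line), bring the two new ends to the bottom and the top of the diagram, and slice the result by horizontal lines into elementary pieces (minima, maxima and trivalent vertices). Every piece gives a matrix in the bases of tensor products of $e_0,e_1$ whose entries are the Boltzmann weights below; the product of all these matrices is an endomorphism of a two-dimensional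 irreducible $U_q(gl(1|1))$-module, that is, multiplication by a rational function (the entry at $e_0,e_0$), and $\underline{\Delta}(G,c)$ is this function divided by $q^{2j_0}-q^{-2j_0}$. The weights vanish unless the two ends of a minimum or maximum are in the same state, and are as follows, $j$ being the multiplicity. * Minimum, traversed right to left: $1$ for $e_0$, $-q^{2j}$ for $e_1$; left to right: $q^{-2j}$ for $e_0$, $1$ for $e_1$. * Maximum, traversed right to left: $1$ for $e_0$, $-q^{-2j}$ for $e_1$; left to right: $q^{2j}$ for $e_0$, $1$ for $e_1$. * Vertex with one edge of multiplicity $k$ on one side (below or above) and, on the other side, a left edge of multiplicity $i$ and a right edge of multiplicity $j$. The triples (state of the single, left, right edge) $(0,0,0),(0,1,1),(1,1,0),(1,0,1)$ have the weights listed below, all other triples weight $0$; arrows show whether the single, left, right edge point up or down. Single edge below: $\uparrow\uparrow\uparrow$: $\{2k\}_q,\ 0,\ \{2i\}_qq^{-2j},\ \{2j\}_q$; $\uparrow\uparrow\downarrow$: $1,\ -q^{2i},\ 1,\ 0$; $\downarrow\uparrow\downarrow$: $\{2j\}_q,\ -\{2i\}_qq^{2j},\ 0,\ \{2k\}_q$;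 $\uparrow\downarrow\uparrow$: $q^{-2i},\ 1,\ 0,\ 1$; $\downarrow\downarrow\uparrow$: $\{2i\}_qq^{-2j},\ \{2j\}_q,\ \{2k\}_q,\ 0$; $\downarrow\downarrow\downarrow$: $1,\ 0,\ 1,\ q^{-2i}$. Single edge above: $\uparrow\uparrow\uparrow$: $1,\ 0,\ 1,\ q^{2i}$; $\uparrow\uparrow\downarrow$: $\{2i\}_qq^{2j},\ \{2j\}_q,\ \{2k\}_q,\ 0$; $\downarrow\uparrow\downarrow$: $q^{2i},\ 1,\ 0,\ 1$; $\uparrow\downarrow\uparrow$: $\{2j\}_q,\ -\{2i\}_qq^{-2j},\ 0,\ \{2k\}_q$; $\downarrow\downarrow\uparrow$: $1,\ -q^{-2i},\ 1,\ 0$; $\downarrow\downarrow\downarrow$: $\{2k\}_q,\ 0,\ \{2i\}_qq^{2j},\ \{2j\}_q$. **States.** Let $\delta$ be an initial point on an edge on the boundary of the unbounded region and let $j$ be the multiplicity of this edge. A state is a map $s:E\to\{0,1\}$ which is $0$ on the edge containing $\delta$ and such that, at every vertex, the sum of $s$ over the incoming edges equals the sum over the outgoing edges; $\mathcal{S}$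 is the set of states. The edges with $s(e)=1$ form disjoint simple closed curves, the solid curves, and $\mathrm{sign}(s)=(-1)^{\#\text{solid curves}}$. The weight $Wt(v;s)$ is as follows, where the plane is turned so that all edges at $v$ point upward. * One incoming edge, left and right outgoing edges of multiplicities $i$, $j$: $\{2i+2j\}_q$ if all three edges have label $0$, $\{2j\}_q$ if the right outgoing edge has label $1$, and $\{2i\}_qq^{-2j}$ if the left outgoing edge has label $1$. * One outgoing edge, left and right incoming edges of multiplicities $i$, $j$: $1$ if all three edges have label $0$, $q^{2i}$ if the right incoming edge has label $1$, and $1$ if the left incoming edge has label $1$. **Rotation.** Replace every edge $e$ by $c(e)$ parallel copies, joined at the vertices without crossings, to obtain oriented simple closed curves. $\mathrm{Rot}(G,c,\delta)$ is the sum of the rotation numbers ($1$ if clockwise, $-1$ if counter-clockwise) of those curves which contain no copy of the edge on which $\delta$ lies. **Proposition.** For every such planar $G$ with positive coloring $c$, and every initial point $\delta$ on an edge of multiplicity $j$ on the boundary of the unbounded region, $$\underline{\Delta}(G,c)=\frac{q^{2\mathrm{Rot}(G,c,\delta)}}{q^{2j}-q^{-2j}}\sum_{s\in\mathcal{S}}\mathrm{sign}(s)\prod_{v\in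 V}Wt(v;s).$$ Here the left-hand side may be calculated from any Morse position of $G$, by cutting at any point with no point of $G$ to its left on the same horizontal line; this cut need not be on the edge of $\delta$. -/

import Mathlib

/-!
Planar oriented trivalent graphs with the blackboard framing are presented by diagrams in Morse
position, colored as in Viro's category of colored framed graphs.
-/

namespace ViroAlexander

noncomputable section

/-- Number of equivalence classes of the equivalence relation generated by `r`. -/
def classCount {α : Type} (r : α → α → Prop) : ℕ := Nat.card (Quot r)

/-! ### Colored diagrams in Morse position -/

/-- The germ of an edge where it crosses a horizontal line: the color `(j, J)` of the edge
(multiplicity and weight) and whether the edge points upward there. -/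
structure Strand where
  mult : ℤ
  weight : ℤ
  up : Bool

/-- The same color, pointing in the opposite direction. -/
def Strand.rev (s : Strand) : Strand := ⟨s.mult, s.weight, !s.up⟩

/-- The elementary pieces of a planar diagram in Morse position: a minimum (whose left end is `l`,
the right end being `l.rev`), a maximum, a vertex with one edge `b` below and two edges `l`, `r`
(left, right) above, and a vertex with two edges `l`, `r` below and one edge `t` above. -/
inductive Piece where
  | cup (l : Strand)
  | cap (l : Strand)
  | split (b l r : Strand)
  | merge (l r t : Strand)

/-- The strands of a piece on its bottom line, from left to right. -/
def Piece.bot : Piece → List Strand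
  | .cup _ => []
  | .cap l => [l, l.rev]
  | .split b _ _ => [b]
  | .merge l r _ => [l, r]

/-- The strands of a piece on its top line, from left to right. -/
def Piece.top : Piece → List Strand
  | .cup l => [l, l.rev]
  | .cap _ => []
  | .split _ l r => [l, r]
  | .merge _ _ t => [t]

/-- `1` for an edge pointing out of the vertex, `-1` for an edge pointing toward it. -/
def outSign (out : Bool) : ℤ := if out then 1 else -1

/-- The conditions at a vertex with edges `s₁ s₂ s₃`, where `oᵢ` says that the `i`-th edge points
out of the vertex: the vertex is neither a source nor a sink, and the colors satisfy the
admissibility conditions `∑ εᵢ jᵢ = 0` and `∑ εᵢ Jᵢ = - ∏ εᵢ`. -/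
def AdmissibleVertex (s₁ s₂ s₃ : Strand) (o₁ o₂ o₃ : Bool) : Prop :=
  ¬ (o₁ = o₂ ∧ o₂ = o₃) ∧
  outSign o₁ * s₁.mult + outSign o₂ * s₂.mult + outSign o₃ * s₃.mult = 0 ∧
  outSign o₁ * s₁.weight + outSign o₂ * s₂.weight + outSign o₃ * s₃.weight =
    -(outSign o₁ * outSign o₂ * outSign o₃)

/-- Multiplicities are nonzero, and vertices are admissible. -/
def Piece.Admissible (p : Piece) : Prop :=
  (∀ s ∈ p.bot ++ p.top, s.mult ≠ 0) ∧
  match p with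
  | .cup _ => True
  | .cap _ => True
  | .split b l r => AdmissibleVertex b l r (!b.up) l.up r.up
  | .merge l r t => AdmissibleVertex l r t (!l.up) (!r.up) t.up

/-- The part of a diagram between two consecutive horizontal lines: one elementary piece, with
trivial vertical segments to its left and to its right. -/
structure Slice where
  left : List Strand
  piece : Piece
  right : List Strand

def Slice.bot (s : Slice) : List Strand := s.left ++ (s.piece.bot ++ s.right)

def Slice.top (s : Slice) : List Strand := s.left ++ (s.piece.top ++ s.right)

/-- A colored oriented planar trivalent graph diagram (without source or sink, possibly
disconnected, possibly with closed components without vertices) in Morse position, cut by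
horizontal lines numbered `0, …, n` from bottom to top into slices; `level t` lists the strands
that cross the `t`-th line, from left to right. -/
structure Diagram where
  n : ℕ
  slice : Fin n → Slice
  level : Fin (n + 1) → List Strand
  level_castSucc : ∀ t : Fin n, level t.castSucc = (slice t).bot
  level_succ : ∀ t : Fin n, level t.succ = (slice t).top
  level_zero : level 0 = []
  level_last : level (Fin.last n) = []
  admissible : ∀ t : Fin n, (slice t).piece.Admissible

/-! ### Viro's functor and the `gl(1|1)`-Alexander polynomial -/

/-- The field of rational functions in `q`. -/
abbrev K : Type := RatFunc ℚ

/-- The variable `q`. -/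
def q : K := RatFunc.X

/-- `{k} = q ^ k - q ^ (-k)`. -/
def br (k : ℤ) : K := q ^ k - q ^ (-k)

/-- A row of the table of vertex weights: the four entries are the weights for the states
`(0,0,0)`, `(0,1,1)`, `(1,1,0)`, `(1,0,1)`, where the first state belongs to the edge which is
alone on its side of the vertex and the other two to the left and the right edge on the other
side. All other states have weight `0`. -/
def row (w₁ w₂ w₃ w₄ : K) : Bool → Bool → Bool → K
  | false, false, false => w₁
  | false, true, true => w₂
  | true, true, false => w₃
  | true, false, true => w₄
  | _, _, _ => 0

/-- Boltzmann weights at a vertex with one edge below: `i`, `j`, `k` are the multiplicities of the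
upper left, the upper right and the lower edge, the first three Booleans say which of the lower,
the upper left and the upper right edge point upward. -/
def splitWeight (i j k : ℤ) : Bool → Bool → Bool → Bool → Bool → Bool → K
  | true, true, true => row (br (2 * k)) 0 (br (2 * i) * q ^ (-2 * j)) (br (2 * j))
  | true, true, false => row 1 (-q ^ (2 * i)) 1 0
  | false, true, false => row (br (2 * j)) (-(br (2 * i) * q ^ (2 * j))) 0 (br (2 * k))
  | true, false, true => row (q ^ (-2 * i)) 1 0 1
  | false, false, true => row (br (2 * i) * q ^ (-2 * j)) (br (2 * j)) (br (2 * k)) 0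
  | false, false, false => row 1 0 1 (q ^ (-2 * i))
  | _, _, _ => fun _ _ _ => 0

/-- Boltzmann weights at a vertex with one edge above: `i`, `j`, `k` are the multiplicities of the
lower left, the lower right and the upper edge, the first three Booleans say which of the upper,
the lower left and the lower right edge point upward. -/
def mergeWeight (i j k : ℤ) : Bool → Bool → Bool → Bool → Bool → Bool → K
  | true, true, true => row 1 0 1 (q ^ (2 * i))
  | true, true, false => row (br (2 * i) * q ^ (2 * j)) (br (2 * j)) (br (2 * k)) 0
  | false, true, false => row (q ^ (2 * i)) 1 0 1
  | true, false, true => row (br (2 * j)) (-(br (2 * i) * q ^ (-2 * j))) 0 (br (2 * k))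
  | false, false, true => row 1 (-q ^ (-2 * i)) 1 0
  | false, false, false => row (br (2 * k)) 0 (br (2 * i) * q ^ (2 * j)) (br (2 * j))
  | _, _, _ => fun _ _ _ => 0

/-- Boltzmann weights at a minimum with left end `l`, both ends in the same state. -/
def cupWeight (l : Strand) : Bool → K
  | false => if l.up then 1 else q ^ (-2 * l.mult)
  | true => if l.up then -q ^ (2 * l.mult) else 1

/-- Boltzmann weights at a maximum with left end `l`, both ends in the same state. -/
def capWeight (l : Strand) : Bool → K
  | false => if l.up then q ^ (2 * l.mult) else 1
  | true => if l.up then 1 else -q ^ (-2 * l.mult)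

/-- The matrix of the morphism of a piece, in the bases formed by the tensor products of the
generators `e₀` (`false`) and `e₁` (`true`) of the modules of the strands on the bottom line (first
list) and on the top line (second list). -/
def Piece.entry : Piece → List Bool → List Bool → K
  | .cup l, [], [x, y] => if x = y then cupWeight l x else 0
  | .cap l, [x, y], [] => if x = y then capWeight l x else 0
  | .split b l r, [x], [y, z] => splitWeight l.mult r.mult b.mult b.up l.up r.up x y z
  | .merge l r t, [y, z], [x] => mergeWeight l.mult r.mult t.mult t.up l.up r.up x y z
  | _, _, _ => 0

/-- The matrix of the morphism of a slice: the tensor product of the matrix of its piece with the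
identities of the vertical segments. -/
def Slice.entry (s : Slice) (x y : List Bool) : K :=
  if x.length = s.bot.length ∧ y.length = s.top.length ∧
      x.take s.left.length = y.take s.left.length ∧
      x.drop (s.left.length + s.piece.bot.length) =
        y.drop (s.left.length + s.piece.top.length) then
    s.piece.entry ((x.drop s.left.length).take s.piece.bot.length)
      ((y.drop s.left.length).take s.piece.top.length)
  else 0

/-- The matrix of the morphism of a stack of slices (listed from bottom to top): the product of
the matrices of the slices. -/
def morphism : List Slice → List Bool → List Bool → K
  | [], x, y => if x = y then 1 else 0
  | s :: S, x, y =>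
      ∑ z : Fin s.top.length → Bool, s.entry x (List.ofFn z) * morphism S (List.ofFn z) y

/-- Add a trivial vertical segment on the far left. -/
def Slice.addLeft (b : Strand) (s : Slice) : Slice := ⟨b :: s.left, s.piece, s.right⟩

/-- The open diagram in Morse position, with one endpoint on its bottom line and one on its top
line, obtained by cutting `G` at the leftmost point of the `t`-th line: the two new ends are bent,
through a maximum (lower end) and a minimum (upper end), to the left and then led to the bottom
line and to the top line. -/
def Diagram.cut (G : Diagram) (t : Fin (G.n + 1)) (h : G.level t ≠ []) : List Slice :=
  let b := ((G.level t).head h).rev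
  ((List.ofFn G.slice).take t).map (Slice.addLeft b) ++
    [⟨[], .cap b, (G.level t).tail⟩, ⟨[], .cup b, (G.level t).tail⟩] ++
    ((List.ofFn G.slice).drop t).map (Slice.addLeft b)

/-- Viro's `gl(1|1)`-Alexander polynomial, calculated by cutting at the leftmost point of the
`t`-th line. The morphism of the cut diagram, an endomorphism of a two-dimensional irreducible
module, is multiplication by a rational function, here read off at `e₀`; it is divided by
`q ^ (2 j) - q ^ (-2 j)` for the multiplicity `j` of the edge that was cut. -/
def Diagram.alexander (G : Diagram) (t : Fin (G.n + 1)) (h : G.level t ≠ []) : K :=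
  morphism (G.cut t h) [false] [false] / br (2 * ((G.level t).head h).mult)

/-! ### The underlying planar graph -/

/-- Strand `i` on the bottom line of the slice is continued by a vertical segment to strand `i'` on
its top line. -/
def Slice.Through (s : Slice) (i i' : ℕ) : Prop :=
  (i < s.left.length ∧ i' = i) ∨
  ∃ k, i = s.left.length + s.piece.bot.length + k ∧ i' = s.left.length + s.piece.top.length + k

namespace Diagram

variable (G : Diagram)

/-- The crossing points of the graph with the horizontal lines. -/
abbrev Point : Type := (t : Fin (G.n + 1)) × Fin (G.level t).length

def strand (p : G.Point) : Strand := (G.level p.1).get p.2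

/-- Two points are consecutive on an edge: they are joined by a vertical segment, a maximum or a
minimum. -/
def Link (p p' : G.Point) : Prop :=
  ∃ t : Fin G.n,
    (p.1 = t.castSucc ∧ p'.1 = t.succ ∧ (G.slice t).Through p.2 p'.2) ∨
    (p.1 = t.castSucc ∧ p'.1 = t.castSucc ∧ (∃ l, (G.slice t).piece = .cap l) ∧
      (p.2 : ℕ) = (G.slice t).left.length ∧ (p'.2 : ℕ) = (G.slice t).left.length + 1) ∨
    (p.1 = t.succ ∧ p'.1 = t.succ ∧ (∃ l, (G.slice t).piece = .cup l) ∧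
      (p.2 : ℕ) = (G.slice t).left.length ∧ (p'.2 : ℕ) = (G.slice t).left.length + 1)

/-- The edges of the graph. A closed component without vertices is an edge, too. -/
def Edge : Type := Quot G.Link

/-- The edge on which a point lies. -/
def edge (p : G.Point) : G.Edge := Quot.mk _ p

instance : Finite G.Edge := inferInstanceAs (Finite (Quot G.Link))

instance : Fintype G.Edge := Fintype.ofFinite _

theorem strand_eq (p : G.Point) {L : List Strand} (h : G.level p.1 = L) :
    L[(p.2 : ℕ)]? = some (G.strand p) := by
  subst h
  simp [strand]

theorem mult_eq_of_link {p p' : G.Point} (h : G.Link p p') :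
    (G.strand p).mult = (G.strand p').mult := by
  obtain ⟨t, ⟨h₁, h₂, h₃⟩ | ⟨h₁, h₂, ⟨l, hl⟩, h₃, h₄⟩ | ⟨h₁, h₂, ⟨l, hl⟩, h₃, h₄⟩⟩ := h
  · have e₁ := G.strand_eq p (L := (G.slice t).bot) (by rw [h₁, G.level_castSucc])
    have e₂ := G.strand_eq p' (L := (G.slice t).top) (by rw [h₂, G.level_succ])
    have e : (G.slice t).bot[(p.2 : ℕ)]? = (G.slice t).top[(p'.2 : ℕ)]? := by
      rcases h₃ with ⟨h, h'⟩ | ⟨k, h, h'⟩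
      · rw [h', Slice.bot, Slice.top, List.getElem?_append_left h, List.getElem?_append_left h]
      · rw [h, h', Slice.bot, Slice.top, add_assoc, add_assoc,
          List.getElem?_append_right (by omega), List.getElem?_append_right (by omega),
          List.getElem?_append_right (by omega), List.getElem?_append_right (by omega)]
        congr 1
        omega
    rw [e₁, e₂] at e
    rw [Option.some.inj e]
  · have e₁ := G.strand_eq p (L := (G.slice t).bot) (by rw [h₁, G.level_castSucc])
    have e₂ := G.strand_eq p' (L := (G.slice t).bot) (by rw [h₂, G.level_castSucc])
    rw [h₃] at e₁
    rw [h₄] at e₂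
    simp [Slice.bot, hl, Piece.bot] at e₁ e₂
    rw [← e₁, ← e₂]
    rfl
  · have e₁ := G.strand_eq p (L := (G.slice t).top) (by rw [h₁, G.level_succ])
    have e₂ := G.strand_eq p' (L := (G.slice t).top) (by rw [h₂, G.level_succ])
    rw [h₃] at e₁
    rw [h₄] at e₂
    simp [Slice.top, hl, Piece.top] at e₁ e₂
    rw [← e₁, ← e₂]
    rfl

/-- The multiplicity of an edge. -/
def mult : G.Edge → ℤ :=
  Quot.lift (fun p => (G.strand p).mult) fun _ _ h => G.mult_eq_of_link h

/-- The intervals into which the graph divides the horizontal lines; interval `i` lies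
immediately to the left of strand `i`. -/
abbrev Gap : Type := (t : Fin (G.n + 1)) × Fin ((G.level t).length + 1)

/-- Two intervals, on the bottom line and on the top line of a slice, bound the same component of
the complement of the graph in the slice. -/
def GapLink (g g' : G.Gap) : Prop :=
  ∃ t : Fin G.n, g.1 = t.castSucc ∧ g'.1 = t.succ ∧
    (((g.2 : ℕ) ≤ (G.slice t).left.length ∧ (g'.2 : ℕ) = g.2) ∨
    ∃ k, (g.2 : ℕ) = (G.slice t).left.length + (G.slice t).piece.bot.length + k ∧
      (g'.2 : ℕ) = (G.slice t).left.length + (G.slice t).piece.top.length + k)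

/-- The regions of the plane cut out by the graph. -/
def Region : Type := Quot G.GapLink

def region (g : G.Gap) : G.Region := Quot.mk _ g

/-- The unbounded region. -/
def outerRegion : G.Region := G.region ⟨0, 0⟩

/-- The edge lies on the boundary of the unbounded region. -/
def IsOutermost (e : G.Edge) : Prop :=
  ∃ p : G.Point, G.edge p = e ∧
    (G.region ⟨p.1, p.2.castSucc⟩ = G.outerRegion ∨ G.region ⟨p.1, p.2.succ⟩ = G.outerRegion)

/-- The edge attached to the bottom line of the piece of slice `t` at its `k`-th bottom strand. -/
def botEdge (t : Fin G.n) (k : ℕ) (h : k < (G.slice t).piece.bot.length) : G.Edge :=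
  G.edge ⟨t.castSucc, ⟨(G.slice t).left.length + k, by
    rw [G.level_castSucc, Slice.bot, List.length_append, List.length_append]; omega⟩⟩

/-- The edge attached to the top line of the piece of slice `t` at its `k`-th top strand. -/
def topEdge (t : Fin G.n) (k : ℕ) (h : k < (G.slice t).piece.top.length) : G.Edge :=
  G.edge ⟨t.succ, ⟨(G.slice t).left.length + k, by
    rw [G.level_succ, Slice.top, List.length_append, List.length_append]; omega⟩⟩

end Diagram

/-- The neighborhood of a vertex in an oriented plane graph without source or sink, drawn so that
all three edges point upward: `odd inn outL outR` has one incoming edge and a left and a right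
outgoing edge, `even out inL inR` has one outgoing edge and a left and a right incoming edge. -/
inductive Corner (E : Type) where
  | odd (inn outL outR : E)
  | even (out inL inR : E)

/-- The neighborhood of a vertex whose edges are `e₀ e₁ e₂` in clockwise order, where `oᵢ` says that
`eᵢ` points out of the vertex; `none` for a source or sink. -/
def Corner.ofClockwise {E : Type} (e₀ e₁ e₂ : E) : Bool → Bool → Bool → Option (Corner E)
  | false, true, true => some (.odd e₀ e₁ e₂)
  | true, false, true => some (.odd e₁ e₂ e₀)
  | true, true, false => some (.odd e₂ e₀ e₁)
  | true, false, false => some (.even e₀ e₂ e₁)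
  | false, true, false => some (.even e₁ e₀ e₂)
  | false, false, true => some (.even e₂ e₁ e₀)
  | _, _, _ => none

/-- The edges at a vertex. -/
def Corner.edges {E : Type} : Corner E → List E
  | .odd inn outL outR => [inn, outL, outR]
  | .even out inL inR => [out, inL, inR]

/-- The labels of the incoming and of the outgoing edges have the same sum. -/
def Corner.Conserves {E : Type} (s : E → Bool) : Corner E → Prop
  | .odd inn outL outR => (s inn).toNat = (s outL).toNat + (s outR).toNat
  | .even out inL inR => (s inL).toNat + (s inR).toNat = (s out).toNat

/-- The weight of a state at a vertex, where `c e` is the multiplicity of the edge `e`. -/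
def Corner.wt {E : Type} (c : E → ℤ) (s : E → Bool) : Corner E → K
  | .odd inn outL outR =>
      if s inn = false then br (2 * c outL + 2 * c outR)
      else if s outR = true then br (2 * c outR)
      else br (2 * c outL) * q ^ (-2 * c outR)
  | .even out inL inR =>
      if s out = false then 1
      else if s inR = true then q ^ (2 * c inL)
      else 1

namespace Diagram

variable (G : Diagram)

/-- The vertex in slice `t` (`none` if the piece of the slice is a maximum or a minimum). -/
def corner (t : Fin G.n) : Option (Corner G.Edge) :=
  match h : (G.slice t).piece with
  | .cup _ => none
  | .cap _ => none
  | .split b l r =>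
      Corner.ofClockwise (G.botEdge t 0 (by simp [h, Piece.bot]))
        (G.topEdge t 0 (by simp [h, Piece.top])) (G.topEdge t 1 (by simp [h, Piece.top]))
        (!b.up) l.up r.up
  | .merge l r u =>
      Corner.ofClockwise (G.topEdge t 0 (by simp [h, Piece.top]))
        (G.botEdge t 1 (by simp [h, Piece.bot])) (G.botEdge t 0 (by simp [h, Piece.bot]))
        u.up (!r.up) (!l.up)

/-! ### States -/

/-- A state: a labeling of the edges by `0` (`false`) and `1` (`true`) with label `0` on the edge
`δ` that contains the initial point, conserved at every vertex. -/
def IsState (δ : G.Edge) (s : G.Edge → Bool) : Prop :=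
  s δ = false ∧ ∀ t, ∀ v ∈ G.corner t, v.Conserves s

/-- The number of solid curves: the components of the union of the edges labeled `1`. -/
def solidCurves (s : G.Edge → Bool) : ℕ :=
  classCount fun e e' : {e : G.Edge // s e = true} =>
    ∃ t, ∃ v ∈ G.corner t, e.1 ∈ v.edges ∧ e'.1 ∈ v.edges

/-- The sign of a state. -/
def sign (s : G.Edge → Bool) : K := (-1) ^ G.solidCurves s

/-- `∏ Wt(v; s)` over the vertices `v`. -/
def weight (s : G.Edge → Bool) : K :=
  ∏ t : Fin G.n,
    match G.corner t with
    | none => 1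
    | some v => v.wt G.mult s

/-! ### Rotation numbers -/

/-- The parallel copies of the edges: `c(e)` copies of every edge `e`, numbered from left to right
as seen when looking along the orientation of `e`. -/
abbrev Copy : Type := (e : G.Edge) × Fin (G.mult e).toNat

/-- The first copy enters a vertex and is continued there by the second one. -/
def CopyLink (x y : G.Copy) : Prop :=
  ∃ t, ∃ v ∈ G.corner t,
    match v with
    | .odd inn outL outR =>
        x.1 = inn ∧ ((y.1 = outL ∧ (x.2 : ℕ) = y.2) ∨
          (y.1 = outR ∧ (x.2 : ℕ) = (G.mult outL).toNat + y.2))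
    | .even out inL inR =>
        y.1 = out ∧ ((x.1 = inL ∧ (y.2 : ℕ) = x.2) ∨
          (x.1 = inR ∧ (y.2 : ℕ) = (G.mult inL).toNat + x.2))

/-- The oriented simple closed curves obtained by replacing every edge `e` with `c(e)` parallel
copies. -/
def Curve : Type := Quot G.CopyLink

instance : Finite G.Curve := inferInstanceAs (Finite (Quot G.CopyLink))

instance : Fintype G.Curve := Fintype.ofFinite _

variable {G} in
/-- The curve contains a copy of the edge `e`. -/
def Curve.Passes (C : G.Curve) (e : G.Edge) : Prop :=
  ∃ m, (Quot.mk _ ⟨e, m⟩ : G.Curve) = C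

variable {G} in
/-- A simple closed curve is clockwise if it points upward where it crosses a horizontal line for
the first time from the left (so that its interior lies to its right). -/
def Curve.Clockwise (C : G.Curve) : Prop :=
  ∃ p : G.Point, C.Passes (G.edge p) ∧
    (∀ i : Fin (G.level p.1).length, C.Passes (G.edge ⟨p.1, i⟩) → p.2 ≤ i) ∧
    (G.strand p).up = true

open scoped Classical in
variable {G} in
/-- The rotation number of a simple closed curve. -/
def Curve.rotation (C : G.Curve) : ℤ := if C.Clockwise then 1 else -1

open scoped Classical in
/-- `Rot(G, c, δ)`: the sum of the rotation numbers of the curves which are disjoint from the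
initial point on the edge `δ`. -/
def rot (δ : G.Edge) : ℤ := ∑ C : G.Curve with ¬ C.Passes δ, C.rotation

end Diagram

end

end ViroAlexander

/-! The morphism of the cut diagram is a sum over labelings of the points where the graph meets the
horizontal lines, and only labelings induced by conserved labelings of the edges contribute.
Renormalize `e₁` on downward strands by `-q ^ (2 c)`; these factors cancel between consecutive
slices because the first and the last line are empty. Every Boltzmann weight then becomes `q ^ (2 T)
* (-1) ^ T'` times the vertex weight of the state sum, where `T` is the turning of the parallel
copies of the edges in the slice and `T'` that of the solid edges (`entry_mul_gauge`). Globally,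
`T'` adds up to an odd number for every solid curve, which gives the sign of the state
(`neg_one_zpow_turn`), and `T` adds up to the sum of the rotation numbers of all parallel curves
(`turn_mult_eq`).

The two extrema that bend the cut ends contribute `q ^ (-2 σ j)`, where `σ = ± 1` says on which side
of the cut edge the unbounded region lies. All `j` parallel curves through an outermost edge have
rotation number `σ`, so this factor removes exactly them and leaves `Rot` (`rot_eq`). This settles
the case of an initial point at the cut.

To move the initial point, divide all vertex weights by their values in the zero state. The state
sum becomes a diagonal cofactor of a matrix `1 - A`, where `A` is the weighted adjacency matrix of
the points along the oriented graph: permutations that contribute to the cofactor are families of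
disjoint cycles avoiding the initial point. With `c` the multiplicity of an edge and `h` the height
(winding number) of the region on its left, `q ^ (2 h)` and `{2c} q ^ (2 (h + c))` span a left and a
right kernel vector, so the cofactors are proportional to their product `{2c} q ^ (2 (2 h + c))`
(`stateSum_mul_eq`). On an outermost edge `2 h + c = σ c`, which is exactly the change of `Rot` and
of the denominator.

Rotation numbers are controlled by the same heights. For a connected simple curve the region on its
left has a constant height `H`, equal to `0` or `-1`, and the rotation number is `2 H + 1`; the
turning of its extrema is computed by sweeping a line upward over systems of disjoint arcs
(`ArcWord.cap`, `exists_labeling`). -/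

namespace ViroAlexander

/-! ### Flows on a finite network and determinants -/

section Network

variable {P V F : Type} [Fintype P] [DecidableEq P] [DecidableEq V] [Field F]

/-- A set of points of a network (where `hd p` is the node that `p` enters, `tl p` the node that
it leaves) which runs through every node at most once. -/
structure IsFlow (hd tl : P → V) (s : P → Bool) : Prop where
  hd_inj : ∀ p p', s p = true → s p' = true → hd p = hd p' → p = p'
  tl_inj : ∀ p p', s p = true → s p' = true → tl p = tl p' → p = p'
  next : ∀ p, s p = true → ∃ p', s p' = true ∧ tl p' = hd p
  prev : ∀ p, s p = true → ∃ p', s p' = true ∧ hd p' = tl p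

/-- The permutation that moves every point of a flow to the next one. -/
structure IsNext (hd tl : P → V) (s : P → Bool) (σ : Equiv.Perm P) : Prop where
  moves : ∀ p, s p = true → tl (σ p) = hd p
  fixes : ∀ p, s p = false → σ p = p
  solid : ∀ p, s p = true → s (σ p) = true

variable {hd tl : P → V}

omit [DecidableEq P] [DecidableEq V] in
theorem IsFlow.exists_isNext {s : P → Bool} (hs : IsFlow hd tl s) : ∃ σ, IsNext hd tl s σ := by
  classical
  choose g hg hg' using hs.next
  let f : P → P := fun p => if h : s p = true then g p h else p
  have hf : Function.Injective f := by
    intro p p' h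
    by_cases h₁ : s p = true <;> by_cases h₂ : s p' = true
    · rw [show f p = g p h₁ from dif_pos h₁, show f p' = g p' h₂ from dif_pos h₂] at h
      exact hs.hd_inj p p' h₁ h₂ (by rw [← hg' p h₁, h, hg'])
    · rw [show f p = g p h₁ from dif_pos h₁, show f p' = p' from dif_neg h₂] at h
      exact absurd (h ▸ hg p h₁) h₂
    · rw [show f p = p from dif_neg h₁, show f p' = g p' h₂ from dif_pos h₂] at h
      exact absurd (h ▸ hg p' h₂) h₁
    · rwa [show f p = p from dif_neg h₁, show f p' = p' from dif_neg h₂] at h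
  refine ⟨Equiv.ofBijective f (Finite.injective_iff_bijective.1 hf), ?_, ?_, ?_⟩
  · intro p hp
    simp [f, hp, hg']
  · intro p hp
    simp [f, hp]
  · intro p hp
    simp [f, hp, hg]

omit [Fintype P] [DecidableEq P] [DecidableEq V] in
theorem IsNext.ne {s : P → Bool} {σ : Equiv.Perm P} (h : IsNext hd tl s σ)
    (hne : ∀ p, hd p ≠ tl p) {p : P} (hp : s p = true) : σ p ≠ p := by
  intro e
  have := h.moves p hp
  rw [e] at this
  exact hne p this.symm

omit [Fintype P] [DecidableEq P] [DecidableEq V] in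
theorem isNext_unique {s : P → Bool} (hs : IsFlow hd tl s) {σ τ : Equiv.Perm P}
    (h : IsNext hd tl s σ) (h' : IsNext hd tl s τ) : σ = τ := by
  ext p
  cases hp : s p
  · rw [h.fixes p hp, h'.fixes p hp]
  · exact hs.tl_inj _ _ (h.solid p hp) (h'.solid p hp) (by rw [h.moves p hp, h'.moves p hp])

omit [Fintype P] [DecidableEq V] in
theorem isFlow_of_perm (σ : Equiv.Perm P)
    (h : ∀ p, σ p ≠ p → tl (σ p) = hd p)
    (hh : ∀ p p', σ p ≠ p → σ p' ≠ p' → hd p = hd p' → p = p')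
    (ht : ∀ p p', σ p ≠ p → σ p' ≠ p' → tl p = tl p' → p = p') :
    IsFlow hd tl (fun p => decide (σ p ≠ p)) where
  hd_inj p p' h₁ h₂ := hh p p' (by simpa using h₁) (by simpa using h₂)
  tl_inj p p' h₁ h₂ := ht p p' (by simpa using h₁) (by simpa using h₂)
  next p hp := ⟨σ p, by simpa using hp, h p (by simpa using hp)⟩
  prev p hp := by
    refine ⟨σ.symm p, ?_, ?_⟩
    · simp only [ne_eq, decide_eq_true_eq, Equiv.apply_symm_apply] at hp ⊢
      intro e
      apply hp
      conv_lhs => rw [e]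
      simp
    · have := h (σ.symm p) (by
        simp only [ne_eq, decide_eq_true_eq, Equiv.apply_symm_apply] at hp ⊢
        intro e
        apply hp
        conv_lhs => rw [e]
        simp)
      rw [← this]
      simp

/-- The number of closed curves of a flow. -/
noncomputable def flowCurves (hd tl : P → V) (s : P → Bool) : ℕ :=
  classCount fun p p' : {p : P // s p = true} => hd p.1 = tl p'.1

omit [DecidableEq V] in
-- Sending a solid point to its cycle identifies the closed curves with the nontrivial cycles of the
-- successor permutation. No solid point is fixed, since `hd p ≠ tl p`.
theorem card_cycleType_eq_flowCurves (hne : ∀ p, hd p ≠ tl p) {s : P → Bool}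
    (hs : IsFlow hd tl s) {σ : Equiv.Perm P} (h : IsNext hd tl s σ) :
    Multiset.card σ.cycleType = flowCurves hd tl s := by
  classical
  have hsupp : ∀ p, p ∈ σ.support ↔ s p = true := by
    intro p
    rw [Equiv.Perm.mem_support]
    constructor
    · intro hp
      by_contra hc
      exact hp (h.fixes p (by simpa using hc))
    · exact h.ne hne
  let f : {p : P // s p = true} → {c // c ∈ σ.cycleFactorsFinset} := fun p =>
    ⟨σ.cycleOf p.1, Equiv.Perm.cycleOf_mem_cycleFactorsFinset_iff.2 ((hsupp _).2 p.2)⟩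
  have hf : ∀ p p' : {p : P // s p = true}, hd p.1 = tl p'.1 → f p = f p' := by
    intro p p' e
    have : σ p.1 = p'.1 :=
      hs.tl_inj _ _ (h.solid _ p.2) p'.2 (by rw [h.moves _ p.2, e])
    apply Subtype.ext
    change σ.cycleOf p.1 = σ.cycleOf p'.1
    rw [← this]
    exact (Equiv.Perm.SameCycle.cycleOf_eq
      ((Equiv.Perm.sameCycle_apply_left).2 (Equiv.Perm.SameCycle.refl σ _))).symm
  have hb : Function.Bijective (Quot.lift f hf) := by
    constructor
    · intro x y
      induction x using Quot.ind with | _ p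
      induction y using Quot.ind with | _ p'
      intro e
      have e' : σ.cycleOf p.1 = σ.cycleOf p'.1 := congrArg Subtype.val e
      have hsc : σ.SameCycle p.1 p'.1 := by
        have := ((Equiv.Perm.sameCycle_iff_cycleOf_eq_of_mem_support
          ((hsupp _).2 p.2) ((hsupp _).2 p'.2)).2 e')
        exact this
      obtain ⟨n, -, hn⟩ := hsc.exists_pow_eq'
      -- Walking `n` steps along the cycle stays in one class of the generated equivalence relation.
      have : ∀ (n : ℕ) (q : {p : P // s p = true}), (σ ^ n) p.1 = q.1 →
          (Quot.mk (fun p p' : {p : P // s p = true} => hd p.1 = tl p'.1) p) = Quot.mk _ q := by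
        intro n
        induction n with
        | zero =>
          intro q hq
          have : p = q := Subtype.ext (by simpa using hq)
          rw [this]
        | succ n ih =>
          intro q hq
          rw [pow_succ', Equiv.Perm.mul_apply] at hq
          have hr : s ((σ ^ n) p.1) = true := by
            rw [← hsupp, Equiv.Perm.mem_support, hq]
            intro e
            have : s q.1 = true := q.2
            rw [← hq] at e
            exact h.ne hne this (by rw [← hq]; exact congrArg σ e)
          rw [ih ⟨_, hr⟩ rfl]
          apply Quot.sound
          change hd ((σ ^ n) p.1) = tl q.1
          rw [← hq, h.moves _ hr]
      exact this n p' hn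
    · rintro ⟨c, hc⟩
      obtain ⟨p, hp⟩ := (Equiv.Perm.mem_cycleFactorsFinset_iff.1 hc).1.nonempty_support
      have hcp := Equiv.Perm.cycle_is_cycleOf hp hc
      have hp' : s p = true := by
        rw [← hsupp]
        exact Equiv.Perm.mem_cycleFactorsFinset_support_le hc hp
      exact ⟨Quot.mk _ ⟨p, hp'⟩, Subtype.ext hcp.symm⟩
  rw [flowCurves, classCount, Nat.card_congr (Equiv.ofBijective _ hb), Nat.card_eq_fintype_card,
    Fintype.card_coe, Equiv.Perm.cycleType_def]
  simp

/-- The weighted adjacency matrix of a network (columns: sources, rows: targets). -/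
def netMatrix (hd tl : P → V) (a b : P → F) : Matrix P P F :=
  1 - Matrix.of fun p' p => if hd p = tl p' then b p' * a p else 0

open scoped Classical in
/-- The state sum of a network over the flows which avoid the point `o`. -/
noncomputable def netSum (hd tl : P → V) (a b : P → F) (o : P) : F :=
  ∑ s : P → Bool with IsFlow hd tl s ∧ s o = false,
    (-1) ^ flowCurves hd tl s * ∏ p, if s p then a p * b p else 1

/-- A cycle of length `l` has sign `(-1) ^ (l - 1)`, and the lengths add up to the size of the
support, so each nontrivial cycle contributes `-1`. -/
theorem neg_one_pow_mul_sign (σ : Equiv.Perm P) :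
    ((-1 : F)) ^ σ.support.card * ((Equiv.Perm.sign σ : ℤ) : F) =
      (-1) ^ Multiset.card σ.cycleType := by
  rw [Equiv.Perm.sign_of_cycleType, ← Equiv.Perm.sum_cycleType]
  push_cast
  rw [← pow_add, ← add_assoc, pow_add, ← two_mul, pow_mul]
  simp

/-- This is the Leibniz expansion of the cofactor at `o`. A permutation with a nonzero term moves
every point either not at all or to a successor, and fixes `o`. By `hh` a node with two entering
points has at most one leaving point, so no two cycles can meet at a node, and the moved points form
a flow. -/
theorem adjugate_netMatrix_apply_self (hne : ∀ p, hd p ≠ tl p)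
    (hh : ∀ p p' r, hd p = hd p' → p ≠ p' → hd p = tl r → ∀ r', hd p = tl r' → r = r')
    (a b : P → F) (o : P) :
    (netMatrix hd tl a b).adjugate o o = netSum hd tl a b o := by
  classical
  -- Two moved points that enter the same node would have the same image by `hh`, against
  -- injectivity. For tails the argument is applied to the preimages under `σ`.
  have key : ∀ σ : Equiv.Perm P, (∀ p, σ p ≠ p → tl (σ p) = hd p) →
      IsFlow hd tl (fun p => decide (σ p ≠ p)) := by
    intro σ h
    refine isFlow_of_perm σ h ?_ ?_
    · intro p p' hp hp' e
      by_contra hc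
      have := hh p p' (σ p) e hc (h p hp).symm (σ p') (by rw [e, h p' hp'])
      exact hc (σ.injective this)
    · intro p p' hp hp' e
      have q : ∀ p, σ p ≠ p → σ (σ.symm p) ≠ σ.symm p := by
        intro p hp e
        apply hp
        rw [Equiv.apply_symm_apply] at e
        conv_lhs => rw [e]
        simp
      have e₁ := h _ (q p hp)
      have e₂ := h _ (q p' hp')
      rw [Equiv.apply_symm_apply] at e₁ e₂
      by_contra hc
      exact hc (hh _ _ p (by rw [← e₁, ← e₂, e]) (fun e => hc (σ.symm.injective e)) e₁.symm p'
        (by rw [← e₁, e]))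
  rw [Matrix.adjugate_apply, Matrix.det_apply', netSum]
  have hM : ∀ σ : Equiv.Perm P, ∀ p,
      ((netMatrix hd tl a b).updateRow o (Pi.single o 1)) (σ p) p ≠ 0 →
      (σ p ≠ p → tl (σ p) = hd p) ∧ (σ p = o → p = o) := by
    intro σ p hp
    by_cases ho : σ p = o
    · rw [ho, Matrix.updateRow_self] at hp
      have : p = o := by
        by_contra hc
        exact hp (by simp [hc])
      subst this
      exact ⟨fun h => absurd ho h, fun _ => rfl⟩
    · rw [Matrix.updateRow_ne ho, netMatrix, Matrix.sub_apply, Matrix.of_apply] at hp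
      refine ⟨fun h => ?_, fun h => absurd h ho⟩
      by_contra hc
      rw [Matrix.one_apply_ne h, if_neg (fun e => hc e.symm)] at hp
      simp at hp
  rw [← Finset.sum_filter_of_ne (p := fun σ : Equiv.Perm P =>
    (∀ p, σ p ≠ p → tl (σ p) = hd p) ∧ σ o = o)]
  swap
  · intro σ _ hσ
    have hp : ∀ p, ((netMatrix hd tl a b).updateRow o (Pi.single o 1)) (σ p) p ≠ 0 := by
      intro p hp
      exact hσ (mul_eq_zero_of_right _ (Finset.prod_eq_zero (Finset.mem_univ p) hp))
    refine ⟨fun p => (hM σ p (hp p)).1, ?_⟩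
    have := (hM σ (σ.symm o) (hp _)).2 (by simp)
    conv_lhs => rw [← this]
    simp
  have hnext : ∀ σ : Equiv.Perm P, (∀ p, σ p ≠ p → tl (σ p) = hd p) →
      IsNext hd tl (fun p => decide (σ p ≠ p)) σ := by
    intro σ h
    refine ⟨fun p hp => h p (by simpa using hp), fun p hp => by simpa using hp, fun p hp => ?_⟩
    simpa using hp
  refine Finset.sum_bij' (fun σ _ => fun p => decide (σ p ≠ p))
    (fun s hs => (IsFlow.exists_isNext (Finset.mem_filter.1 hs).2.1).choose) ?_ ?_ ?_ ?_ ?_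
  · intro σ hσ
    obtain ⟨-, h, ho⟩ := Finset.mem_filter.1 hσ
    exact Finset.mem_filter.2 ⟨Finset.mem_univ _, key σ h, by simpa using ho⟩
  · intro s hs
    have hn := (IsFlow.exists_isNext (Finset.mem_filter.1 hs).2.1).choose_spec
    refine Finset.mem_filter.2 ⟨Finset.mem_univ _, fun p hp => hn.moves p ?_,
      hn.fixes o (Finset.mem_filter.1 hs).2.2⟩
    by_contra hc
    exact hp (hn.fixes p (by simpa using hc))
  · intro σ hσ
    have hs := (key σ (Finset.mem_filter.1 hσ).2.1)
    exact isNext_unique hs (IsFlow.exists_isNext hs).choose_spec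
      (hnext σ (Finset.mem_filter.1 hσ).2.1)
  · intro s hs
    have hn := (IsFlow.exists_isNext (Finset.mem_filter.1 hs).2.1).choose_spec
    funext p
    cases hp : s p
    · simpa using hn.fixes p hp
    · simpa using hn.ne hne hp
  · intro σ hσ
    obtain ⟨-, h, ho⟩ := Finset.mem_filter.1 hσ
    rw [← card_cycleType_eq_flowCurves hne (key σ h) (hnext σ h), ← neg_one_pow_mul_sign,
      mul_comm ((-1 : F) ^ _), mul_assoc]
    congr 1
    -- Fixed points give the factor `1`: the network has no loops, and row `o` has been replaced by
    -- a unit vector.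
    have e₁ : ∀ p, ((netMatrix hd tl a b).updateRow o (Pi.single o 1)) (σ p) p =
        if σ p ≠ p then -(b (σ p) * a p) else 1 := by
      intro p
      by_cases hp : σ p = p
      · rw [hp]
        simp only [ne_eq, not_true_eq_false, if_false]
        by_cases hpo : p = o
        · subst hpo
          simp
        · rw [Matrix.updateRow_ne hpo, netMatrix, Matrix.sub_apply, Matrix.of_apply,
            if_neg (hne p)]
          simp
      · have hpo : σ p ≠ o := by
          intro e
          exact hp (by rw [e]; exact σ.injective (ho.trans e.symm))
        rw [Matrix.updateRow_ne hpo, netMatrix, Matrix.sub_apply, Matrix.of_apply,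
          if_pos (h p hp).symm, Matrix.one_apply_ne hp, if_pos hp]
        ring
    have e₂ : ∏ p, (if σ p ≠ p then b (σ p) else 1) = ∏ p, if σ p ≠ p then b p else 1 := by
      rw [← Equiv.prod_comp σ (fun p => if σ p ≠ p then b p else 1)]
      exact Finset.prod_congr rfl fun p _ => by simp
    have e₃ : ∏ p, (if σ p ≠ p then (-1 : F) else 1) = (-1) ^ σ.support.card := by
      rw [Finset.prod_ite, Finset.prod_const, Finset.prod_const_one, mul_one]
      rfl
    rw [Finset.prod_congr rfl fun p _ => e₁ p]
    have e₄ : ∀ p, (if σ p ≠ p then -(b (σ p) * a p) else 1) = (if σ p ≠ p then (-1 : F) else 1) *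
        ((if σ p ≠ p then b (σ p) else 1) * (if σ p ≠ p then a p else 1)) := by
      intro p
      split_ifs <;> ring
    rw [Finset.prod_congr rfl fun p _ => e₄ p, Finset.prod_mul_distrib, Finset.prod_mul_distrib,
      e₂, e₃, ← Finset.prod_mul_distrib]
    congr 1
    refine Finset.prod_congr rfl fun p _ => ?_
    by_cases hp : σ p = p <;> simp [hp, mul_comm]

/-- If a matrix has kernel vectors `y` and `x` (on both sides) without zero entries, then the
entries of its adjugate are proportional to the products of the entries of `y` and `x`. -/
theorem adjugate_apply_mul_eq (M : Matrix P P F) (x y : P → F) (hx : ∀ p, x p ≠ 0)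
    (hy : ∀ p, y p ≠ 0) (hyM : M.mulVec y = 0) (hxM : M.vecMul x = 0) (p r : P) :
    M.adjugate p p * (x r * y r) = M.adjugate r r * (x p * y p) := by
  have h₁ : ∀ (M : Matrix P P F) (y : P → F), (∀ p, y p ≠ 0) → M.mulVec y = 0 → ∀ p r o,
      y r * M.adjugate p o = y p * M.adjugate r o := by
    intro M y hy hyM p r o
    -- The new row `y r • e_p - y p • e_r` annihilates `y`, as do the old rows, so the matrix is
    -- singular. Linearity in this row gives the relation between the two cofactors.
    have : (M.updateRow o (y r • Pi.single p 1 + (-y p) • Pi.single r 1)).det = 0 := by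
      rw [← Matrix.exists_mulVec_eq_zero_iff]
      refine ⟨y, fun h => hy o (congrFun h o), ?_⟩
      funext i
      by_cases hi : i = o
      · subst hi
        rw [Matrix.mulVec, Matrix.updateRow_self, add_dotProduct, smul_dotProduct, smul_dotProduct,
          single_dotProduct, single_dotProduct, smul_eq_mul, smul_eq_mul, Pi.zero_apply]
        ring
      · have := congrFun hyM i
        rw [Matrix.mulVec, Matrix.updateRow_ne hi]
        exact this
    rw [Matrix.det_updateRow_add, Matrix.det_updateRow_smul, Matrix.det_updateRow_smul,
      ← Matrix.adjugate_apply, ← Matrix.adjugate_apply] at this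
    linear_combination this
  -- The cofactors at `p` and at `r` are compared through the off-diagonal entry `(r, p)`, with `y`
  -- along the column and, after transposition, with `x` along the row.
  have h₂ := h₁ M y hy hyM p r p
  have h₃ := h₁ M.transpose x hx (by rw [Matrix.mulVec_transpose, hxM]) p r r
  rw [← Matrix.adjugate_transpose, Matrix.transpose_apply, Matrix.transpose_apply] at h₃
  linear_combination (x r) * h₂ + (y p) * h₃

/-- The state sums of a network with kernel vectors. -/
theorem netSum_mul_eq (hne : ∀ p, hd p ≠ tl p)
    (hh : ∀ p p' r, hd p = hd p' → p ≠ p' → hd p = tl r → ∀ r', hd p = tl r' → r = r')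
    (a b x y : P → F) (hx : ∀ p, x p ≠ 0) (hy : ∀ p, y p ≠ 0)
    (hxa : ∀ p, x p = a p * ∑ r, if tl r = hd p then b r * x r else 0)
    (hyb : ∀ p, y p = b p * ∑ r, if hd r = tl p then a r * y r else 0) (p r : P) :
    netSum hd tl a b p * (x r * y r) = netSum hd tl a b r * (x p * y p) := by
  rw [← adjugate_netMatrix_apply_self hne hh, ← adjugate_netMatrix_apply_self hne hh]
  refine adjugate_apply_mul_eq _ x y hx hy ?_ ?_ p r
  · rw [netMatrix, Matrix.sub_mulVec, Matrix.one_mulVec]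
    funext p
    rw [Pi.sub_apply, Pi.zero_apply, sub_eq_zero, hyb p, Matrix.mulVec, dotProduct, Finset.mul_sum]
    refine Finset.sum_congr rfl fun r _ => ?_
    rw [Matrix.of_apply]
    split_ifs <;> ring
  · rw [netMatrix, Matrix.vecMul_sub, Matrix.vecMul_one]
    funext p
    rw [Pi.sub_apply, Pi.zero_apply, sub_eq_zero, hxa p, Matrix.vecMul, dotProduct, Finset.mul_sum]
    refine Finset.sum_congr rfl fun r _ => ?_
    rw [Matrix.of_apply]
    by_cases h : tl r = hd p
    · rw [if_pos h, if_pos h.symm]; ring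
    · rw [if_neg h, if_neg (fun e => h e.symm)]; ring

end Network

/-! ### The levels of a diagram -/

/-- The strands of a piece with the edges on which they lie, and the vertex of the piece. -/
inductive PieceLevels {E : Type} :
    Piece → List (Strand × E) → List (Strand × E) → Option (Corner E) → Prop
  | cup (l : Strand) (e : E) : PieceLevels (.cup l) [] [(l, e), (l.rev, e)] none
  | cap (l : Strand) (e : E) : PieceLevels (.cap l) [(l, e), (l.rev, e)] [] none
  | split (b l r : Strand) (e₀ e₁ e₂ : E) :
      PieceLevels (.split b l r) [(b, e₀)] [(l, e₁), (r, e₂)]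
        (Corner.ofClockwise e₀ e₁ e₂ (!b.up) l.up r.up)
  | merge (l r t : Strand) (e₀ e₁ e₂ : E) :
      PieceLevels (.merge l r t) [(l, e₁), (r, e₂)] [(t, e₀)]
        (Corner.ofClockwise e₀ e₂ e₁ t.up (!r.up) (!l.up))

namespace Diagram

variable (G : Diagram)

/-- The strands of a level with the edges on which they lie. -/
def lev (t : Fin (G.n + 1)) : List (Strand × G.Edge) :=
  List.ofFn fun i => (G.strand ⟨t, i⟩, G.edge ⟨t, i⟩)

@[simp] theorem length_lev (t : Fin (G.n + 1)) : (G.lev t).length = (G.level t).length := by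
  simp [lev]

theorem mult_of_mem_lev {t : Fin (G.n + 1)} {x : Strand × G.Edge} (hx : x ∈ G.lev t) :
    G.mult x.2 = x.1.mult := by
  obtain ⟨i, rfl⟩ := (List.mem_ofFn' _ _).1 hx
  rfl

theorem length_level_castSucc (t : Fin G.n) : (G.level t.castSucc).length =
    (G.slice t).left.length + (G.slice t).piece.bot.length + (G.slice t).right.length := by
  rw [G.level_castSucc, Slice.bot, List.length_append, List.length_append, add_assoc]

theorem length_level_succ (t : Fin G.n) : (G.level t.succ).length =
    (G.slice t).left.length + (G.slice t).piece.top.length + (G.slice t).right.length := by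
  rw [G.level_succ, Slice.top, List.length_append, List.length_append, add_assoc]

theorem edge_through (t : Fin G.n) (i i' : ℕ) (h : i < (G.level t.castSucc).length)
    (h' : i' < (G.level t.succ).length) (hi : (G.slice t).Through i i') :
    G.edge ⟨t.castSucc, i, h⟩ = G.edge ⟨t.succ, i', h'⟩ :=
  Quot.sound ⟨t, .inl ⟨rfl, rfl, hi⟩⟩

theorem topEdge_cup (t : Fin G.n) (l : Strand) (hl : (G.slice t).piece = .cup l)
    (h₀ : 0 < (G.slice t).piece.top.length) (h₁ : 1 < (G.slice t).piece.top.length) :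
    G.topEdge t 0 h₀ = G.topEdge t 1 h₁ :=
  Quot.sound ⟨t, .inr (.inr ⟨rfl, rfl, ⟨l, hl⟩, rfl, rfl⟩)⟩

theorem botEdge_cap (t : Fin G.n) (l : Strand) (hl : (G.slice t).piece = .cap l)
    (h₀ : 0 < (G.slice t).piece.bot.length) (h₁ : 1 < (G.slice t).piece.bot.length) :
    G.botEdge t 0 h₀ = G.botEdge t 1 h₁ :=
  Quot.sound ⟨t, .inr (.inl ⟨rfl, rfl, ⟨l, hl⟩, rfl, rfl⟩)⟩

/-- The bottom strands of a piece with their edges. -/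
def botLev (t : Fin G.n) : List (Strand × G.Edge) :=
  List.ofFn fun k : Fin (G.slice t).piece.bot.length =>
    ((G.slice t).piece.bot.get k, G.botEdge t k k.2)

/-- The top strands of a piece with their edges. -/
def topLev (t : Fin G.n) : List (Strand × G.Edge) :=
  List.ofFn fun k : Fin (G.slice t).piece.top.length =>
    ((G.slice t).piece.top.get k, G.topEdge t k k.2)

/-- Encodes all local information on a slice in an inductive relation that no longer mentions the
diagram, so that later local claims can be settled by cases on the piece. -/
theorem pieceLevels (t : Fin G.n) :
    PieceLevels (G.slice t).piece (G.botLev t) (G.topLev t) (G.corner t) := by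
  have key : ∀ P, (G.slice t).piece = P → PieceLevels P (G.botLev t) (G.topLev t) (G.corner t) := by
    intro P hP
    have hb : ∀ (h : P.bot.length = (G.slice t).piece.bot.length), G.botLev t =
        List.ofFn fun k : Fin P.bot.length =>
          (P.bot.get k, G.botEdge t k (h ▸ k.2)) := by
      subst hP
      intro h
      rfl
    have ht : ∀ (h : P.top.length = (G.slice t).piece.top.length), G.topLev t =
        List.ofFn fun k : Fin P.top.length =>
          (P.top.get k, G.topEdge t k (h ▸ k.2)) := by
      subst hP
      intro h
      rfl
    have hb := hb (by rw [hP])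
    have ht := ht (by rw [hP])
    have hc : ∀ Q, (G.slice t).piece = Q → P = Q := fun Q h => hP.symm.trans h
    cases P with
    | cup l =>
      have e₁ : G.botLev t = [] := by rw [hb]; rfl
      have e₂ : G.topLev t = [(l, G.topEdge t 0 (by rw [hP]; simp [Piece.top])),
          (l.rev, G.topEdge t 1 (by rw [hP]; simp [Piece.top]))] := by rw [ht]; rfl
      have e₃ : G.corner t = none := by
        unfold corner
        split <;> rename_i h <;> simp [hP] at h <;> rfl
      rw [e₁, e₂, e₃, G.topEdge_cup t l hP]
      exact .cup _ _
    | cap l =>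
      have e₁ : G.topLev t = [] := by rw [ht]; rfl
      have e₂ : G.botLev t = [(l, G.botEdge t 0 (by rw [hP]; simp [Piece.bot])),
          (l.rev, G.botEdge t 1 (by rw [hP]; simp [Piece.bot]))] := by rw [hb]; rfl
      have e₃ : G.corner t = none := by
        unfold corner
        split <;> rename_i h <;> simp [hP] at h <;> rfl
      rw [e₁, e₂, e₃, G.botEdge_cap t l hP]
      exact .cap _ _
    | split b l r =>
      have e₁ : G.botLev t = [(b, G.botEdge t 0 (by rw [hP]; simp [Piece.bot]))] := by
        rw [hb]; rfl
      have e₂ : G.topLev t = [(l, G.topEdge t 0 (by rw [hP]; simp [Piece.top])),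
          (r, G.topEdge t 1 (by rw [hP]; simp [Piece.top]))] := by rw [ht]; rfl
      have e₃ : G.corner t = Corner.ofClockwise (G.botEdge t 0 (by rw [hP]; simp [Piece.bot]))
          (G.topEdge t 0 (by rw [hP]; simp [Piece.top]))
          (G.topEdge t 1 (by rw [hP]; simp [Piece.top])) (!b.up) l.up r.up := by
        unfold corner
        split <;> rename_i h <;> rw [hP] at h <;> cases h <;> rfl
      rw [e₁, e₂, e₃]
      exact .split _ _ _ _ _ _
    | merge l r u =>
      have e₁ : G.topLev t = [(u, G.topEdge t 0 (by rw [hP]; simp [Piece.top]))] := by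
        rw [ht]; rfl
      have e₂ : G.botLev t = [(l, G.botEdge t 0 (by rw [hP]; simp [Piece.bot])),
          (r, G.botEdge t 1 (by rw [hP]; simp [Piece.bot]))] := by rw [hb]; rfl
      have e₃ : G.corner t = Corner.ofClockwise (G.topEdge t 0 (by rw [hP]; simp [Piece.top]))
          (G.botEdge t 1 (by rw [hP]; simp [Piece.bot]))
          (G.botEdge t 0 (by rw [hP]; simp [Piece.bot])) u.up (!r.up) (!l.up) := by
        unfold corner
        split <;> rename_i h <;> rw [hP] at h <;> cases h <;> rfl
      rw [e₁, e₂, e₃]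
      exact .merge _ _ _ _ _ _
  exact key _ rfl

/-- The strands to the left of a piece with their edges. -/
def leftLev (t : Fin G.n) : List (Strand × G.Edge) :=
  (G.lev t.castSucc).take (G.slice t).left.length

/-- The strands to the right of a piece with their edges. -/
def rightLev (t : Fin G.n) : List (Strand × G.Edge) :=
  (G.lev t.castSucc).drop ((G.slice t).left.length + (G.slice t).piece.bot.length)

@[simp] theorem length_leftLev (t : Fin G.n) :
    (G.leftLev t).length = (G.slice t).left.length := by
  simp [leftLev, length_level_castSucc]; omega

@[simp] theorem length_rightLev (t : Fin G.n) :
    (G.rightLev t).length = (G.slice t).right.length := by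
  simp [rightLev, length_level_castSucc]

@[simp] theorem length_botLev (t : Fin G.n) :
    (G.botLev t).length = (G.slice t).piece.bot.length := by
  simp [botLev]

@[simp] theorem length_topLev (t : Fin G.n) :
    (G.topLev t).length = (G.slice t).piece.top.length := by
  simp [topLev]

/-- Together with `lev_succ` this says that consecutive lines carry the same strands on the same
edges outside the piece; comparisons of two lines therefore reduce to the piece. -/
theorem lev_castSucc (t : Fin G.n) :
    G.lev t.castSucc = G.leftLev t ++ (G.botLev t ++ G.rightLev t) := by
  have h : G.botLev t =
      ((G.lev t.castSucc).drop (G.slice t).left.length).take (G.slice t).piece.bot.length := by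
    apply List.ext_getElem
    · simp [length_level_castSucc]
      omega
    · intro i h₁ h₂
      rw [length_botLev] at h₁
      rw [List.getElem_take, List.getElem_drop]
      simp only [botLev, lev, List.getElem_ofFn, botEdge, Prod.mk.injEq, and_true]
      have := G.strand_eq ⟨t.castSucc, ⟨(G.slice t).left.length + i, by
        rw [length_level_castSucc]; omega⟩⟩ (G.level_castSucc t)
      simp only [Slice.bot] at this
      rw [List.getElem?_append_right (by omega), Nat.add_sub_cancel_left,
        List.getElem?_append_left h₁, List.getElem?_eq_getElem h₁] at this
      simpa using Option.some.inj this
  rw [h, leftLev, rightLev, ← List.drop_drop, List.take_append_drop, List.take_append_drop]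

theorem lev_succ (t : Fin G.n) :
    G.lev t.succ = G.leftLev t ++ (G.topLev t ++ G.rightLev t) := by
  apply List.ext_getElem
  · simp [length_level_succ]
    omega
  · intro i h₁ h₂
    have hi : i < (G.slice t).left.length + (G.slice t).piece.top.length +
        (G.slice t).right.length := by
      rwa [length_lev, length_level_succ] at h₁
    have hs := G.strand_eq ⟨t.succ, ⟨i, by rwa [length_lev] at h₁⟩⟩ (G.level_succ t)
    simp only [Slice.top] at hs
    rcases lt_or_ge i (G.slice t).left.length with hl | hl
    · rw [List.getElem_append_left (by simpa using hl)]
      have hlt : i < (G.level t.castSucc).length := by rw [length_level_castSucc]; omega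
      have hs' := G.strand_eq ⟨t.castSucc, ⟨i, hlt⟩⟩ (G.level_castSucc t)
      simp only [Slice.bot] at hs'
      rw [List.getElem?_append_left hl] at hs hs'
      simp only [lev, leftLev, List.getElem_ofFn, List.getElem_take, Prod.mk.injEq]
      exact ⟨Option.some.inj (hs.symm.trans hs'),
        (G.edge_through t i i hlt (by simpa using h₁) (.inl ⟨hl, rfl⟩)).symm⟩
    · rw [List.getElem_append_right (by simpa using hl)]
      rw [List.getElem?_append_right hl] at hs
      rcases lt_or_ge (i - (G.slice t).left.length) (G.slice t).piece.top.length with hm | hm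
      · rw [List.getElem_append_left (by simpa using hm)]
        rw [List.getElem?_append_left hm, List.getElem?_eq_getElem hm] at hs
        simp only [lev, topLev, List.getElem_ofFn, topEdge, Prod.mk.injEq, length_leftLev]
        refine ⟨(Option.some.inj hs).symm, ?_⟩
        congr 3
        omega
      · rw [List.getElem_append_right (by simpa using hm)]
        rw [List.getElem?_append_right hm] at hs
        have hlt : (G.slice t).left.length + (G.slice t).piece.bot.length +
          (i - (G.slice t).left.length - (G.slice t).piece.top.length) <
            (G.level t.castSucc).length := by rw [length_level_castSucc]; omega
        have hs' := G.strand_eq ⟨t.castSucc, ⟨_, hlt⟩⟩ (G.level_castSucc t)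
        simp only [Slice.bot] at hs'
        rw [List.getElem?_append_right (by omega), List.getElem?_append_right (by omega)] at hs'
        simp only [lev, rightLev, List.getElem_ofFn, List.getElem_drop, Prod.mk.injEq,
          length_leftLev, length_topLev]
        constructor
        · refine Option.some.inj (hs.symm.trans (Eq.trans ?_ hs'))
          congr 1
          omega
        · refine (G.edge_through t _ _ hlt (by simpa using h₁)
            (.inr ⟨i - (G.slice t).left.length - (G.slice t).piece.top.length, rfl, ?_⟩)).symm
          omega

theorem lev_zero : G.lev 0 = [] :=
  List.eq_nil_of_length_eq_zero (by simp [G.level_zero])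

theorem lev_last : G.lev (Fin.last G.n) = [] :=
  List.eq_nil_of_length_eq_zero (by simp [G.level_last])

theorem exists_mem_lev (e : G.Edge) : ∃ t, ∃ x ∈ G.lev t, x.2 = e := by
  induction e using Quot.ind with | _ p
  exact ⟨p.1, (G.strand p, G.edge p), (List.mem_ofFn' _ _).2 ⟨p.2, rfl⟩, rfl⟩

/-- A labeling of the strands of all levels that is compatible with the slices comes from a
labeling of the edges. -/
theorem exists_edge_labeling {X : Type} (w : Fin (G.n + 1) → List X)
    (hw : ∀ t, (w t).length = (G.level t).length)
    (hs : ∀ t : Fin G.n, ∃ A B C D, A.length = (G.slice t).left.length ∧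
      B.length = (G.slice t).piece.bot.length ∧ C.length = (G.slice t).piece.top.length ∧
      w t.castSucc = A ++ (B ++ D) ∧ w t.succ = A ++ (C ++ D) ∧
      ((∃ l, (G.slice t).piece = .cup l) → ∃ x, C = [x, x]) ∧
      ((∃ l, (G.slice t).piece = .cap l) → ∃ x, B = [x, x])) :
    ∃ φ : G.Edge → X, ∀ t, w t = (G.lev t).map fun x => φ x.2 := by
  let ψ : G.Point → X := fun p => (w p.1)[(p.2 : ℕ)]'(by rw [hw]; exact p.2.2)
  have hψ : ∀ p : G.Point, ∀ L, w p.1 = L → L[(p.2 : ℕ)]? = some (ψ p) := by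
    rintro p L rfl
    exact List.getElem?_eq_getElem _
  refine ⟨Quot.lift ψ ?_, ?_⟩
  · intro p p' hl
    apply Option.some.inj
    obtain ⟨t, ht⟩ := hl
    obtain ⟨A, B, C, D, hA, hB, hC, hb, hc, hcup, hcap⟩ := hs t
    rcases ht with ⟨h₁, h₂, h₃⟩ | ⟨h₁, h₂, h₃, h₄, h₅⟩ | ⟨h₁, h₂, h₃, h₄, h₅⟩
    · rw [← hψ p _ (h₁ ▸ hb), ← hψ p' _ (h₂ ▸ hc)]
      rcases h₃ with ⟨h, h'⟩ | ⟨k, h, h'⟩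
      · rw [h', List.getElem?_append_left (by omega), List.getElem?_append_left (by omega)]
      · rw [h, h', List.getElem?_append_right (by omega), List.getElem?_append_right (by omega),
          List.getElem?_append_right (by omega), List.getElem?_append_right (by omega)]
        congr 1
        omega
    · rw [← hψ p _ (h₁ ▸ hb), ← hψ p' _ (h₂ ▸ hb)]
      obtain ⟨x, rfl⟩ := hcap h₃
      rw [h₄, h₅, ← hA]
      simp
    · rw [← hψ p _ (h₁ ▸ hc), ← hψ p' _ (h₂ ▸ hc)]
      obtain ⟨x, rfl⟩ := hcup h₃
      rw [h₄, h₅, ← hA]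
      simp
  · intro t
    apply List.ext_getElem
    · simp [hw]
    · intro i h₁ h₂
      simp only [lev, List.map_ofFn, List.getElem_ofFn]
      rfl

end Diagram

/-! ### The morphism of a cut diagram as a state sum -/

/-- Iterated product of matrices indexed by words, applied to a function of words. -/
noncomputable def chain :
    List (ℕ × (List Bool → List Bool → K)) → (List Bool → K) → List Bool → K
  | [], Ψ, x => Ψ x
  | (m, E) :: S, Ψ, x => ∑ z : Fin m → Bool, E x (List.ofFn z) * chain S Ψ (List.ofFn z)

/-- The matrix of a slice, together with the length of the words on its top line. -/
noncomputable def Slice.link (s : Slice) : ℕ × (List Bool → List Bool → K) :=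
  (s.top.length, s.entry)

theorem chain_append (S T : List (ℕ × (List Bool → List Bool → K))) (Ψ : List Bool → K)
    (x : List Bool) : chain (S ++ T) Ψ x = chain S (chain T Ψ) x := by
  induction S generalizing x with
  | nil => rfl
  | cons e S ih =>
    obtain ⟨m, E⟩ := e
    simp only [List.cons_append, chain, ih]

theorem chain_congr (S : List (ℕ × (List Bool → List Bool → K))) (Ψ Ψ' : List Bool → K) (ℓ : ℕ)
    (x : List Bool) (h₀ : S = [] → x.length = ℓ) (h₁ : ∀ e ∈ S.getLast?, e.1 = ℓ)
    (h : ∀ z, z.length = ℓ → Ψ z = Ψ' z) : chain S Ψ x = chain S Ψ' x := by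
  induction S generalizing x with
  | nil => exact h _ (h₀ rfl)
  | cons e S ih =>
    obtain ⟨m, E⟩ := e
    simp only [chain]
    refine Finset.sum_congr rfl fun z _ => ?_
    rw [ih]
    · intro hS
      subst hS
      simpa using h₁
    · intro e he
      apply h₁
      rw [List.getLast?_cons]
      simp only [Option.mem_def] at he ⊢
      rw [he]
      rfl

theorem Slice.length_addLeft_top (b : Strand) (s : Slice) :
    (s.addLeft b).top.length = s.top.length + 1 := by
  simp [addLeft, top]

theorem Slice.addLeft_entry (b : Strand) (s : Slice) (c d : Bool) (x y : List Bool) :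
    (s.addLeft b).entry (c :: x) (d :: y) = if c = d then s.entry x y else 0 := by
  by_cases h : c = d
  · subst h
    have e : ∀ m, s.left.length + 1 + m = s.left.length + m + 1 := fun m => by omega
    simp [entry, addLeft, bot, top, e]
  · rw [if_neg h, entry, if_neg]
    rintro ⟨-, -, h', -⟩
    simp [addLeft, h] at h'

/-- The added vertical segment is an identity factor, so its label `c` is transported unchanged
through all slices of `S`. -/
theorem morphism_map_addLeft (b : Strand) (S R : List Slice) (c : Bool) (x y : List Bool) :
    morphism (S.map (Slice.addLeft b) ++ R) (c :: x) y =
      chain (S.map Slice.link) (fun z => morphism R (c :: z) y) x := by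
  induction S generalizing x with
  | nil => rfl
  | cons s S ih =>
    simp only [List.map_cons, List.cons_append, morphism, chain, Slice.link]
    have key : ∀ (m : ℕ) (hm : m = s.top.length + 1) (f : List Bool → K),
        ∑ z : Fin m → Bool, f (List.ofFn z) =
          ∑ d : Bool, ∑ z : Fin s.top.length → Bool, f (d :: List.ofFn z) := by
      rintro m rfl f
      rw [← (Fin.consEquiv fun _ => Bool).sum_comp, Fintype.sum_prod_type]
      refine Finset.sum_congr rfl fun d _ => Finset.sum_congr rfl fun z _ => ?_
      simp [Fin.consEquiv, List.ofFn_succ]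
    rw [key _ (Slice.length_addLeft_top b s) (fun z => (s.addLeft b).entry (c :: x) z *
      morphism (S.map (Slice.addLeft b) ++ R) z y)]
    simp only [Slice.addLeft_entry, ite_mul, zero_mul]
    rw [Finset.sum_eq_single c (fun d _ hd => by simp [hd.symm]) (by simp)]
    refine Finset.sum_congr rfl fun z _ => ?_
    rw [if_pos rfl, ih]

/-- The maximum forces the added segment and the leftmost strand of the cut line to agree, and the
minimum recreates both with a common label `d`; the other strands `w` pass unchanged. -/
theorem morphism_cap_cup (b : Strand) (L : List Strand) (R : List Slice) (c c' : Bool)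
    (w y : List Bool) (hw : w.length = L.length) :
    morphism (⟨[], .cap b, L⟩ :: ⟨[], .cup b, L⟩ :: R) (c :: c' :: w) y =
      if c = c' then capWeight b c * ∑ d, cupWeight b d * morphism R (d :: d :: w) y else 0 := by
  have h₁ : ∀ z : List Bool, z.length = L.length →
      Slice.entry ⟨[], .cap b, L⟩ (c :: c' :: w) z =
        if z = w then (if c = c' then capWeight b c else 0) else 0 := by
    intro z hz
    by_cases h : z = w
    · subst h
      simp [Slice.entry, Slice.bot, Slice.top, Piece.bot, Piece.top, Piece.entry, hz]
    · rw [if_neg h, Slice.entry, if_neg]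
      simp [Piece.bot, Piece.top]
      exact fun _ _ e => h e.symm
  have h₂ : ∀ (d d' : Bool) (z : List Bool), z.length = L.length →
      Slice.entry ⟨[], .cup b, L⟩ w (d :: d' :: z) =
        if z = w then (if d = d' then cupWeight b d else 0) else 0 := by
    intro d d' z hz
    by_cases h : z = w
    · subst h
      simp [Slice.entry, Slice.bot, Slice.top, Piece.bot, Piece.top, Piece.entry, hz]
    · rw [if_neg h, Slice.entry, if_neg]
      simp [Piece.bot, Piece.top]
      exact fun _ _ e => h e.symm
  have k₁ : ∀ (m : ℕ) (_ : m = L.length) (f : List Bool → K),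
      (∀ z : List Bool, z.length = L.length → z ≠ w → f z = 0) →
      ∑ z : Fin m → Bool, f (List.ofFn z) = f w := by
    rintro m rfl f hf
    obtain ⟨w', rfl⟩ : ∃ w' : Fin L.length → Bool, w = List.ofFn w' :=
      ⟨fun i => w.get (i.cast hw.symm), by
        apply List.ext_getElem <;> simp [hw]⟩
    rw [Finset.sum_eq_single w']
    · intro z _ hz
      exact hf _ (by simp) fun e => hz (List.ofFn_injective e)
    · simp
  have k₂ : ∀ (m : ℕ) (_ : m = L.length + 2) (f : List Bool → K),
      ∑ z : Fin m → Bool, f (List.ofFn z) =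
        ∑ d : Bool, ∑ d' : Bool, ∑ z : Fin L.length → Bool, f (d :: d' :: List.ofFn z) := by
    rintro m rfl f
    rw [← (Fin.consEquiv fun _ => Bool).sum_comp, Fintype.sum_prod_type]
    refine Finset.sum_congr rfl fun d _ => ?_
    rw [← (Fin.consEquiv fun _ => Bool).sum_comp, Fintype.sum_prod_type]
    refine Finset.sum_congr rfl fun d' _ => Finset.sum_congr rfl fun z _ => ?_
    simp [Fin.consEquiv, List.ofFn_succ]
  rw [morphism, k₁ _ (by simp [Slice.top, Piece.top])
    (fun z => Slice.entry ⟨[], .cap b, L⟩ (c :: c' :: w) z *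
      morphism (⟨[], .cup b, L⟩ :: R) z y)]
  swap
  · intro z hz hzw
    simp only [h₁ z hz, if_neg hzw, zero_mul]
  simp only [h₁ w hw, if_true]
  by_cases hc : c = c'
  · rw [if_pos hc, if_pos hc, morphism]
    congr 1
    rw [k₂ _ (by simp [Slice.top, Piece.top])
      (fun z => Slice.entry ⟨[], .cup b, L⟩ w z * morphism R z y)]
    refine Finset.sum_congr rfl fun d _ => ?_
    rw [Finset.sum_eq_single d]
    · rw [k₁ _ rfl (fun z => Slice.entry ⟨[], .cup b, L⟩ w (d :: d :: z) *
        morphism R (d :: d :: z) y)]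
      · simp only [h₂ d d w hw, if_true]
      · intro z hz hzw
        simp only [h₂ d d z hz, if_neg hzw, zero_mul]
    · intro d' _ hd
      refine Finset.sum_eq_zero fun z _ => ?_
      rw [h₂ d d' _ (by simp), if_neg hd.symm]
      simp
    · simp
  · rw [if_neg hc, if_neg hc, zero_mul]

/-- Expands an iterated matrix product into a sum over all labelings of all lines. The left factor
`g` is there for the induction. -/
theorem sum_chain (n : ℕ) : ∀ (len : Fin (n + 1) → ℕ)
    (E : Fin n → List Bool → List Bool → K) (Ω g : List Bool → K),
    ∑ X : ∀ j, Fin (len j) → Bool, g (List.ofFn (X 0)) *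
        (∏ i : Fin n, E i (List.ofFn (X i.castSucc)) (List.ofFn (X i.succ))) *
        Ω (List.ofFn (X (Fin.last n))) =
      ∑ x : Fin (len 0) → Bool, g (List.ofFn x) *
        chain (List.ofFn fun i => (len i.succ, E i)) Ω (List.ofFn x) := by
  induction n with
  | zero =>
    intro len E Ω g
    rw [← (Fin.consEquiv fun j => Fin (len j) → Bool).sum_comp, Fintype.sum_prod_type]
    refine Finset.sum_congr rfl fun x _ => ?_
    simp [chain, Fin.consEquiv]
  | succ n ih =>
    intro len E Ω g
    rw [← (Fin.consEquiv fun j => Fin (len j) → Bool).sum_comp, Fintype.sum_prod_type,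
      Finset.sum_comm]
    -- The first matrix, summed over the words on line `0`, is absorbed into the left factor.
    have := ih (fun j => len j.succ) (fun i => E i.succ) Ω
      (fun z => ∑ x : Fin (len 0) → Bool, g (List.ofFn x) * E 0 (List.ofFn x) z)
    refine Eq.trans ?_ (this.trans ?_)
    · refine Finset.sum_congr rfl fun X _ => ?_
      rw [Finset.sum_mul, Finset.sum_mul]
      refine Finset.sum_congr rfl fun x _ => ?_
      rw [Fin.prod_univ_succ]
      simp only [Fin.consEquiv, Equiv.coe_fn_mk, Fin.cons_succ, Fin.cons_zero, Fin.castSucc_zero,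
        ← Fin.succ_last, Fin.castSucc_succ]
      ring
    · rw [List.ofFn_succ]
      simp only [chain, Finset.sum_mul, Finset.mul_sum]
      rw [Finset.sum_comm]
      refine Finset.sum_congr rfl fun x _ => Finset.sum_congr rfl fun z _ => ?_
      ring

namespace Diagram

variable (G : Diagram)

/-- The labels on a level of a labeling of the crossing points. -/
def word {X : Type} (s : G.Point → X) (t : Fin (G.n + 1)) : List X :=
  List.ofFn fun i => s ⟨t, i⟩

/-- The contribution of the two bends at the cut in state `e₀`: with `σ = 1` for an upward strand
and `σ = -1` for a downward one, it is `q ^ (-2 σ j)`, which will remove the curves through the cut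
edge from the total rotation. -/
theorem head_up_weight (b : Strand) :
    capWeight b.rev false * cupWeight b.rev false = if b.up then q ^ (-2 * b.mult)
      else q ^ (2 * b.mult) := by
  cases h : b.up <;> simp [capWeight, cupWeight, Strand.rev, h]

/-- The morphism of a cut diagram is a sum over labelings of the crossing points. -/
theorem morphism_cut (t : Fin (G.n + 1)) (ht : G.level t ≠ []) (o : G.Point) (ho : o.1 = t)
    (ho' : (o.2 : ℕ) = 0) :
    morphism (G.cut t ht) [false] [false] =
      (if (G.strand o).up then q ^ (-2 * (G.strand o).mult) else q ^ (2 * (G.strand o).mult)) *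
        ∑ s : G.Point → Bool with s o = false,
          ∏ i : Fin G.n, (G.slice i).entry (G.word s i.castSucc) (G.word s i.succ) := by
  have hstrand : (G.level t).head ht = G.strand o := by
    have := G.strand_eq o (L := G.level t) (by rw [ho])
    rw [ho', ← List.head?_eq_getElem?, List.head?_eq_some_head ht] at this
    exact Option.some.inj this
  set b := (G.strand o).rev with hb
  rw [cut, hstrand, ← head_up_weight, ← hb]
  have hlast : t ≠ Fin.last G.n := by
    rintro rfl
    exact ht G.level_last
  obtain ⟨τ, rfl⟩ : ∃ τ : Fin G.n, t = τ.castSucc := ⟨t.castPred hlast, by simp⟩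
  set L := List.ofFn G.slice with hL
  simp only [List.append_assoc, Fin.val_castSucc]
  rw [morphism_map_addLeft]
  -- Above the cut the added segment runs to the top line, where the label `0` is prescribed; hence
  -- only `d = 0` survives after the minimum.
  have hfinal : ∀ (S : List Slice) (d : Bool) (x : List Bool),
      morphism (S.map (Slice.addLeft b)) (d :: x) [false] =
        if d = false then chain (S.map Slice.link) (fun z => if z = [] then 1 else 0) x else 0 := by
    intro S d x
    have := morphism_map_addLeft b S [] d x [false]
    rw [List.append_nil] at this
    rw [this]
    cases d
    · simp [morphism]
    · simp only [morphism]
      rw [if_neg (by simp)]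
      have : ∀ (S : List (ℕ × (List Bool → List Bool → K))) x,
          chain S (fun _ => 0) x = 0 := by
        intro S
        induction S with
        | nil => intro x; rfl
        | cons e S ih =>
          intro x
          obtain ⟨m, E⟩ := e
          simp [chain, ih]
      simpa using this _ x
  have hlen : ∀ i : Fin G.n, (G.slice i).top.length = (G.level i.succ).length := fun i => by
    rw [G.level_succ]
  -- The whole effect of the cut is a factor on words of the cut line: the leftmost label must be
  -- `0`, and the two bends contribute their weights for `e₀`. It is attached to the matrix of the
  -- slice `τ` just above the cut.
  let g : List Bool → K := fun z => if z.head? = some false then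
    capWeight b false * cupWeight b false else 0
  let E' : Fin G.n → List Bool → List Bool → K := fun i x y =>
    if i = τ then g x * (G.slice i).entry x y else (G.slice i).entry x y
  have hdrop : L.drop τ = G.slice τ :: L.drop (τ + 1) := by
    rw [List.drop_eq_getElem_cons (by simp [hL])]
    simp [hL]
  have hE : List.ofFn (fun i => ((G.level i.succ).length, E' i)) =
      (L.take τ).map Slice.link ++
        (((G.slice τ).top.length, fun x y => g x * (G.slice τ).entry x y) ::
          (L.drop (τ + 1)).map Slice.link) := by
    apply List.ext_getElem
    · simp [hL]
      omega
    · intro i h₁ h₂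
      rw [List.length_ofFn] at h₁
      rw [List.getElem_ofFn]
      rcases lt_trichotomy i τ with h | h | h
      · have hi : (⟨i, h₁⟩ : Fin G.n) ≠ τ := by
          rintro rfl
          simp at h
        rw [List.getElem_append_left (by simp [hL]; omega)]
        simp only [List.getElem_map, List.getElem_take, hL, List.getElem_ofFn, Slice.link, hlen, E',
          if_neg hi]
      · subst h
        rw [List.getElem_append_right (by simp [hL])]
        simp [hL, E', hlen]
      · have hi : (⟨i, h₁⟩ : Fin G.n) ≠ τ := by
          rintro rfl
          simp at h
        have hm : ((L.take τ).map Slice.link).length = τ := by simp [hL]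
        rw [List.getElem_append_right (by omega), List.getElem_cons, dif_neg (by omega)]
        have : (τ : ℕ) + 1 + (i - τ - 1) = i := by omega
        simp only [List.getElem_map, List.getElem_drop, Slice.link, E', if_neg hi, hm, this]
        simp only [hL, List.getElem_ofFn, hlen]
  have hR : chain ((L.take τ).map Slice.link) (fun z => morphism
      ([⟨[], .cap b, (G.level τ.castSucc).tail⟩, ⟨[], .cup b, (G.level τ.castSucc).tail⟩] ++
        (L.drop τ).map (Slice.addLeft b)) (false :: z) [false]) [] =
      chain (List.ofFn (fun i => ((G.level i.succ).length, E' i)))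
        (fun z => if z = [] then 1 else 0) [] := by
    rw [hE, chain_append]
    apply chain_congr (ℓ := (G.level τ.castSucc).length)
    · intro h
      have h0 : (τ : ℕ) = 0 := by
        have := congrArg List.length h
        simpa [hL] using this
      have : τ.castSucc = 0 := Fin.ext h0
      rw [this, G.level_zero]
      rfl
    · intro e he
      rw [List.getLast?_map, Option.mem_def, Option.map_eq_some_iff] at he
      obtain ⟨s, hs, rfl⟩ := he
      rw [List.getLast?_eq_getElem?, List.getElem?_take] at hs
      have h1 : (L.take τ).length = τ := by simp [hL]
      rw [h1] at hs
      split_ifs at hs with hlt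
      have hlt' : (τ : ℕ) - 1 < G.n := by omega
      rw [List.getElem?_eq_getElem (by simpa [hL] using hlt')] at hs
      simp only [hL, List.getElem_ofFn, Option.some.injEq] at hs
      rw [← hs]
      simp only [Slice.link, hlen]
      congr 2
      exact Fin.ext (by simp; omega)
    · intro z hz
      have hpos : (G.level τ.castSucc).length ≠ 0 := fun h => ht (List.length_eq_zero_iff.1 h)
      obtain ⟨c, w, rfl⟩ : ∃ c w, z = c :: w := by
        cases z with
        | nil => simp at hz; exact absurd hz.symm hpos
        | cons c w => exact ⟨c, w, rfl⟩
      have hw : w.length = (G.level τ.castSucc).tail.length := by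
        simp at hz
        simp; omega
      rw [List.cons_append, List.cons_append, List.nil_append, morphism_cap_cup b _ _ _ _ _ _ hw]
      rw [hdrop]
      simp only [chain, g]
      have hd := hfinal (G.slice τ :: L.drop (τ + 1))
      cases c
      · simp only [if_true, List.head?_cons, Fintype.sum_bool, hd]
        simp only [List.map_cons, Slice.link, chain, Finset.mul_sum]
        simp only [Bool.true_eq_false, if_false, mul_zero, zero_add,
          Finset.mul_sum]
        refine Finset.sum_congr rfl fun z _ => ?_
        ring
      · simp
  have hsum := sum_chain G.n (fun j => (G.level j).length) E' (fun z => if z = [] then 1 else 0)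
    (fun _ => 1)
  have hzero : (G.level 0).length = 0 := by simp [G.level_zero]
  have hun : ∀ (m : ℕ) (_ : m = 0) (f : List Bool → K),
      ∑ x : Fin m → Bool, f (List.ofFn x) = f [] := by
    rintro m rfl f
    simp
  rw [hun _ hzero (fun x => 1 * chain _ _ x), one_mul] at hsum
  rw [hR, ← hsum, ← (Equiv.piCurry fun (j : Fin (G.n + 1)) (_ : Fin (G.level j).length) =>
    Bool).sum_comp, Finset.mul_sum, Finset.sum_filter]
  refine Finset.sum_congr rfl fun s _ => ?_
  have e₁ : ∀ j, List.ofFn ((Equiv.piCurry fun (j : Fin (G.n + 1)) (_ : Fin (G.level j).length) =>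
      Bool) s j) = G.word s j := fun j => rfl
  simp only [e₁]
  rw [if_pos (List.eq_nil_of_length_eq_zero (by simp [word, G.level_last])), mul_one, one_mul]
  have e₂ : ∀ i, E' i (G.word s i.castSucc) (G.word s i.succ) =
      (if i = τ then g (G.word s i.castSucc) else 1) *
        (G.slice i).entry (G.word s i.castSucc) (G.word s i.succ) := by
    intro i
    simp only [E']
    split_ifs <;> simp
  rw [Finset.prod_congr rfl fun i _ => e₂ i, Finset.prod_mul_distrib,
    Finset.prod_ite_eq' Finset.univ τ, if_pos (Finset.mem_univ _)]
  have e₃ : (G.word s τ.castSucc).head? = some (s o) := by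
    obtain ⟨j, i⟩ := o
    dsimp only at ho ho'
    subst ho
    rw [List.head?_eq_getElem?, List.getElem?_eq_getElem (by rw [← ho']; simp [word])]
    simp only [word, List.getElem_ofFn, Option.some.injEq]
    exact congrArg s (Sigma.ext rfl (heq_of_eq (Fin.ext ho'.symm)))
  simp only [g, e₃]
  cases s o <;> simp

end Diagram

/-! ### Moves: nested minima and maxima -/

/-- A family of `m` nested minima (`cup`) or maxima; `up` says that the left ends point upward. -/
structure Move where
  m : ℕ
  cup : Bool
  up : Bool

/-- The rotation of a family of nested extrema, in a normalization in which the rotation of a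
minimum is `0` or `-1` and that of a maximum is `1` or `0`. -/
def Move.turn (v : Move) : ℤ :=
  match v.cup, v.up with
  | true, true => 0
  | true, false => -v.m
  | false, true => v.m
  | false, false => 0

/-- The move at a vertex with one edge on one side and two edges on the other, with `fl` parallel
copies of the left and `fr` parallel copies of the right edge. -/
def vertexMove (cup : Bool) (s l r : Bool) (fl fr : ℕ) : Move where
  m := if l = r then 0 else if s = l then fr else fl
  cup := cup
  up := l

/-- The move that a piece performs on the parallel copies of its edges. -/
def pieceMove {E : Type} (f : E → ℕ) : List (Strand × E) → List (Strand × E) → Move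
  | [], (l, e) :: _ => ⟨f e, true, l.up⟩
  | (l, e) :: _, [] => ⟨f e, false, l.up⟩
  | [(b, _)], [(l, e₁), (r, e₂)] => vertexMove true b.up l.up r.up (f e₁) (f e₂)
  | [(l, e₁), (r, e₂)], [(t, _)] => vertexMove false t.up l.up r.up (f e₁) (f e₂)
  | _, _ => ⟨0, true, true⟩

theorem q_ne_zero : q ≠ 0 := RatFunc.X_ne_zero

/-- The factor by which the weights of `e₁` are renormalized on strands that point downward. -/
noncomputable def gauge {E : Type} (φ : E → Bool) (L : List (Strand × E)) : K :=
  (L.map fun x => if φ x.2 = true ∧ x.1.up = false then -q ^ (2 * x.1.mult) else 1).prod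

theorem gauge_append {E : Type} (φ : E → Bool) (L L' : List (Strand × E)) :
    gauge φ (L ++ L') = gauge φ L * gauge φ L' := by
  simp [gauge]

theorem gauge_ne_zero {E : Type} (φ : E → Bool) (L : List (Strand × E)) : gauge φ L ≠ 0 := by
  rw [gauge]
  apply List.prod_ne_zero
  simp only [List.mem_map, not_exists, not_and]
  intro x _
  split_ifs
  · exact neg_ne_zero.2 (zpow_ne_zero _ q_ne_zero)
  · exact one_ne_zero

/-- The weight of a vertex, if there is one. -/
noncomputable def cornerWeight {E : Type} (c : E → ℤ) (φ : E → Bool) : Option (Corner E) → K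
  | none => 1
  | some v => v.wt c φ

set_option linter.unusedSimpArgs false in
set_option maxHeartbeats 4000000 in
-- The local heart of the comparison: up to a gauge, the tables of Boltzmann weights are the vertex
-- weights of the state sum times a factor for the turning. At a vertex the copies of an edge that
-- reverses direction behave like nested extrema. The table entries are checked one by one.
theorem entry_mul_gauge {E : Type} {P : Piece} {pb pt : List (Strand × E)} {v : Option (Corner E)}
    (h : PieceLevels P pb pt v) (hP : P.Admissible) (c : E → ℤ)
    (hc : ∀ x ∈ pb ++ pt, c x.2 = x.1.mult) (f : E → ℕ) (hf : ∀ e, (f e : ℤ) = c e) (φ : E → Bool)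
    (hφ : ∀ w ∈ v, w.Conserves φ) :
    P.entry (pb.map fun x => φ x.2) (pt.map fun x => φ x.2) * gauge φ pb =
      q ^ (2 * (pieceMove f pb pt).turn) *
        (-1) ^ (pieceMove (fun e => (φ e).toNat) pb pt).turn * cornerWeight c φ v *
          gauge φ pt := by
  have hq := fun i : ℤ => zpow_ne_zero (2 * i) q_ne_zero
  cases h with
  | cup l e =>
    obtain ⟨m, J, u⟩ := l
    simp only [List.nil_append, List.mem_cons, forall_eq_or_imp] at hc
    have hm : c e = m := hc.1
    have := inv_mul_cancel₀ (hq m)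
    cases u <;> cases he : φ e <;>
      simp [Piece.entry, cupWeight, gauge, pieceMove, Move.turn, cornerWeight, he, hf, hm,
        Strand.rev, this]
  | cap l e =>
    obtain ⟨m, J, u⟩ := l
    simp only [List.append_nil, List.mem_cons, forall_eq_or_imp] at hc
    have hm : c e = m := hc.1
    have := hq m
    cases u <;> cases he : φ e <;>
      simp [Piece.entry, capWeight, gauge, pieceMove, Move.turn, cornerWeight, he, hf, hm,
        Strand.rev, this]
  | split b l r e₀ e₁ e₂ =>
    obtain ⟨k, J₀, u₀⟩ := b
    obtain ⟨i, J₁, u₁⟩ := l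
    obtain ⟨j, J₂, u₂⟩ := r
    simp only [List.cons_append, List.nil_append, List.mem_cons, forall_eq_or_imp] at hc
    obtain ⟨hk, hi, hj, -⟩ := hc
    obtain ⟨-, h₁, h₂, -⟩ := hP
    have pi := hq i
    have pj := hq j
    have pk := hq k
    -- Depending on the orientations, admissibility makes one of the three multiplicities the sum of
    -- the other two; eliminating it leaves an identity of Laurent polynomials in powers of `q`.
    cases u₀ <;> cases u₁ <;> cases u₂ <;> simp [outSign] at h₁ h₂ <;>
      cases f₀ : φ e₀ <;> cases f₁ : φ e₁ <;> cases f₂ : φ e₂ <;>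
      simp [Corner.ofClockwise, Corner.Conserves, f₀, f₁, f₂] at hφ <;>
      simp [Piece.entry, splitWeight, row, gauge, pieceMove, vertexMove, Move.turn, cornerWeight,
        Corner.ofClockwise, Corner.wt, f₀, f₁, f₂, hi, hj, hk, hf, br] <;>
      first
        | done
        | (have hs : k = i + j
           · linarith
           subst hs
           simp only [mul_add, neg_add, zpow_add₀ q_ne_zero, zpow_neg, neg_mul, mul_neg, mul_inv,
             inv_inv] at pi pj pk ⊢
           try field_simp
           try ring)
        | (have hs : i = k + j
           · linarith
           subst hs
           simp only [mul_add, neg_add, zpow_add₀ q_ne_zero, zpow_neg, neg_mul, mul_neg, mul_inv,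
             inv_inv] at pi pj pk ⊢
           try field_simp
           try ring)
        | (have hs : j = k + i
           · linarith
           subst hs
           simp only [mul_add, neg_add, zpow_add₀ q_ne_zero, zpow_neg, neg_mul, mul_neg, mul_inv,
             inv_inv] at pi pj pk ⊢
           try field_simp
           try ring)
  | merge l r t e₀ e₁ e₂ =>
    obtain ⟨k, J₀, u₀⟩ := t
    obtain ⟨i, J₁, u₁⟩ := l
    obtain ⟨j, J₂, u₂⟩ := r
    simp only [List.cons_append, List.nil_append, List.mem_cons, forall_eq_or_imp] at hc
    obtain ⟨hi, hj, hk, -⟩ := hc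
    obtain ⟨-, h₁, h₂, -⟩ := hP
    have pi := hq i
    have pj := hq j
    have pk := hq k
    cases u₀ <;> cases u₁ <;> cases u₂ <;> simp [outSign] at h₁ h₂ <;>
      cases f₀ : φ e₀ <;> cases f₁ : φ e₁ <;> cases f₂ : φ e₂ <;>
      simp [Corner.ofClockwise, Corner.Conserves, f₀, f₁, f₂] at hφ <;>
      simp [Piece.entry, mergeWeight, row, gauge, pieceMove, vertexMove, Move.turn, cornerWeight,
        Corner.ofClockwise, Corner.wt, f₀, f₁, f₂, hi, hj, hk, hf, br] <;>
      first
        | done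
        | (have hs : k = i + j
           · linarith
           subst hs
           simp only [mul_add, neg_add, zpow_add₀ q_ne_zero, zpow_neg, neg_mul, mul_neg, mul_inv,
             inv_inv] at pi pj pk ⊢
           try field_simp
           try ring)
        | (have hs : i = k + j
           · linarith
           subst hs
           simp only [mul_add, neg_add, zpow_add₀ q_ne_zero, zpow_neg, neg_mul, mul_neg, mul_inv,
             inv_inv] at pi pj pk ⊢
           try field_simp
           try ring)
        | (have hs : j = k + i
           · linarith
           subst hs
           simp only [mul_add, neg_add, zpow_add₀ q_ne_zero, zpow_neg, neg_mul, mul_neg, mul_inv,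
             inv_inv] at pi pj pk ⊢
           try field_simp
           try ring)

/-! ### The state sum over labelings of the edges -/

set_option linter.unusedSimpArgs false in
theorem conserves_of_entry_ne_zero {E : Type} {P : Piece} {pb pt : List (Strand × E)}
    {v : Option (Corner E)} (h : PieceLevels P pb pt v) (φ : E → Bool)
    (h₀ : P.entry (pb.map fun x => φ x.2) (pt.map fun x => φ x.2) ≠ 0) :
    ∀ w ∈ v, w.Conserves φ := by
  cases h with
  | cup l e => simp
  | cap l e => simp
  | split b l r e₀ e₁ e₂ =>
    obtain ⟨k, J₀, u₀⟩ := b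
    obtain ⟨i, J₁, u₁⟩ := l
    obtain ⟨j, J₂, u₂⟩ := r
    revert h₀
    cases u₀ <;> cases u₁ <;> cases u₂ <;> cases f₀ : φ e₀ <;> cases f₁ : φ e₁ <;>
      cases f₂ : φ e₂ <;>
      simp [Piece.entry, splitWeight, Corner.ofClockwise, row, Corner.Conserves, f₀, f₁, f₂]
  | merge l r t e₀ e₁ e₂ =>
    obtain ⟨k, J₀, u₀⟩ := t
    obtain ⟨i, J₁, u₁⟩ := l
    obtain ⟨j, J₂, u₂⟩ := r
    revert h₀
    cases u₀ <;> cases u₁ <;> cases u₂ <;> cases f₀ : φ e₀ <;> cases f₁ : φ e₁ <;>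
      cases f₂ : φ e₂ <;>
      simp [Piece.entry, mergeWeight, Corner.ofClockwise, row, Corner.Conserves, f₀, f₁, f₂]

theorem Slice.entry_append (s : Slice) {A B C D : List Bool} (hA : A.length = s.left.length)
    (hB : B.length = s.piece.bot.length) (hC : C.length = s.piece.top.length)
    (hD : D.length = s.right.length) :
    s.entry (A ++ (B ++ D)) (A ++ (C ++ D)) = s.piece.entry B C := by
  rw [entry, if_pos]
  · rw [← hA, ← hB, ← hC]
    simp
  · refine ⟨by simp [bot, *], by simp [top, *], by simp [← hA], ?_⟩
    rw [← hA, ← hB, ← hC, ← List.drop_drop, ← List.drop_drop]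
    simp

theorem Slice.exists_of_entry_ne_zero (s : Slice) {x y : List Bool} (h : s.entry x y ≠ 0) :
    ∃ A B C D, A.length = s.left.length ∧ B.length = s.piece.bot.length ∧
      C.length = s.piece.top.length ∧ D.length = s.right.length ∧
      x = A ++ (B ++ D) ∧ y = A ++ (C ++ D) ∧ s.piece.entry B C ≠ 0 := by
  rw [entry] at h
  split_ifs at h with hc
  · obtain ⟨h₁, h₂, h₃, h₄⟩ := hc
    simp only [bot, top, List.length_append] at h₁ h₂
    refine ⟨x.take s.left.length, _, _, x.drop (s.left.length + s.piece.bot.length), ?_, ?_, ?_, ?_,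
      ?_, ?_, h⟩
    · simp; omega
    · simp; omega
    · simp; omega
    · simp; omega
    · rw [← List.drop_drop, List.take_append_drop, List.take_append_drop]
    · rw [h₃, h₄, ← List.drop_drop, List.take_append_drop, List.take_append_drop]
  · exact absurd rfl h

namespace Diagram

variable (G : Diagram)

/-- The move of a slice on the parallel copies of the edges, `f e` copies of the edge `e`. -/
def move (f : G.Edge → ℕ) (t : Fin G.n) : Move := pieceMove f (G.botLev t) (G.topLev t)

/-- The total rotation of the parallel copies of the edges, `f e` copies of the edge `e`. -/
def turn (f : G.Edge → ℕ) : ℤ := ∑ t, (G.move f t).turn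

theorem word_edge {X : Type} (φ : G.Edge → X) (t : Fin (G.n + 1)) :
    G.word (fun p => φ (G.edge p)) t = (G.lev t).map fun x => φ x.2 := by
  simp only [word, lev, List.map_ofFn]
  rfl

theorem entry_word_edge (φ : G.Edge → Bool) (t : Fin G.n) :
    (G.slice t).entry (G.word (fun p => φ (G.edge p)) t.castSucc)
      (G.word (fun p => φ (G.edge p)) t.succ) =
    (G.slice t).piece.entry ((G.botLev t).map fun x => φ x.2)
      ((G.topLev t).map fun x => φ x.2) := by
  rw [word_edge, word_edge, lev_castSucc, lev_succ]
  simp only [List.map_append]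
  exact Slice.entry_append _ (by simp) (by simp) (by simp) (by simp)

/-- Labels are conserved at all vertices. -/
def Conserved (φ : G.Edge → Bool) : Prop := ∀ t, ∀ v ∈ G.corner t, v.Conserves φ

/-- A nonzero product forces equal labels along vertical segments and at the two ends of an
extremum, hence a labeling of the edges; at vertices the zeros of the tables force conservation. -/
theorem exists_of_prod_entry_ne_zero (s : G.Point → Bool)
    (h : ∏ t : Fin G.n, (G.slice t).entry (G.word s t.castSucc) (G.word s t.succ) ≠ 0) :
    ∃ φ : G.Edge → Bool, s = (fun p => φ (G.edge p)) ∧ G.Conserved φ := by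
  have hne : ∀ t, (G.slice t).entry (G.word s t.castSucc) (G.word s t.succ) ≠ 0 := fun t =>
    Finset.prod_ne_zero_iff.1 h t (Finset.mem_univ t)
  obtain ⟨φ, hφ⟩ := G.exists_edge_labeling (G.word s) (by simp [word]) (by
    intro t
    obtain ⟨A, B, C, D, hA, hB, hC, -, hx, hy, hP⟩ := (G.slice t).exists_of_entry_ne_zero (hne t)
    refine ⟨A, B, C, D, hA, hB, hC, hx, hy, ?_, ?_⟩
    · rintro ⟨l, hl⟩
      rw [hl] at hB hC hP
      obtain ⟨x, y, rfl⟩ := List.length_eq_two.1 hC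
      obtain rfl := List.length_eq_zero_iff.1 hB
      simp only [Piece.entry] at hP
      split_ifs at hP with he
      · exact ⟨x, by rw [he]⟩
      · exact absurd rfl hP
    · rintro ⟨l, hl⟩
      rw [hl] at hB hC hP
      obtain ⟨x, y, rfl⟩ := List.length_eq_two.1 hB
      obtain rfl := List.length_eq_zero_iff.1 hC
      simp only [Piece.entry] at hP
      split_ifs at hP with he
      · exact ⟨x, by rw [he]⟩
      · exact absurd rfl hP)
  have hs : s = fun p => φ (G.edge p) := by
    funext ⟨t, i⟩
    have := hφ t
    rw [← word_edge] at this
    exact congrFun (List.ofFn_injective this) i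
  refine ⟨φ, hs, fun t v hv => ?_⟩
  refine conserves_of_entry_ne_zero (G.pieceLevels t) φ ?_ v hv
  rw [← entry_word_edge, ← hs]
  exact hne t

theorem weight_eq (φ : G.Edge → Bool) :
    G.weight φ = ∏ t, cornerWeight G.mult φ (G.corner t) := by
  unfold weight
  refine Finset.prod_congr rfl fun t _ => ?_
  cases G.corner t <;> rfl

theorem prod_castSucc_eq_prod_succ {F : Type} [CommMonoid F] (n : ℕ) (g : Fin (n + 1) → F)
    (h₀ : g 0 = 1) (h₁ : g (Fin.last n) = 1) : ∏ t : Fin n, g t.castSucc = ∏ t : Fin n, g t.succ := by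
  have := (Fin.prod_univ_castSucc g).symm.trans (Fin.prod_univ_succ g)
  rwa [h₀, h₁, mul_one, one_mul] at this

theorem mem_bot_top_mult {t : Fin G.n} {x : Strand × G.Edge} (hx : x ∈ G.botLev t ++ G.topLev t) :
    G.mult x.2 = x.1.mult := by
  rcases List.mem_append.1 hx with h | h
  · exact G.mult_of_mem_lev (t := t.castSucc) (by rw [lev_castSucc]; simp [h])
  · exact G.mult_of_mem_lev (t := t.succ) (by rw [lev_succ]; simp [h])

/-- In the product of the local identities of `entry_mul_gauge` the gauge factors cancel: the top
line of a slice is the bottom line of the next one, and the extreme lines are empty. -/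
theorem prod_entry (hpos : ∀ e : G.Edge, 0 < G.mult e) (φ : G.Edge → Bool) (hφ : G.Conserved φ) :
    ∏ t : Fin G.n, (G.slice t).entry (G.word (fun p => φ (G.edge p)) t.castSucc)
      (G.word (fun p => φ (G.edge p)) t.succ) =
    q ^ (2 * G.turn fun e => (G.mult e).toNat) * (-1) ^ (G.turn fun e => (φ e).toNat) *
      G.weight φ := by
  have hg : ∏ t : Fin G.n, gauge φ (G.lev t.castSucc) = ∏ t : Fin G.n, gauge φ (G.lev t.succ) :=
    prod_castSucc_eq_prod_succ G.n (fun t => gauge φ (G.lev t)) (by simp [lev_zero, gauge])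
      (by simp [lev_last, gauge])
  have hz : ∏ t : Fin G.n, gauge φ (G.lev t.succ) ≠ 0 :=
    Finset.prod_ne_zero_iff.2 fun t _ => gauge_ne_zero _ _
  apply mul_right_cancel₀ hz
  conv_lhs => rw [← hg]
  rw [weight_eq, turn, turn, Finset.mul_sum]
  have hsum : ∀ (x : K) (_ : x ≠ 0) (h : Fin G.n → ℤ), x ^ (∑ t, h t) = ∏ t, x ^ h t := by
    intro x hx h
    induction (Finset.univ : Finset (Fin G.n)) using Finset.induction_on with
    | empty => simp
    | insert a S ha ih => rw [Finset.sum_insert ha, Finset.prod_insert ha, zpow_add₀ hx, ih]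
  rw [hsum q q_ne_zero, hsum (-1) (by simp), ← Finset.prod_mul_distrib, ← Finset.prod_mul_distrib,
    ← Finset.prod_mul_distrib, ← Finset.prod_mul_distrib]
  refine Finset.prod_congr rfl fun t _ => ?_
  rw [entry_word_edge, lev_castSucc, lev_succ]
  simp only [gauge_append]
  have := entry_mul_gauge (G.pieceLevels t) (G.admissible t) G.mult
    (fun x hx => G.mem_bot_top_mult hx) (fun e => (G.mult e).toNat)
    (fun e => Int.toNat_of_nonneg (hpos e).le) φ (hφ t)
  rw [mul_left_comm, ← mul_assoc ((G.slice t).piece.entry _ _), this, move, move]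
  ring

open scoped Classical in
/-- The sum over the labelings of the crossing points, as a sum over states. -/
theorem sum_prod_entry (hpos : ∀ e : G.Edge, 0 < G.mult e) (o : G.Point) :
    ∑ s : G.Point → Bool with s o = false,
      ∏ i : Fin G.n, (G.slice i).entry (G.word s i.castSucc) (G.word s i.succ) =
    q ^ (2 * G.turn fun e => (G.mult e).toNat) *
      ∑ φ : G.Edge → Bool with G.IsState (G.edge o) φ,
        (-1) ^ (G.turn fun e => (φ e).toNat) * G.weight φ := by
  rw [Finset.mul_sum]
  symm
  -- The correspondence is between nonzero terms only: labelings of the points that do not come from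
  -- a conserved labeling of the edges have zero product.
  refine Finset.sum_bij_ne_zero (fun φ _ _ => fun p => φ (G.edge p)) ?_ ?_ ?_ ?_
  · intro φ hφ _
    exact Finset.mem_filter.2 ⟨Finset.mem_univ _, (Finset.mem_filter.1 hφ).2.1⟩
  · intro φ _ _ φ' _ _ h
    funext e
    induction e using Quot.ind with | _ p
    exact congrFun h p
  · intro s hs h
    obtain ⟨φ, rfl, hφ⟩ := G.exists_of_prod_entry_ne_zero s h
    refine ⟨φ, Finset.mem_filter.2 ⟨Finset.mem_univ _, (Finset.mem_filter.1 hs).2, hφ⟩, ?_, rfl⟩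
    rwa [prod_entry G hpos φ hφ, mul_assoc] at h
  · intro φ hφ _
    rw [prod_entry G hpos φ (Finset.mem_filter.1 hφ).2.2, mul_assoc]

end Diagram

/-- The values on the incoming and on the outgoing edges have the same sum. -/
def Corner.Sums {E : Type} (f : E → ℤ) : Corner E → Prop
  | .odd inn outL outR => f inn = f outL + f outR
  | .even out inL inR => f out = f inL + f inR

theorem sum_outSign_eq_zero {E : Type} (f : E → ℤ) {e₀ e₁ e₂ : E} {o₀ o₁ o₂ : Bool}
    (hne : ¬ (o₀ = o₁ ∧ o₁ = o₂))
    (h : ∀ w ∈ Corner.ofClockwise e₀ e₁ e₂ o₀ o₁ o₂, w.Sums f) :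
    outSign o₀ * f e₀ + outSign o₁ * f e₁ + outSign o₂ * f e₂ = 0 := by
  revert hne h
  cases o₀ <;> cases o₁ <;> cases o₂ <;>
    simp [outSign, Corner.ofClockwise, Corner.Sums] <;> omega

namespace Diagram

variable (G : Diagram)

/-! ### Sums over the strands to the left of an interval -/

section GapSum

variable {A : Type} [AddCommGroup A] (v : Strand × G.Edge → A)

/-- The sum of a valuation over the strands to the left of an interval. -/
def gapSum (t : Fin (G.n + 1)) (i : ℕ) : A := (((G.lev t).take i).map v).sum

/-- The valuation is conserved by all pieces. -/
def Balanced : Prop :=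
  ∀ t : Fin G.n, ((G.botLev t).map v).sum = ((G.topLev t).map v).sum

theorem gapSum_succ (p : G.Point) :
    G.gapSum v p.1 (p.2 + 1) = G.gapSum v p.1 p.2 + v (G.strand p, G.edge p) := by
  have h := List.take_succ_eq_append_getElem (l := G.lev p.1) (i := p.2) (by simp)
  rw [gapSum, h, gapSum, List.map_append, List.sum_append]
  simp [lev]

theorem gapSum_castSucc (t : Fin G.n) {i : ℕ} (hi : i ≤ (G.slice t).left.length) :
    G.gapSum v t.castSucc i = (((G.leftLev t).take i).map v).sum := by
  rw [gapSum, lev_castSucc, List.take_append_of_le_length (by simpa using hi)]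

theorem gapSum_succ' (t : Fin G.n) {i : ℕ} (hi : i ≤ (G.slice t).left.length) :
    G.gapSum v t.succ i = (((G.leftLev t).take i).map v).sum := by
  rw [gapSum, lev_succ, List.take_append_of_le_length (by simpa using hi)]

theorem gapSum_bot (t : Fin G.n) {k : ℕ} (hk : k ≤ (G.slice t).piece.bot.length) :
    G.gapSum v t.castSucc ((G.slice t).left.length + k) =
      ((G.leftLev t).map v).sum + (((G.botLev t).take k).map v).sum := by
  rw [gapSum, lev_castSucc, ← length_leftLev, List.take_length_add_append,
    List.take_append_of_le_length (by simpa using hk), List.map_append, List.sum_append]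

theorem gapSum_top (t : Fin G.n) {k : ℕ} (hk : k ≤ (G.slice t).piece.top.length) :
    G.gapSum v t.succ ((G.slice t).left.length + k) =
      ((G.leftLev t).map v).sum + (((G.topLev t).take k).map v).sum := by
  rw [gapSum, lev_succ, ← length_leftLev, List.take_length_add_append,
    List.take_append_of_le_length (by simpa using hk), List.map_append, List.sum_append]

theorem gapSum_bot_add (t : Fin G.n) (k : ℕ) :
    G.gapSum v t.castSucc ((G.slice t).left.length + (G.slice t).piece.bot.length + k) =
      ((G.leftLev t).map v).sum + (((G.botLev t).map v).sum +
        (((G.rightLev t).take k).map v).sum) := by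
  rw [gapSum, lev_castSucc, ← length_leftLev, ← length_botLev, add_assoc,
    List.take_length_add_append, List.take_length_add_append]
  simp

theorem gapSum_top_add (t : Fin G.n) (k : ℕ) :
    G.gapSum v t.succ ((G.slice t).left.length + (G.slice t).piece.top.length + k) =
      ((G.leftLev t).map v).sum + (((G.topLev t).map v).sum +
        (((G.rightLev t).take k).map v).sum) := by
  rw [gapSum, lev_succ, ← length_leftLev, ← length_topLev, add_assoc,
    List.take_length_add_append, List.take_length_add_append]
  simp

variable {v}

/-- Conservation at the pieces makes the sum over the strands to the left independent of the line,
so it is a potential on the regions of the plane. -/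
theorem gapSum_eq_of_gapLink (hv : G.Balanced v) {g g' : G.Gap} (h : G.GapLink g g') :
    G.gapSum v g.1 g.2 = G.gapSum v g'.1 g'.2 := by
  obtain ⟨j, i⟩ := g
  obtain ⟨j', i'⟩ := g'
  obtain ⟨t, h₁, h₂, h⟩ := h
  dsimp only at h₁ h₂
  subst h₁ h₂
  rcases h with ⟨h, h'⟩ | ⟨k, h, h'⟩
  · dsimp only at h h' ⊢
    rw [h', gapSum_castSucc _ _ _ h, gapSum_succ' _ _ _ h]
  · dsimp only at h h' ⊢
    rw [h, h', gapSum_bot_add, gapSum_top_add, hv t]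

theorem gapSum_eq_of_region_eq (hv : G.Balanced v) {g g' : G.Gap}
    (h : G.region g = G.region g') : G.gapSum v g.1 g.2 = G.gapSum v g'.1 g'.2 := by
  let F : G.Region → A := Quot.lift (fun g => G.gapSum v g.1 g.2)
    fun g g' h => G.gapSum_eq_of_gapLink hv h
  exact congrArg F h

theorem gapSum_eq_zero (hv : G.Balanced v) {g : G.Gap} (h : G.region g = G.outerRegion) :
    G.gapSum v g.1 g.2 = 0 := by
  rw [G.gapSum_eq_of_region_eq hv h]
  simp [gapSum]

end GapSum

/-- The values on the incoming and on the outgoing edges have the same sum at every vertex. -/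
def Sums (f : G.Edge → ℤ) : Prop := ∀ t, ∀ w ∈ G.corner t, w.Sums f

/-- The algebraic intersection number of a strand with a path from left to right, when every edge
is taken with the multiplicity `f`. -/
def flux (f : G.Edge → ℤ) (x : Strand × G.Edge) : ℤ := if x.1.up then f x.2 else -f x.2

/-- Kirchhoff's law: what flows upward through the bottom of a piece leaves through its top. Hence
conserved values on edges define heights of regions, which jump by `f` across an edge. -/
theorem balanced_flux {f : G.Edge → ℤ} (hf : G.Sums f) : G.Balanced (G.flux f) := by
  intro t
  have h := G.pieceLevels t
  have ha := G.admissible t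
  have hf := hf t
  generalize (G.slice t).piece = P, G.botLev t = pb, G.topLev t = pt, G.corner t = c at h ha hf
  cases h with
  | cup l e => cases h : l.up <;> simp [flux, Strand.rev, h]
  | cap l e => cases h : l.up <;> simp [flux, Strand.rev, h]
  | split b l r e₀ e₁ e₂ =>
    obtain ⟨-, h, -⟩ := ha
    have := sum_outSign_eq_zero f h hf
    revert this
    cases h₀ : b.up <;> cases h₁ : l.up <;> cases h₂ : r.up <;>
      simp [flux, outSign, h₀, h₁, h₂] <;> omega
  | merge l r b e₀ e₁ e₂ =>
    obtain ⟨-, h, -⟩ := ha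
    have := sum_outSign_eq_zero f (by
      revert h
      cases l.up <;> cases r.up <;> cases b.up <;> simp) hf
    revert this
    cases h₀ : b.up <;> cases h₁ : l.up <;> cases h₂ : r.up <;>
      simp [flux, outSign, h₀, h₁, h₂] <;> omega

theorem sums_mult : G.Sums G.mult := by
  intro t
  have h := G.pieceLevels t
  have ha := G.admissible t
  have hm : ∀ x ∈ G.botLev t ++ G.topLev t, G.mult x.2 = x.1.mult := fun x hx =>
    G.mem_bot_top_mult hx
  generalize (G.slice t).piece = P, G.botLev t = pb, G.topLev t = pt, G.corner t = c at h ha hm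
  cases h with
  | cup l e => simp
  | cap l e => simp
  | split b l r e₀ e₁ e₂ =>
    obtain ⟨-, -, h, -⟩ := ha
    simp only [List.cons_append, List.nil_append, List.mem_cons, forall_eq_or_imp] at hm
    obtain ⟨h₀, h₁, h₂, -⟩ := hm
    revert h
    rw [← h₀, ← h₁, ← h₂]
    cases b.up <;> cases l.up <;> cases r.up <;>
      simp [outSign, Corner.ofClockwise, Corner.Sums] <;> omega
  | merge l r b e₀ e₁ e₂ =>
    obtain ⟨-, -, h, -⟩ := ha
    simp only [List.cons_append, List.nil_append, List.mem_cons, forall_eq_or_imp] at hm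
    obtain ⟨h₁, h₂, h₀, -⟩ := hm
    revert h
    rw [← h₀, ← h₁, ← h₂]
    cases b.up <;> cases l.up <;> cases r.up <;>
      simp [outSign, Corner.ofClockwise, Corner.Sums] <;> omega

/-! ### The diagram as a network -/

theorem ne_last_of_point (p : G.Point) : p.1 ≠ Fin.last G.n := by
  obtain ⟨j, i⟩ := p
  rintro h
  dsimp only at h
  subst h
  have := i.2
  simp [G.level_last] at this

theorem ne_zero_of_point (p : G.Point) : p.1 ≠ 0 := by
  obtain ⟨j, i⟩ := p
  rintro h
  dsimp only at h
  subst h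
  have := i.2
  simp [G.level_zero] at this

/-- The slice above a point. -/
def above (p : G.Point) : Fin G.n := p.1.castPred (G.ne_last_of_point p)

/-- The slice below a point. -/
def below (p : G.Point) : Fin G.n := p.1.pred (G.ne_zero_of_point p)

/-- The place in a slice where strand `i` on its bottom line (of `L + b` strands or more) ends: its
piece (`none`) or a vertical segment. -/
def place (L b i : ℕ) : Option ℕ := if i < L then some i else if i < L + b then none else some (i - b)

/-- The node just above a point. -/
def upper (p : G.Point) : Fin G.n × Option ℕ :=
  (G.above p, place (G.slice (G.above p)).left.length (G.slice (G.above p)).piece.bot.length p.2)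

/-- The node just below a point. -/
def lower (p : G.Point) : Fin G.n × Option ℕ :=
  (G.below p, place (G.slice (G.below p)).left.length (G.slice (G.below p)).piece.top.length p.2)

/-- The node that the edge enters after a point. -/
def hd (p : G.Point) : Fin G.n × Option ℕ := if (G.strand p).up then G.upper p else G.lower p

/-- The node that the edge leaves before a point. -/
def tl (p : G.Point) : Fin G.n × Option ℕ := if (G.strand p).up then G.lower p else G.upper p

theorem hd_ne_tl (p : G.Point) : G.hd p ≠ G.tl p := by
  have : G.above p ≠ G.below p := by
    intro h
    have := congrArg (Fin.val) h
    simp [above, below] at this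
    have h0 := G.ne_zero_of_point p
    rw [← Fin.val_ne_zero_iff] at h0
    omega
  intro h
  unfold hd tl at h
  split_ifs at h
  · exact this (congrArg Prod.fst h)
  · exact this (congrArg Prod.fst h).symm

/-- The `k`-th strand at the bottom of the piece of a slice. -/
def botPoint (t : Fin G.n) (k : ℕ) (h : k < (G.slice t).piece.bot.length) : G.Point :=
  ⟨t.castSucc, ⟨(G.slice t).left.length + k, by rw [length_level_castSucc]; omega⟩⟩

/-- The `k`-th strand at the top of the piece of a slice. -/
def topPoint (t : Fin G.n) (k : ℕ) (h : k < (G.slice t).piece.top.length) : G.Point :=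
  ⟨t.succ, ⟨(G.slice t).left.length + k, by rw [length_level_succ]; omega⟩⟩

theorem place_eq_none {L b i : ℕ} : place L b i = none ↔ ∃ k, k < b ∧ i = L + k := by
  unfold place
  split_ifs with h₁ h₂
  · simp; omega
  · simp only [true_iff]
    exact ⟨i - L, by omega, by omega⟩
  · simp; omega

variable {G} in
theorem point_ext {p p' : G.Point} (h : p.1 = p'.1) (h' : (p.2 : ℕ) = p'.2) : p = p' := by
  obtain ⟨j, i⟩ := p
  obtain ⟨j', i'⟩ := p'
  dsimp only at h
  subst h
  exact Sigma.ext rfl (heq_of_eq (Fin.ext h'))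

theorem upper_eq {p : G.Point} {t : Fin G.n} {o : Option ℕ} : G.upper p = (t, o) ↔
    p.1 = t.castSucc ∧ place (G.slice t).left.length (G.slice t).piece.bot.length p.2 = o := by
  constructor
  · intro h
    obtain ⟨rfl, h⟩ := Prod.ext_iff.1 h
    exact ⟨by simp [upper, above], h⟩
  · rintro ⟨h, h'⟩
    have : G.above p = t := by simp [above, h]
    rw [upper, this, h']

theorem lower_eq {p : G.Point} {t : Fin G.n} {o : Option ℕ} : G.lower p = (t, o) ↔
    p.1 = t.succ ∧ place (G.slice t).left.length (G.slice t).piece.top.length p.2 = o := by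
  constructor
  · intro h
    obtain ⟨rfl, h⟩ := Prod.ext_iff.1 h
    exact ⟨by simp [lower, below], h⟩
  · rintro ⟨h, h'⟩
    have : G.below p = t := by simp [below, h]
    rw [lower, this, h']

theorem upper_eq_none {p : G.Point} {t : Fin G.n} :
    G.upper p = (t, none) ↔ ∃ k h, p = G.botPoint t k h := by
  rw [upper_eq, place_eq_none]
  constructor
  · rintro ⟨h, k, hk, h'⟩
    exact ⟨k, hk, point_ext h h'⟩
  · rintro ⟨k, h, rfl⟩
    exact ⟨rfl, k, h, rfl⟩

theorem lower_eq_none {p : G.Point} {t : Fin G.n} :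
    G.lower p = (t, none) ↔ ∃ k h, p = G.topPoint t k h := by
  rw [lower_eq, place_eq_none]
  constructor
  · rintro ⟨h, k, hk, h'⟩
    exact ⟨k, hk, point_ext h h'⟩
  · rintro ⟨k, h, rfl⟩
    exact ⟨rfl, k, h, rfl⟩

/-- The lower end of a vertical segment. -/
def botThrough (t : Fin G.n) (k : ℕ)
    (h : k < (G.slice t).left.length + (G.slice t).right.length) : G.Point :=
  ⟨t.castSucc, ⟨if k < (G.slice t).left.length then k else k + (G.slice t).piece.bot.length, by
    rw [length_level_castSucc]; split_ifs <;> omega⟩⟩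

/-- The upper end of a vertical segment. -/
def topThrough (t : Fin G.n) (k : ℕ)
    (h : k < (G.slice t).left.length + (G.slice t).right.length) : G.Point :=
  ⟨t.succ, ⟨if k < (G.slice t).left.length then k else k + (G.slice t).piece.top.length, by
    rw [length_level_succ]; split_ifs <;> omega⟩⟩

theorem place_eq_some {L b i k : ℕ} : place L b i = some k ↔ i = if k < L then k else k + b := by
  unfold place
  split_ifs <;> simp <;> omega

theorem upper_eq_some {p : G.Point} {t : Fin G.n} {k : ℕ} (h) :
    G.upper p = (t, some k) ↔ p = G.botThrough t k h := by
  rw [upper_eq, place_eq_some]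
  constructor
  · rintro ⟨h, h'⟩
    exact point_ext h h'
  · rintro rfl
    exact ⟨rfl, rfl⟩

theorem lower_eq_some {p : G.Point} {t : Fin G.n} {k : ℕ} (h) :
    G.lower p = (t, some k) ↔ p = G.topThrough t k h := by
  rw [lower_eq, place_eq_some]
  constructor
  · rintro ⟨h, h'⟩
    exact point_ext h h'
  · rintro rfl
    exact ⟨rfl, rfl⟩

theorem upper_lt (p : G.Point) {k : ℕ} (h : (G.upper p).2 = some k) :
    k < (G.slice (G.above p)).left.length + (G.slice (G.above p)).right.length := by
  have h' := place_eq_some.1 h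
  have h₁ := p.2.2
  have h₂ := G.length_level_castSucc (G.above p)
  have h₃ : (G.above p).castSucc = p.1 := by simp [above]
  rw [h₃] at h₂
  split_ifs at h' <;> omega

theorem lower_lt (p : G.Point) {k : ℕ} (h : (G.lower p).2 = some k) :
    k < (G.slice (G.below p)).left.length + (G.slice (G.below p)).right.length := by
  have h' := place_eq_some.1 h
  have h₁ := p.2.2
  have h₂ := G.length_level_succ (G.below p)
  have h₃ : (G.below p).succ = p.1 := by simp [below]
  rw [h₃] at h₂
  split_ifs at h' <;> omega

/-- The height of the region to the left of an edge, seen along its orientation. -/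
def heightLeft (f : G.Edge → ℤ) (p : G.Point) : ℤ :=
  if (G.strand p).up then G.gapSum (G.flux f) p.1 p.2 else G.gapSum (G.flux f) p.1 (p.2 + 1)

end Diagram

/-! ### Links and vertices as nodes of a network, with heights around them -/

/-- A node of a network: a link between two consecutive points of an edge, or a vertex. -/
inductive Node (P : Type) where
  | link (a b : P)
  | vertex (w : Corner P)

/-- The points at which edges enter a node. -/
def Node.ins {P : Type} : Node P → List P
  | .link a _ => [a]
  | .vertex (.odd inn _ _) => [inn]
  | .vertex (.even _ inL inR) => [inL, inR]

/-- The points at which edges leave a node. -/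
def Node.outs {P : Type} : Node P → List P
  | .link _ b => [b]
  | .vertex (.odd _ outL outR) => [outL, outR]
  | .vertex (.even out _ _) => [out]

/-- The multiplicities `c` are conserved, and the heights `h` of the regions to the left of the
edges are compatible with them. -/
def Node.Balanced {P : Type} (c h : P → ℤ) : Node P → Prop
  | .link a b => c a = c b ∧ h a = h b
  | .vertex (.odd inn outL outR) =>
      c inn = c outL + c outR ∧ h inn = h outL ∧ h outR = h outL + c outL
  | .vertex (.even out inL inR) => c out = c inL + c inR ∧ h out = h inL ∧ h inR = h inL + c inL

/-- Apply a function to the edges at a vertex. -/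
def Corner.map {E E' : Type} (f : E → E') : Corner E → Corner E'
  | .odd inn outL outR => .odd (f inn) (f outL) (f outR)
  | .even out inL inR => .even (f out) (f inL) (f inR)

theorem Corner.map_ofClockwise {E E' : Type} (f : E → E') (e₀ e₁ e₂ : E) (o₀ o₁ o₂ : Bool) :
    (Corner.ofClockwise e₀ e₁ e₂ o₀ o₁ o₂).map (Corner.map f) =
      Corner.ofClockwise (f e₀) (f e₁) (f e₂) o₀ o₁ o₂ := by
  cases o₀ <;> cases o₁ <;> cases o₂ <;> rfl

namespace Diagram

variable (G : Diagram)

section Height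

variable (f : G.Edge → ℤ)

/-- The description of the network near a node. -/
structure NodeAt (f : G.Edge → ℤ) (v : Fin G.n × Option ℕ) (N : Node G.Point) : Prop where
  ins : ∀ p, G.hd p = v ↔ p ∈ N.ins
  outs : ∀ p, G.tl p = v ↔ p ∈ N.outs
  nodup_ins : N.ins.Nodup
  nodup_outs : N.outs.Nodup
  balanced : N.Balanced (fun p => f (G.edge p)) (G.heightLeft f)

theorem hd_eq {p : G.Point} {v : Fin G.n × Option ℕ} : G.hd p = v ↔
    (G.upper p = v ∧ (G.strand p).up = true) ∨ (G.lower p = v ∧ (G.strand p).up = false) := by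
  unfold hd
  cases (G.strand p).up <;> simp

theorem tl_eq {p : G.Point} {v : Fin G.n × Option ℕ} : G.tl p = v ↔
    (G.upper p = v ∧ (G.strand p).up = false) ∨ (G.lower p = v ∧ (G.strand p).up = true) := by
  unfold tl
  cases (G.strand p).up <;> simp

/-- The height of the interval to the left of a point. -/
def heightWest (p : G.Point) : ℤ := G.gapSum (G.flux f) p.1 p.2

theorem heightLeft_eq (p : G.Point) : G.heightLeft f p =
    if (G.strand p).up then G.heightWest f p else G.heightWest f p - f (G.edge p) := by
  rw [heightLeft, heightWest, gapSum_succ, flux]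
  split_ifs <;> ring

/-- A link node which joins two points that are connected by a vertical segment or an extremum. -/
theorem nodeAt_link {v : Fin G.n × Option ℕ} {a b : G.Point} (hin : ∀ p, G.hd p = v ↔ p = a) (hout : ∀ p, G.tl p = v ↔ p = b)
    (hc : f (G.edge a) = f (G.edge b)) (hh : G.heightLeft f a = G.heightLeft f b) :
    G.NodeAt f v (.link a b) where
  ins p := by simp [Node.ins, hin]
  outs p := by simp [Node.outs, hout]
  nodup_ins := by simp [Node.ins]
  nodup_outs := by simp [Node.outs]
  balanced := ⟨hc, hh⟩

/-- The heights of the regions on both sides of an edge at a vertex, where `R` and `R'` are the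
heights of the regions that precede and follow the edge in clockwise order. -/
def Sides (e : G.Point) (o : Bool) (R R' : ℤ) : Prop :=
  if o then G.heightLeft f e = R ∧ R' = R + f (G.edge e)
  else G.heightLeft f e = R' ∧ R = R' + f (G.edge e)

/-- Treats both kinds of vertex and all orientations at once: `R₀`, `R₁`, `R₂` are the heights of
the regions met after `e₀`, `e₁`, `e₂` in clockwise order. Rotating the vertex upright only permutes
the roles of the edges. -/
theorem nodeAt_vertex {v : Fin G.n × Option ℕ} {e₀ e₁ e₂ : G.Point} {o₀ o₁ o₂ : Bool}
    (h₀₁ : e₀ ≠ e₁) (h₀₂ : e₀ ≠ e₂) (h₁₂ : e₁ ≠ e₂)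
    (hin : ∀ p, G.hd p = v ↔
      (p = e₀ ∧ o₀ = false) ∨ (p = e₁ ∧ o₁ = false) ∨ (p = e₂ ∧ o₂ = false))
    (hout : ∀ p, G.tl p = v ↔
      (p = e₀ ∧ o₀ = true) ∨ (p = e₁ ∧ o₁ = true) ∨ (p = e₂ ∧ o₂ = true))
    (R₀ R₁ R₂ : ℤ) (s₀ : G.Sides f e₀ o₀ R₂ R₀) (s₁ : G.Sides f e₁ o₁ R₀ R₁)
    (s₂ : G.Sides f e₂ o₂ R₁ R₂) (hne : ¬ (o₀ = o₁ ∧ o₁ = o₂)) :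
    ∃ w, Corner.ofClockwise e₀ e₁ e₂ o₀ o₁ o₂ = some w ∧ G.NodeAt f v (.vertex w) := by
  cases o₀ <;> cases o₁ <;> cases o₂ <;> simp at hne <;> refine ⟨_, rfl, ?_, ?_, ?_, ?_, ?_⟩ <;>
    first
    | (intro p; rw [hin]; simp [Node.ins, or_comm])
    | (intro p; rw [hout]; simp [Node.outs, or_comm])
    | (simp [Node.ins, h₀₁, h₀₂, h₁₂, h₀₁.symm, h₀₂.symm, h₁₂.symm]; done)
    | (simp [Node.outs, h₀₁, h₀₂, h₁₂, h₀₁.symm, h₀₂.symm, h₁₂.symm]; done)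
    | (simp only [Sides, if_true, if_false, Bool.false_eq_true] at s₀ s₁ s₂
       simp only [Node.Balanced]
       omega)

theorem strand_botPoint (t : Fin G.n) (k : ℕ) (h : k < (G.slice t).piece.bot.length) :
    G.strand (G.botPoint t k h) = (G.slice t).piece.bot[k] := by
  have := G.strand_eq (G.botPoint t k h) (G.level_castSucc t)
  simp only [Slice.bot, botPoint] at this
  rw [List.getElem?_append_right (by omega), Nat.add_sub_cancel_left,
    List.getElem?_append_left h, List.getElem?_eq_getElem h] at this
  exact (Option.some.inj this).symm

theorem strand_topPoint (t : Fin G.n) (k : ℕ) (h : k < (G.slice t).piece.top.length) :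
    G.strand (G.topPoint t k h) = (G.slice t).piece.top[k] := by
  have := G.strand_eq (G.topPoint t k h) (G.level_succ t)
  simp only [Slice.top, topPoint] at this
  rw [List.getElem?_append_right (by omega), Nat.add_sub_cancel_left,
    List.getElem?_append_left h, List.getElem?_eq_getElem h] at this
  exact (Option.some.inj this).symm

theorem heightWest_botPoint_zero (t : Fin G.n) (h) :
    G.heightWest f (G.botPoint t 0 h) = ((G.leftLev t).map (G.flux f)).sum := by
  change G.gapSum (G.flux f) t.castSucc ((G.slice t).left.length + 0) = _
  rw [G.gapSum_bot _ _ (by omega)]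
  simp

theorem heightWest_topPoint_zero (t : Fin G.n) (h) :
    G.heightWest f (G.topPoint t 0 h) = ((G.leftLev t).map (G.flux f)).sum := by
  change G.gapSum (G.flux f) t.succ ((G.slice t).left.length + 0) = _
  rw [G.gapSum_top _ _ (by omega)]
  simp

theorem heightWest_botPoint_one (t : Fin G.n) (h h') : G.heightWest f (G.botPoint t 1 h) =
    ((G.leftLev t).map (G.flux f)).sum + (G.flux f) (G.strand (G.botPoint t 0 h'), G.edge (G.botPoint t 0 h')) := by
  rw [← heightWest_botPoint_zero _ _ _ h']
  exact G.gapSum_succ (G.flux f) (G.botPoint t 0 h')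

theorem heightWest_topPoint_one (t : Fin G.n) (h h') : G.heightWest f (G.topPoint t 1 h) =
    ((G.leftLev t).map (G.flux f)).sum + (G.flux f) (G.strand (G.topPoint t 0 h'), G.edge (G.topPoint t 0 h')) := by
  rw [← heightWest_topPoint_zero _ _ _ h']
  exact G.gapSum_succ (G.flux f) (G.topPoint t 0 h')

theorem botPoint_ne {t : Fin G.n} {h h'} : G.botPoint t 0 h ≠ G.botPoint t 1 h' := by
  intro e
  have := congrArg (fun p : G.Point => (p.2 : ℕ)) e
  simp [botPoint] at this

theorem topPoint_ne {t : Fin G.n} {h h'} : G.topPoint t 0 h ≠ G.topPoint t 1 h' := by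
  intro e
  have := congrArg (fun p : G.Point => (p.2 : ℕ)) e
  simp [topPoint] at this

theorem botPoint_ne_topPoint {t : Fin G.n} {k k' : ℕ} {h h'} :
    G.botPoint t k h ≠ G.topPoint t k' h' := by
  intro e
  have := congrArg (fun p : G.Point => (p.1 : ℕ)) e
  simp [botPoint, topPoint] at this

theorem corner_split (t : Fin G.n) {b l r : Strand} (hP : (G.slice t).piece = .split b l r)
    (h h₀ h₁) : G.corner t = Corner.ofClockwise (G.edge (G.botPoint t 0 h))
      (G.edge (G.topPoint t 0 h₀)) (G.edge (G.topPoint t 1 h₁)) (!b.up) l.up r.up := by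
  unfold corner
  split <;> rename_i h <;> rw [hP] at h <;> cases h <;> rfl

theorem corner_merge (t : Fin G.n) {l r b : Strand} (hP : (G.slice t).piece = .merge l r b)
    (h h₀ h₁) : G.corner t = Corner.ofClockwise (G.edge (G.topPoint t 0 h))
      (G.edge (G.botPoint t 1 h₁)) (G.edge (G.botPoint t 0 h₀)) b.up (!r.up) (!l.up) := by
  unfold corner
  split <;> rename_i h <;> rw [hP] at h <;> cases h <;> rfl

/-- The node of the piece of a slice. -/
theorem exists_nodeAt_none (hf : G.Sums f) (t : Fin G.n) : ∃ N, G.NodeAt f (t, none) N ∧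
    ((∃ a b, N = .link a b ∧ G.edge a = G.edge b ∧ G.corner t = none) ∨
      ∃ w, N = .vertex w ∧ G.corner t = some (w.map G.edge)) := by
  have hadm := G.admissible t
  have key : ∀ P, (G.slice t).piece = P → ∃ N, G.NodeAt f (t, none) N ∧
    ((∃ a b, N = .link a b ∧ G.edge a = G.edge b ∧ G.corner t = none) ∨
      ∃ w, N = .vertex w ∧ G.corner t = some (w.map G.edge)) := by
    intro P hP
    have hu : ∀ p, G.upper p = (t, none) ↔ ∃ k h, p = G.botPoint t k h := fun p =>
      G.upper_eq_none
    have hl : ∀ p, G.lower p = (t, none) ↔ ∃ k h, p = G.topPoint t k h := fun p =>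
      G.lower_eq_none
    cases P with
    | cup l =>
      have h0 : 0 < (G.slice t).piece.top.length := by rw [hP]; simp [Piece.top]
      have h1 : 1 < (G.slice t).piece.top.length := by rw [hP]; simp [Piece.top]
      have hs0 : G.strand (G.topPoint t 0 h0) = l := by
        rw [strand_topPoint]; simp [hP, Piece.top]
      have hs1 : G.strand (G.topPoint t 1 h1) = l.rev := by
        rw [strand_topPoint]; simp [hP, Piece.top]
      have hu' : ∀ p, ¬ G.upper p = (t, none) := by
        intro p
        rw [hu]
        rintro ⟨k, h, -⟩
        rw [hP] at h
        simp [Piece.bot] at h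
      have hl' : ∀ p, G.lower p = (t, none) ↔ p = G.topPoint t 0 h0 ∨ p = G.topPoint t 1 h1 := by
        intro p
        rw [hl]
        constructor
        · rintro ⟨k, h, rfl⟩
          have : k < 2 := by rw [hP] at h; simpa [Piece.top] using h
          interval_cases k <;> simp
        · rintro (rfl | rfl)
          exacts [⟨0, h0, rfl⟩, ⟨1, h1, rfl⟩]
      have hc : G.corner t = none := by
        unfold corner
        split <;> rename_i h <;> simp [hP] at h <;> rfl
      have he : G.edge (G.topPoint t 0 h0) = G.edge (G.topPoint t 1 h1) := G.topEdge_cup t l hP h0 h1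
      cases hup : l.up
      · refine ⟨_, G.nodeAt_link f (a := G.topPoint t 0 h0) (b := G.topPoint t 1 h1)
          ?_ ?_ ?_ ?_, .inl ⟨_, _, rfl, he, hc⟩⟩
        · intro p
          rw [hd_eq, hl']
          simp only [hu', false_and, false_or]
          constructor
          · rintro ⟨rfl | rfl, h⟩
            · rfl
            · rw [hs1] at h; simp [Strand.rev, hup] at h
          · rintro rfl
            exact ⟨.inl rfl, by rw [hs0, hup]⟩
        · intro p
          rw [tl_eq, hl']
          simp only [hu', false_and, false_or]
          constructor
          · rintro ⟨rfl | rfl, h⟩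
            · rw [hs0] at h; simp [hup] at h
            · rfl
          · rintro rfl
            exact ⟨.inr rfl, by simp [hs1, Strand.rev, hup]⟩
        · exact congrArg f he
        · rw [heightLeft_eq, heightLeft_eq, heightWest_topPoint_zero,
            heightWest_topPoint_one _ _ _ _ h0]
          simp [hs0, hs1, Strand.rev, hup, flux, he]
          ring
      · refine ⟨_, G.nodeAt_link f (a := G.topPoint t 1 h1) (b := G.topPoint t 0 h0)
          ?_ ?_ ?_ ?_, .inl ⟨_, _, rfl, he.symm, hc⟩⟩
        · intro p
          rw [hd_eq, hl']
          simp only [hu', false_and, false_or]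
          constructor
          · rintro ⟨rfl | rfl, h⟩
            · rw [hs0] at h; simp [hup] at h
            · rfl
          · rintro rfl
            exact ⟨.inr rfl, by simp [hs1, Strand.rev, hup]⟩
        · intro p
          rw [tl_eq, hl']
          simp only [hu', false_and, false_or]
          constructor
          · rintro ⟨rfl | rfl, h⟩
            · rfl
            · rw [hs1] at h; simp [Strand.rev, hup] at h
          · rintro rfl
            exact ⟨.inl rfl, by rw [hs0, hup]⟩
        · exact congrArg f he.symm
        · rw [heightLeft_eq, heightLeft_eq, heightWest_topPoint_zero,
            heightWest_topPoint_one _ _ _ _ h0]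
          simp [hs0, hs1, Strand.rev, hup, flux, he]
    | cap l =>
      have h0 : 0 < (G.slice t).piece.bot.length := by rw [hP]; simp [Piece.bot]
      have h1 : 1 < (G.slice t).piece.bot.length := by rw [hP]; simp [Piece.bot]
      have hs0 : G.strand (G.botPoint t 0 h0) = l := by
        rw [strand_botPoint]; simp [hP, Piece.bot]
      have hs1 : G.strand (G.botPoint t 1 h1) = l.rev := by
        rw [strand_botPoint]; simp [hP, Piece.bot]
      have hl' : ∀ p, ¬ G.lower p = (t, none) := by
        intro p
        rw [hl]
        rintro ⟨k, h, -⟩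
        rw [hP] at h
        simp [Piece.top] at h
      have hu' : ∀ p, G.upper p = (t, none) ↔ p = G.botPoint t 0 h0 ∨ p = G.botPoint t 1 h1 := by
        intro p
        rw [hu]
        constructor
        · rintro ⟨k, h, rfl⟩
          have : k < 2 := by rw [hP] at h; simpa [Piece.bot] using h
          interval_cases k <;> simp
        · rintro (rfl | rfl)
          exacts [⟨0, h0, rfl⟩, ⟨1, h1, rfl⟩]
      have hc : G.corner t = none := by
        unfold corner
        split <;> rename_i h <;> simp [hP] at h <;> rfl
      have he : G.edge (G.botPoint t 0 h0) = G.edge (G.botPoint t 1 h1) := G.botEdge_cap t l hP h0 h1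
      cases hup : l.up
      · refine ⟨_, G.nodeAt_link f (a := G.botPoint t 1 h1) (b := G.botPoint t 0 h0)
          ?_ ?_ ?_ ?_, .inl ⟨_, _, rfl, he.symm, hc⟩⟩
        · intro p
          rw [hd_eq, hu']
          simp only [hl', false_and, or_false]
          constructor
          · rintro ⟨rfl | rfl, h⟩
            · rw [hs0] at h; simp [hup] at h
            · rfl
          · rintro rfl
            exact ⟨.inr rfl, by simp [hs1, Strand.rev, hup]⟩
        · intro p
          rw [tl_eq, hu']
          simp only [hl', false_and, or_false]
          constructor
          · rintro ⟨rfl | rfl, h⟩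
            · rfl
            · rw [hs1] at h; simp [Strand.rev, hup] at h
          · rintro rfl
            exact ⟨.inl rfl, by rw [hs0, hup]⟩
        · exact congrArg f he.symm
        · rw [heightLeft_eq, heightLeft_eq, heightWest_botPoint_zero,
            heightWest_botPoint_one _ _ _ _ h0]
          simp [hs0, hs1, Strand.rev, hup, flux, he]
          ring
      · refine ⟨_, G.nodeAt_link f (a := G.botPoint t 0 h0) (b := G.botPoint t 1 h1)
          ?_ ?_ ?_ ?_, .inl ⟨_, _, rfl, he, hc⟩⟩
        · intro p
          rw [hd_eq, hu']
          simp only [hl', false_and, or_false]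
          constructor
          · rintro ⟨rfl | rfl, h⟩
            · rfl
            · rw [hs1] at h; simp [Strand.rev, hup] at h
          · rintro rfl
            exact ⟨.inl rfl, by rw [hs0, hup]⟩
        · intro p
          rw [tl_eq, hu']
          simp only [hl', false_and, or_false]
          constructor
          · rintro ⟨rfl | rfl, h⟩
            · rw [hs0] at h; simp [hup] at h
            · rfl
          · rintro rfl
            exact ⟨.inr rfl, by simp [hs1, Strand.rev, hup]⟩
        · exact congrArg f he
        · rw [heightLeft_eq, heightLeft_eq, heightWest_botPoint_zero,
            heightWest_botPoint_one _ _ _ _ h0]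
          simp [hs0, hs1, Strand.rev, hup, flux, he]
    | split b l r =>
      have hb : 0 < (G.slice t).piece.bot.length := by rw [hP]; simp [Piece.bot]
      have h0 : 0 < (G.slice t).piece.top.length := by rw [hP]; simp [Piece.top]
      have h1 : 1 < (G.slice t).piece.top.length := by rw [hP]; simp [Piece.top]
      have hsb : G.strand (G.botPoint t 0 hb) = b := by
        rw [strand_botPoint]; simp [hP, Piece.bot]
      have hs0 : G.strand (G.topPoint t 0 h0) = l := by
        rw [strand_topPoint]; simp [hP, Piece.top]
      have hs1 : G.strand (G.topPoint t 1 h1) = r := by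
        rw [strand_topPoint]; simp [hP, Piece.top]
      have hu' : ∀ p, G.upper p = (t, none) ↔ p = G.botPoint t 0 hb := by
        intro p
        rw [hu]
        constructor
        · rintro ⟨k, h, rfl⟩
          have : k < 1 := by rw [hP] at h; simpa [Piece.bot] using h
          interval_cases k
          rfl
        · rintro rfl
          exact ⟨0, hb, rfl⟩
      have hl' : ∀ p, G.lower p = (t, none) ↔ p = G.topPoint t 0 h0 ∨ p = G.topPoint t 1 h1 := by
        intro p
        rw [hl]
        constructor
        · rintro ⟨k, h, rfl⟩
          have : k < 2 := by rw [hP] at h; simpa [Piece.top] using h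
          interval_cases k <;> simp
        · rintro (rfl | rfl)
          exacts [⟨0, h0, rfl⟩, ⟨1, h1, rfl⟩]
      have hc := G.corner_split t hP hb h0 h1
      rw [hP] at hadm
      obtain ⟨-, hne, -⟩ := hadm
      have hm := sum_outSign_eq_zero f hne (by rw [← hc]; exact hf t)
      obtain ⟨w, hw, hN⟩ := G.nodeAt_vertex f (v := (t, none)) (e₀ := G.botPoint t 0 hb)
        (e₁ := G.topPoint t 0 h0) (e₂ := G.topPoint t 1 h1) (o₀ := !b.up) (o₁ := l.up)
        (o₂ := r.up) G.botPoint_ne_topPoint G.botPoint_ne_topPoint G.topPoint_ne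
        (by
          intro p
          rw [hd_eq, hu', hl']
          constructor
          · rintro (⟨rfl, h⟩ | ⟨rfl | rfl, h⟩)
            · exact .inl ⟨rfl, by simpa [hsb] using h⟩
            · exact .inr (.inl ⟨rfl, by simpa [hs0] using h⟩)
            · exact .inr (.inr ⟨rfl, by simpa [hs1] using h⟩)
          · rintro (⟨rfl, h⟩ | ⟨rfl, h⟩ | ⟨rfl, h⟩)
            · exact .inl ⟨rfl, by simpa [hsb] using h⟩
            · exact .inr ⟨.inl rfl, by simpa [hs0] using h⟩
            · exact .inr ⟨.inr rfl, by simpa [hs1] using h⟩)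
        (by
          intro p
          rw [tl_eq, hu', hl']
          constructor
          · rintro (⟨rfl, h⟩ | ⟨rfl | rfl, h⟩)
            · exact .inl ⟨rfl, by simpa [hsb] using h⟩
            · exact .inr (.inl ⟨rfl, by simpa [hs0] using h⟩)
            · exact .inr (.inr ⟨rfl, by simpa [hs1] using h⟩)
          · rintro (⟨rfl, h⟩ | ⟨rfl, h⟩ | ⟨rfl, h⟩)
            · exact .inl ⟨rfl, by simpa [hsb] using h⟩
            · exact .inr ⟨.inl rfl, by simpa [hs0] using h⟩
            · exact .inr ⟨.inr rfl, by simpa [hs1] using h⟩)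
        -- The three regions are the one to the left of the vertex, the one between the two upper
        -- edges, and the one to the right, whose height is computed below the vertex.
        (((G.leftLev t).map (G.flux f)).sum)
        (((G.leftLev t).map (G.flux f)).sum + if l.up then f (G.edge (G.topPoint t 0 h0)) else -f (G.edge (G.topPoint t 0 h0)))
        (((G.leftLev t).map (G.flux f)).sum + if b.up then f (G.edge (G.botPoint t 0 hb)) else -f (G.edge (G.botPoint t 0 hb)))
        (by
          unfold Sides
          rw [heightLeft_eq, heightWest_botPoint_zero, hsb]
          cases b.up <;> simp; ring)
        (by
          unfold Sides
          rw [heightLeft_eq, heightWest_topPoint_zero, hs0]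
          cases l.up <;> simp; ring)
        (by
          unfold Sides
          rw [heightLeft_eq, heightWest_topPoint_one _ _ _ _ h0, hs0, hs1, flux]
          revert hm
          cases b.up <;> cases l.up <;> cases r.up <;> simp [outSign] <;> intro hm <;> omega) hne
      refine ⟨_, hN, .inr ⟨w, rfl, ?_⟩⟩
      rw [hc, ← Corner.map_ofClockwise, hw]
      rfl
    | merge l r b =>
      have hb : 0 < (G.slice t).piece.top.length := by rw [hP]; simp [Piece.top]
      have h0 : 0 < (G.slice t).piece.bot.length := by rw [hP]; simp [Piece.bot]
      have h1 : 1 < (G.slice t).piece.bot.length := by rw [hP]; simp [Piece.bot]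
      have hsb : G.strand (G.topPoint t 0 hb) = b := by
        rw [strand_topPoint]; simp [hP, Piece.top]
      have hs0 : G.strand (G.botPoint t 0 h0) = l := by
        rw [strand_botPoint]; simp [hP, Piece.bot]
      have hs1 : G.strand (G.botPoint t 1 h1) = r := by
        rw [strand_botPoint]; simp [hP, Piece.bot]
      have hl' : ∀ p, G.lower p = (t, none) ↔ p = G.topPoint t 0 hb := by
        intro p
        rw [hl]
        constructor
        · rintro ⟨k, h, rfl⟩
          have : k < 1 := by rw [hP] at h; simpa [Piece.top] using h
          interval_cases k
          rfl
        · rintro rfl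
          exact ⟨0, hb, rfl⟩
      have hu' : ∀ p, G.upper p = (t, none) ↔ p = G.botPoint t 0 h0 ∨ p = G.botPoint t 1 h1 := by
        intro p
        rw [hu]
        constructor
        · rintro ⟨k, h, rfl⟩
          have : k < 2 := by rw [hP] at h; simpa [Piece.bot] using h
          interval_cases k <;> simp
        · rintro (rfl | rfl)
          exacts [⟨0, h0, rfl⟩, ⟨1, h1, rfl⟩]
      have hc := G.corner_merge t hP hb h0 h1
      rw [hP] at hadm
      obtain ⟨-, hne, -⟩ := hadm
      have hne' : ¬ (b.up = (!r.up) ∧ (!r.up) = !l.up) := by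
        revert hne
        cases b.up <;> cases l.up <;> cases r.up <;> simp
      have hm := sum_outSign_eq_zero f hne' (by rw [← hc]; exact hf t)
      obtain ⟨w, hw, hN⟩ := G.nodeAt_vertex f (v := (t, none)) (e₀ := G.topPoint t 0 hb)
        (e₁ := G.botPoint t 1 h1) (e₂ := G.botPoint t 0 h0) (o₀ := b.up) (o₁ := !r.up)
        (o₂ := !l.up) G.botPoint_ne_topPoint.symm G.botPoint_ne_topPoint.symm G.botPoint_ne.symm
        (by
          intro p
          rw [hd_eq, hu', hl']
          constructor
          · rintro (⟨rfl | rfl, h⟩ | ⟨rfl, h⟩)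
            · exact .inr (.inr ⟨rfl, by simpa [hs0] using h⟩)
            · exact .inr (.inl ⟨rfl, by simpa [hs1] using h⟩)
            · exact .inl ⟨rfl, by simpa [hsb] using h⟩
          · rintro (⟨rfl, h⟩ | ⟨rfl, h⟩ | ⟨rfl, h⟩)
            · exact .inr ⟨rfl, by simpa [hsb] using h⟩
            · exact .inl ⟨.inr rfl, by simpa [hs1] using h⟩
            · exact .inl ⟨.inl rfl, by simpa [hs0] using h⟩)
        (by
          intro p
          rw [tl_eq, hu', hl']
          constructor
          · rintro (⟨rfl | rfl, h⟩ | ⟨rfl, h⟩)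
            · exact .inr (.inr ⟨rfl, by simpa [hs0] using h⟩)
            · exact .inr (.inl ⟨rfl, by simpa [hs1] using h⟩)
            · exact .inl ⟨rfl, by simpa [hsb] using h⟩
          · rintro (⟨rfl, h⟩ | ⟨rfl, h⟩ | ⟨rfl, h⟩)
            · exact .inr ⟨rfl, by simpa [hsb] using h⟩
            · exact .inl ⟨.inr rfl, by simpa [hs1] using h⟩
            · exact .inl ⟨.inl rfl, by simpa [hs0] using h⟩)
        (((G.leftLev t).map (G.flux f)).sum + if b.up then f (G.edge (G.topPoint t 0 hb)) else -f (G.edge (G.topPoint t 0 hb)))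
        (((G.leftLev t).map (G.flux f)).sum + if l.up then f (G.edge (G.botPoint t 0 h0)) else -f (G.edge (G.botPoint t 0 h0)))
        (((G.leftLev t).map (G.flux f)).sum)
        (by
          unfold Sides
          rw [heightLeft_eq, heightWest_topPoint_zero, hsb]
          cases b.up <;> simp; ring)
        (by
          unfold Sides
          rw [heightLeft_eq, heightWest_botPoint_one _ _ _ _ h0, hs0, hs1, flux]
          revert hm
          cases b.up <;> cases l.up <;> cases r.up <;> simp [outSign] <;> intro hm <;> omega)
        (by
          unfold Sides
          rw [heightLeft_eq, heightWest_botPoint_zero, hs0]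
          cases l.up <;> simp; ring)
        hne'
      refine ⟨_, hN, .inr ⟨w, rfl, ?_⟩⟩
      rw [hc, ← Corner.map_ofClockwise, hw]
      rfl
  exact key _ rfl

/-- The node of a vertical segment. -/
theorem exists_nodeAt_some (hf : G.Sums f) (t : Fin G.n) (k : ℕ)
    (hk : k < (G.slice t).left.length + (G.slice t).right.length) :
    ∃ a b, G.NodeAt f (t, some k) (.link a b) ∧ G.edge a = G.edge b := by
  have hu : ∀ p, G.upper p = (t, some k) ↔ p = G.botThrough t k hk := fun p =>
    G.upper_eq_some hk
  have hl : ∀ p, G.lower p = (t, some k) ↔ p = G.topThrough t k hk := fun p =>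
    G.lower_eq_some hk
  have hlink : (G.slice t).Through (G.botThrough t k hk).2 (G.topThrough t k hk).2 := by
    simp only [botThrough, topThrough]
    split_ifs with h
    · exact .inl ⟨h, rfl⟩
    · exact .inr ⟨k - (G.slice t).left.length, by omega, by omega⟩
  have he : G.edge (G.botThrough t k hk) = G.edge (G.topThrough t k hk) :=
    Quot.sound ⟨t, .inl ⟨rfl, rfl, hlink⟩⟩
  have hne : G.botThrough t k hk ≠ G.topThrough t k hk := by
    intro e
    have := congrArg (fun p : G.Point => (p.1 : ℕ)) e
    simp [botThrough, topThrough] at this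
  have hs : G.strand (G.botThrough t k hk) = G.strand (G.topThrough t k hk) := by
    have h₁ := G.strand_eq (G.botThrough t k hk) (G.level_castSucc t)
    have h₂ := G.strand_eq (G.topThrough t k hk) (G.level_succ t)
    simp only [Slice.bot, Slice.top] at h₁ h₂
    have h₃ : ((G.slice t).left ++ ((G.slice t).piece.bot ++ (G.slice t).right))[
        ((G.botThrough t k hk).2 : ℕ)]? = ((G.slice t).left ++ ((G.slice t).piece.top ++
          (G.slice t).right))[((G.topThrough t k hk).2 : ℕ)]? := by
      rcases hlink with ⟨h, h'⟩ | ⟨j, h, h'⟩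
      · rw [h', List.getElem?_append_left h, List.getElem?_append_left h]
      · rw [h, h', List.getElem?_append_right (by omega), List.getElem?_append_right (by omega),
          List.getElem?_append_right (by omega), List.getElem?_append_right (by omega)]
        congr 1
        omega
    rw [h₁, h₂] at h₃
    exact Option.some.inj h₃
  have hw : G.heightWest f (G.botThrough t k hk) = G.heightWest f (G.topThrough t k hk) := by
    simp only [heightWest]
    change G.gapSum (G.flux f) t.castSucc _ = G.gapSum (G.flux f) t.succ _
    rcases hlink with ⟨h, h'⟩ | ⟨j, h, h'⟩
    · rw [h', gapSum_castSucc _ _ _ h.le, gapSum_succ' _ _ _ h.le]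
    · rw [h, h', gapSum_bot_add, gapSum_top_add, G.balanced_flux hf t]
  have hc : f (G.edge (G.botThrough t k hk)) = f (G.edge (G.topThrough t k hk)) := congrArg f he
  have hh : G.heightLeft f (G.botThrough t k hk) = G.heightLeft f (G.topThrough t k hk) := by
    rw [heightLeft_eq, heightLeft_eq, hs, hw, hc]
  cases hup : (G.strand (G.botThrough t k hk)).up
  · refine ⟨_, _, G.nodeAt_link f ?_ ?_ hc.symm hh.symm, he.symm⟩
    · intro p
      rw [hd_eq, hu, hl]
      constructor
      · rintro (⟨rfl, h⟩ | ⟨rfl, h⟩)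
        · simp [hup] at h
        · rfl
      · rintro rfl
        exact .inr ⟨rfl, by rw [← hs, hup]⟩
    · intro p
      rw [tl_eq, hu, hl]
      constructor
      · rintro (⟨rfl, h⟩ | ⟨rfl, h⟩)
        · rfl
        · rw [← hs, hup] at h; simp at h
      · rintro rfl
        exact .inl ⟨rfl, hup⟩
  · refine ⟨_, _, G.nodeAt_link f ?_ ?_ hc hh, he⟩
    · intro p
      rw [hd_eq, hu, hl]
      constructor
      · rintro (⟨rfl, h⟩ | ⟨rfl, h⟩)
        · rfl
        · rw [← hs, hup] at h; simp at h
      · rintro rfl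
        exact .inl ⟨rfl, hup⟩
    · intro p
      rw [tl_eq, hu, hl]
      constructor
      · rintro (⟨rfl, h⟩ | ⟨rfl, h⟩)
        · simp [hup] at h
        · rfl
      · rintro rfl
        exact .inr ⟨rfl, by rw [← hs, hup]⟩

end Height

end Diagram

/-! ### Normalized vertex weights and the two kernel vectors -/

/-- Vanishing would give `q ^ (2 k) = 1`, but no nonzero power of the variable is `1`, by degree. -/
theorem br_ne_zero {k : ℤ} (hk : k ≠ 0) : br k ≠ 0 := by
  intro h
  have h₁ : q ^ (k + k) = 1 := by
    rw [br, sub_eq_zero] at h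
    rw [zpow_add₀ q_ne_zero]
    nth_rewrite 2 [h]
    rw [← zpow_add₀ q_ne_zero, add_neg_cancel, zpow_zero]
  have key : ∀ n : ℕ, n ≠ 0 → q ^ n ≠ 1 := by
    intro n hn h
    rw [q, ← RatFunc.algebraMap_X, ← map_pow, ← map_one (algebraMap (Polynomial ℚ) K)] at h
    have := RatFunc.algebraMap_injective ℚ h
    have := congrArg Polynomial.natDegree this
    simp at this
    exact hn this
  rcases Int.eq_nat_or_neg (k + k) with ⟨n, hn | hn⟩
  · rw [hn, zpow_natCast] at h₁
    exact key n (by omega) h₁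
  · rw [hn, zpow_neg, inv_eq_one, zpow_natCast] at h₁
    exact key n (by omega) h₁

section NodeWeights

variable {P : Type} [DecidableEq P] (c : P → ℤ)

/-- The normalized weight of a solid edge entering a node. -/
noncomputable def Node.inWeight (p : P) : Node P → K
  | .vertex (.even _ inL inR) => if p = inR then q ^ (2 * c inL) else 1
  | _ => 1

/-- The normalized weight of a solid edge leaving a node. -/
noncomputable def Node.outWeight (p : P) : Node P → K
  | .vertex (.odd _ outL outR) =>
      if p = outL then br (2 * c outL) * q ^ (-2 * c outR) / br (2 * c outL + 2 * c outR)
      else br (2 * c outR) / br (2 * c outL + 2 * c outR)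
  | _ => 1

/-- The weight of a vertex in the zero state. -/
noncomputable def zeroWeight : Option (Corner P) → K
  | some (.odd _ outL outR) => br (2 * c outL + 2 * c outR)
  | _ => 1

/-- The only identity between vertex weights behind the independence of the initial point; both
kernel equations reduce to it. -/
theorem br_add (i j : ℤ) :
    br (2 * i + 2 * j) = br (2 * j) * q ^ (2 * i) + br (2 * i) * q ^ (-2 * j) := by
  simp only [br, neg_add, zpow_add₀ q_ne_zero, neg_mul]
  ring

/-- The local equation of the left kernel vector `q ^ (2 h)`. At a vertex with two outgoing edges
the right one is higher by `c outL`, which turns the equation into `br_add`; at a vertex with two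
incoming edges the weight `q ^ (2 c inL)` accounts for the difference in height. -/
theorem Node.solution_left {h : P → ℤ} {N : Node P} (hN : N.Balanced c h) (ho : N.outs.Nodup)
    (hc : ∀ p, 0 < c p) (hi : N.ins.Nodup) {p : P} (hp : p ∈ N.ins) :
    q ^ (2 * h p) = N.inWeight c p *
      (N.outs.map fun r => N.outWeight c r * q ^ (2 * h r)).sum := by
  match N with
  | .link a b =>
    simp only [ins, List.mem_singleton] at hp
    subst hp
    simp [inWeight, outs, outWeight, hN.2]
  | .vertex (.odd inn outL outR) =>
    simp only [ins, List.mem_singleton] at hp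
    subst hp
    simp only [outs, List.nodup_cons, List.mem_singleton] at ho
    obtain ⟨-, h₁, h₂⟩ := hN
    have hne : br (2 * c outL + 2 * c outR) ≠ 0 :=
      br_ne_zero (by have := hc outL; have := hc outR; omega)
    have e := br_add (c outL) (c outR)
    simp only [inWeight, outs, outWeight, List.map_cons, List.map_nil, List.sum_cons, List.sum_nil,
      if_true, if_neg (Ne.symm ho.1), h₁, h₂, mul_add, zpow_add₀ q_ne_zero (2 * h outL)]
    have e' : ∀ A B D X Y : K,
        1 * (A / D * X) + (1 * (B / D * (X * Y)) + 1 * 0) = X * ((B * Y + A) / D) := by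
      intros
      ring
    rw [e', ← e, div_self hne, mul_one]
  | .vertex (.even out inL inR) =>
    simp only [ins, List.mem_cons, List.not_mem_nil, or_false] at hp
    simp only [ins, List.nodup_cons, List.mem_singleton] at hi
    obtain ⟨-, h₁, h₂⟩ := hN
    rcases hp with rfl | rfl
    · simp [inWeight, outs, outWeight, h₁, hi.1]
    · simp only [inWeight, outs, outWeight, h₁, h₂, mul_add, zpow_add₀ q_ne_zero, if_true,
        List.map_cons, List.map_nil, List.sum_cons, List.sum_nil, one_mul, add_zero]
      rw [mul_comm]

/-- The local equation of the right kernel vector. Since `h p + c p` is the height of the region on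
the right of the edge, the two vectors are dual under exchanging the sides; now it is the vertex
with two incoming edges that needs `br_add`. -/
theorem Node.solution_right {h : P → ℤ} {N : Node P} (hN : N.Balanced c h) (ho : N.outs.Nodup)
    (hc : ∀ p, 0 < c p) (hi : N.ins.Nodup) {p : P} (hp : p ∈ N.outs) :
    br (2 * c p) * q ^ (2 * (h p + c p)) = N.outWeight c p *
      (N.ins.map fun r => N.inWeight c r * (br (2 * c r) * q ^ (2 * (h r + c r)))).sum := by
  match N with
  | .link a b =>
    simp only [outs, List.mem_singleton] at hp
    subst hp
    simp [inWeight, ins, outWeight, hN.1, hN.2]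
  | .vertex (.odd inn outL outR) =>
    simp only [outs, List.mem_cons, List.not_mem_nil, or_false] at hp
    simp only [outs, List.nodup_cons, List.mem_singleton] at ho
    obtain ⟨h₀, h₁, h₂⟩ := hN
    have hne : br (2 * c outL + 2 * c outR) ≠ 0 :=
      br_ne_zero (by have := hc outL; have := hc outR; omega)
    rcases hp with rfl | rfl
    · simp only [outWeight, if_true, ins, inWeight, List.map_cons, List.map_nil, List.sum_cons,
        List.sum_nil, h₀, h₁, one_mul, add_zero]
      rw [mul_add 2 (c p), div_mul_eq_mul_div, eq_div_iff hne, ← add_assoc, mul_add 2 (h p + c p),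
        zpow_add₀ q_ne_zero (2 * (h p + c p)), neg_mul, zpow_neg]
      have := zpow_ne_zero (2 * c outR) q_ne_zero
      field_simp
    · simp only [outWeight, if_neg (Ne.symm ho.1), ins, inWeight, List.map_cons, List.map_nil,
        List.sum_cons, List.sum_nil, h₀, h₁, h₂, one_mul, add_zero]
      rw [mul_add 2 (c outL), div_mul_eq_mul_div, eq_div_iff hne, ← add_assoc]
      ring
  | .vertex (.even out inL inR) =>
    simp only [outs, List.mem_singleton] at hp
    subst hp
    simp only [ins, List.nodup_cons, List.mem_singleton] at hi
    obtain ⟨h₀, h₁, h₂⟩ := hN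
    simp only [inWeight, outWeight, ins, List.map_cons, List.map_nil, List.sum_cons,
      List.sum_nil, if_true, if_neg hi.1, h₀, h₁, h₂, one_mul, add_zero]
    rw [mul_add 2 (c inL) (c inR), br_add]
    simp only [mul_add, zpow_add₀ q_ne_zero, neg_mul, zpow_neg]
    have := zpow_ne_zero (2 * c inR) q_ne_zero
    field_simp
    ring

/-- After division by the zero state the vertex weight factors into one weight for each solid end.
The factorization is possible because at most one incoming and one outgoing edge are solid. -/
theorem Node.cornerWeight_eq {w : Corner P} (hi : (Node.vertex w).ins.Nodup)
    (ho : (Node.vertex w).outs.Nodup) (hc : ∀ p, 0 < c p) (s : P → Bool) (hs : w.Conserves s) :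
    cornerWeight c s (some w) = zeroWeight c (some w) *
      (((Node.vertex w).ins.map fun p =>
        if s p = true then (Node.vertex w).inWeight c p else 1).prod *
      ((Node.vertex w).outs.map fun p =>
        if s p = true then (Node.vertex w).outWeight c p else 1).prod) := by
  match w with
  | .odd inn outL outR =>
    simp only [outs, List.nodup_cons, List.mem_singleton] at ho
    have hne : br (2 * c outL + 2 * c outR) ≠ 0 :=
      br_ne_zero (by have := hc outL; have := hc outR; omega)
    revert hs
    cases h₀ : s inn <;> cases h₁ : s outL <;> cases h₂ : s outR <;>
      simp [Corner.Conserves, cornerWeight, Corner.wt, zeroWeight, ins, outs, inWeight, outWeight,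
        h₀, h₁, h₂, Ne.symm ho.1] <;> field_simp
  | .even out inL inR =>
    simp only [ins, List.nodup_cons, List.mem_singleton] at hi
    revert hs
    cases h₀ : s out <;> cases h₁ : s inL <;> cases h₂ : s inR <;>
      simp [Corner.Conserves, cornerWeight, Corner.wt, zeroWeight, ins, outs, inWeight, outWeight,
        h₀, h₁, h₂, hi.1]

end NodeWeights

/-- The labels of the incoming and of the outgoing edges of a node have the same sum. -/
def Node.Conserves {P : Type} (s : P → Bool) : Node P → Prop
  | .link a b => s a = s b
  | .vertex w => w.Conserves s

/-- With one edge alone on the incoming or on the outgoing side, conservation of labels means that a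
solid curve traverses the node at most once and neither starts nor ends there. -/
theorem Node.conserves_of {P : Type} {s : P → Bool} {N : Node P}
    (hi : ∀ p ∈ N.ins, ∀ p' ∈ N.ins, s p = true → s p' = true → p = p')
    (ho : ∀ p ∈ N.outs, ∀ p' ∈ N.outs, s p = true → s p' = true → p = p')
    (hn : ∀ p ∈ N.ins, s p = true → ∃ p' ∈ N.outs, s p' = true)
    (hp : ∀ p ∈ N.outs, s p = true → ∃ p' ∈ N.ins, s p' = true)
    (hi' : N.ins.Nodup) (ho' : N.outs.Nodup) : N.Conserves s := by
  match N with
  | .link a b =>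
    simp only [ins, outs, List.mem_singleton, forall_eq, exists_eq_left] at hn hp
    exact Bool.eq_iff_iff.2 ⟨hn, hp⟩
  | .vertex (.odd inn outL outR) =>
    simp only [outs, List.nodup_cons, List.mem_singleton] at ho'
    revert hn hp ho
    simp only [Conserves, Corner.Conserves]
    cases h₀ : s inn <;> cases h₁ : s outL <;> cases h₂ : s outR <;>
      simp [ins, outs, h₀, h₁, h₂, ho'.1]
  | .vertex (.even out inL inR) =>
    simp only [ins, List.nodup_cons, List.mem_singleton] at hi'
    revert hn hp hi
    simp only [Conserves, Corner.Conserves]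
    cases h₀ : s out <;> cases h₁ : s inL <;> cases h₂ : s inR <;>
      simp [ins, outs, h₀, h₁, h₂, hi'.1]

theorem Node.Conserves.ins_unique {P : Type} {s : P → Bool} {N : Node P} (h : N.Conserves s) :
    ∀ p ∈ N.ins, ∀ p' ∈ N.ins, s p = true → s p' = true → p = p' := by
  match N with
  | .link a b => simp [ins]
  | .vertex (.odd inn outL outR) => simp [ins]
  | .vertex (.even out inL inR) =>
    revert h
    simp only [Conserves, Corner.Conserves, ins]
    cases h₀ : s out <;> cases h₁ : s inL <;> cases h₂ : s inR <;> simp [h₁, h₂]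

theorem Node.Conserves.outs_unique {P : Type} {s : P → Bool} {N : Node P} (h : N.Conserves s) :
    ∀ p ∈ N.outs, ∀ p' ∈ N.outs, s p = true → s p' = true → p = p' := by
  match N with
  | .link a b => simp [outs]
  | .vertex (.even out inL inR) => simp [outs]
  | .vertex (.odd inn outL outR) =>
    revert h
    simp only [Conserves, Corner.Conserves, outs]
    cases h₀ : s inn <;> cases h₁ : s outL <;> cases h₂ : s outR <;> simp [h₁, h₂]

theorem Node.Conserves.next {P : Type} {s : P → Bool} {N : Node P} (h : N.Conserves s) :
    ∀ p ∈ N.ins, s p = true → ∃ p' ∈ N.outs, s p' = true := by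
  match N with
  | .link a b => simp [ins, outs, show s a = s b from h]
  | .vertex (.odd inn outL outR) =>
    revert h
    simp only [Conserves, Corner.Conserves, outs, ins]
    cases h₀ : s inn <;> cases h₁ : s outL <;> cases h₂ : s outR <;> simp [h₀, h₁, h₂]
  | .vertex (.even out inL inR) =>
    revert h
    simp only [Conserves, Corner.Conserves, outs, ins]
    cases h₀ : s out <;> cases h₁ : s inL <;> cases h₂ : s inR <;> simp [h₀, h₁, h₂]

theorem Node.Conserves.prev {P : Type} {s : P → Bool} {N : Node P} (h : N.Conserves s) :
    ∀ p ∈ N.outs, s p = true → ∃ p' ∈ N.ins, s p' = true := by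
  match N with
  | .link a b => simp [ins, outs, show s a = s b from h]
  | .vertex (.odd inn outL outR) =>
    revert h
    simp only [Conserves, Corner.Conserves, outs, ins]
    cases h₀ : s inn <;> cases h₁ : s outL <;> cases h₂ : s outR <;> simp [h₀, h₁, h₂]
  | .vertex (.even out inL inR) =>
    revert h
    simp only [Conserves, Corner.Conserves, outs, ins]
    cases h₀ : s out <;> cases h₁ : s inL <;> cases h₂ : s inR <;> simp [h₀, h₁, h₂]

/-- No node has both two incoming and two outgoing edges; this is the hypothesis under which
permutation cycles are disjoint curves. -/
theorem Node.eq_of_mem_ins {P : Type} {N : Node P} {p p' r r' : P} (hp : p ∈ N.ins)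
    (hp' : p' ∈ N.ins) (hne : p ≠ p') (hr : r ∈ N.outs) (hr' : r' ∈ N.outs) : r = r' := by
  match N with
  | .link a b => simp_all [ins, outs]
  | .vertex (.odd inn outL outR) => simp_all [ins, outs]
  | .vertex (.even out inL inR) => simp_all [ins, outs]

theorem Corner.conserves_map {E P : Type} (f : P → E) (φ : E → Bool) (w : Corner P) :
    (w.map f).Conserves φ ↔ w.Conserves fun p => φ (f p) := by
  cases w <;> rfl

theorem Corner.wt_map {E P : Type} (f : P → E) (c : E → ℤ) (φ : E → Bool) (w : Corner P) :
    (w.map f).wt c φ = w.wt (fun p => c (f p)) fun p => φ (f p) := by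
  cases w <;> rfl

theorem Corner.mem_edges_map {E P : Type} (f : P → E) (w : Corner P) (e : E) :
    e ∈ (w.map f).edges ↔ ∃ p, (p ∈ (Node.vertex w).ins ∨ p ∈ (Node.vertex w).outs) ∧ f p = e := by
  cases w <;> simp [map, edges, Node.ins, Node.outs, or_and_right, exists_or, eq_comm, or_comm]

/-! ### Flows on the points as conserved labelings of the edges -/

namespace Diagram

variable (G : Diagram)

/-- The nodes of the network: the pieces of the slices and the vertical segments. -/
def IsNode (v : Fin G.n × Option ℕ) : Prop :=
  ∀ k, v.2 = some k → k < (G.slice v.1).left.length + (G.slice v.1).right.length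

theorem isNode_upper (p : G.Point) : G.IsNode (G.upper p) := fun _ h => G.upper_lt p h

theorem isNode_lower (p : G.Point) : G.IsNode (G.lower p) := fun _ h => G.lower_lt p h

theorem isNode_hd (p : G.Point) : G.IsNode (G.hd p) := by
  unfold hd
  split_ifs
  exacts [G.isNode_upper p, G.isNode_lower p]

theorem isNode_tl (p : G.Point) : G.IsNode (G.tl p) := by
  unfold tl
  split_ifs
  exacts [G.isNode_lower p, G.isNode_upper p]

theorem isNode_none (t : Fin G.n) : G.IsNode (t, none) := by
  rintro k ⟨⟩

/-- A description of the nodes of the network. -/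
structure NodeFamily (f : G.Edge → ℤ) (N : Fin G.n × Option ℕ → Node G.Point) : Prop where
  nodeAt : ∀ v, G.IsNode v → G.NodeAt f v (N v)
  kind : ∀ v, G.IsNode v →
    (∃ a b, N v = .link a b ∧ G.edge a = G.edge b ∧ ∀ t, v = (t, none) → G.corner t = none) ∨
    ∃ w t, v = (t, none) ∧ N v = .vertex w ∧ G.corner t = some (w.map G.edge)

theorem exists_nodeFamily {f : G.Edge → ℤ} (hf : G.Sums f) (o : G.Point) : ∃ N, G.NodeFamily f N := by
  have key : ∀ v, ∃ N, G.IsNode v → G.NodeAt f v N ∧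
      ((∃ a b, N = .link a b ∧ G.edge a = G.edge b ∧ ∀ t, v = (t, none) → G.corner t = none) ∨
        ∃ w t, v = (t, none) ∧ N = .vertex w ∧ G.corner t = some (w.map G.edge)) := by
    rintro ⟨t, _ | k⟩
    · obtain ⟨N, hN, ⟨a, b, h, h', h''⟩ | ⟨w, h, h'⟩⟩ := G.exists_nodeAt_none f hf t
      · refine ⟨N, fun _ => ⟨hN, .inl ⟨a, b, h, h', ?_⟩⟩⟩
        rintro t' ⟨⟩
        exact h''
      · exact ⟨N, fun _ => ⟨hN, .inr ⟨w, t, rfl, h, h'⟩⟩⟩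
    · by_cases hv : G.IsNode (t, some k)
      · obtain ⟨a, b, h, h'⟩ := G.exists_nodeAt_some f hf t k (hv k rfl)
        exact ⟨_, fun _ => ⟨h, .inl ⟨a, b, rfl, h', by simp⟩⟩⟩
      · exact ⟨.link o o, fun h => absurd h hv⟩
  choose N hN using key
  exact ⟨N, fun v hv => (hN v hv).1, fun v hv => (hN v hv).2⟩

section Family

variable {G} {f : G.Edge → ℤ} {N : Fin G.n × Option ℕ → Node G.Point} (hN : G.NodeFamily f N)

theorem incident_iff {p : G.Point} {v : Fin G.n × Option ℕ} :
    (G.upper p = v ∨ G.lower p = v) ↔ (G.hd p = v ∨ G.tl p = v) := by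
  unfold hd tl
  cases (G.strand p).up <;> simp [or_comm]

include hN in
-- Every point enters and leaves a node, so the global conditions on a flow are the conjunction of
-- the local ones.
theorem isFlow_iff (s : G.Point → Bool) :
    IsFlow G.hd G.tl s ↔ ∀ v, G.IsNode v → (N v).Conserves s := by
  constructor
  · intro h v hv
    obtain ⟨hi, ho, hi', ho', -⟩ := hN.nodeAt v hv
    refine Node.conserves_of ?_ ?_ ?_ ?_ hi' ho'
    · intro p hp p' hp'
      rw [← hi] at hp hp'
      exact fun h₁ h₂ => h.hd_inj p p' h₁ h₂ (hp.trans hp'.symm)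
    · intro p hp p' hp'
      rw [← ho] at hp hp'
      exact fun h₁ h₂ => h.tl_inj p p' h₁ h₂ (hp.trans hp'.symm)
    · intro p hp hs
      rw [← hi] at hp
      obtain ⟨p', h₁, h₂⟩ := h.next p hs
      exact ⟨p', (ho p').1 (h₂.trans hp), h₁⟩
    · intro p hp hs
      rw [← ho] at hp
      obtain ⟨p', h₁, h₂⟩ := h.prev p hs
      exact ⟨p', (hi p').1 (h₂.trans hp), h₁⟩
  · intro h
    constructor
    · intro p p' h₁ h₂ e
      have hv := G.isNode_hd p
      have hA := hN.nodeAt _ hv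
      exact (h _ hv).ins_unique p ((hA.ins p).1 rfl) p' ((hA.ins p').1 e.symm) h₁ h₂
    · intro p p' h₁ h₂ e
      have hv := G.isNode_tl p
      have hA := hN.nodeAt _ hv
      exact (h _ hv).outs_unique p ((hA.outs p).1 rfl) p' ((hA.outs p').1 e.symm) h₁ h₂
    · intro p h₁
      have hv := G.isNode_hd p
      have hA := hN.nodeAt _ hv
      obtain ⟨p', h₂, h₃⟩ := (h _ hv).next p ((hA.ins p).1 rfl) h₁
      exact ⟨p', h₃, (hA.outs p').2 h₂⟩
    · intro p h₁
      have hv := G.isNode_tl p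
      have hA := hN.nodeAt _ hv
      obtain ⟨p', h₂, h₃⟩ := (h _ hv).prev p ((hA.outs p).1 rfl) h₁
      exact ⟨p', h₃, (hA.ins p').2 h₂⟩

include hN in
theorem conserves_edge {φ : G.Edge → Bool} (hφ : G.Conserved φ) (v) (hv : G.IsNode v) :
    (N v).Conserves fun p => φ (G.edge p) := by
  rcases hN.kind v hv with ⟨a, b, h, h', -⟩ | ⟨w, t, -, h, h'⟩
  · rw [h]
    exact congrArg φ h'
  · rw [h]
    exact (Corner.conserves_map G.edge φ w).1 (hφ t _ h')

include hN in
theorem conserved_of_conserves {φ : G.Edge → Bool}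
    (h : ∀ v, G.IsNode v → (N v).Conserves fun p => φ (G.edge p)) : G.Conserved φ := by
  intro t w hw
  have ht := G.isNode_none t
  rcases hN.kind _ ht with ⟨a, b, -, -, h'⟩ | ⟨w', t', h₁, h₂, h₃⟩
  · rw [h' t rfl] at hw
    cases hw
  · obtain ⟨rfl, -⟩ := Prod.ext_iff.1 h₁
    have h₄ := h _ ht
    rw [h₂] at h₄
    dsimp only at h₃
    obtain rfl : w'.map G.edge = w := Option.some.inj (h₃.symm.trans hw)
    exact (Corner.conserves_map G.edge φ w').2 h₄

include hN in
/-- Linked points lie at a common node, which is not a vertex. -/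
theorem exists_node_of_link {p p' : G.Point} (h : G.Link p p') :
    ∃ v a b, G.IsNode v ∧ N v = .link a b ∧ (p = a ∨ p = b) ∧ (p' = a ∨ p' = b) := by
  have key : ∀ v, (G.upper p = v ∨ G.lower p = v) → (G.upper p' = v ∨ G.lower p' = v) →
      (∀ t, v = (t, none) → G.corner t = none) →
      ∃ v a b, G.IsNode v ∧ N v = .link a b ∧ (p = a ∨ p = b) ∧ (p' = a ∨ p' = b) := by
    intro v h₁ h₂ h₃
    have hv : G.IsNode v := by
      rcases h₁ with rfl | rfl
      exacts [G.isNode_upper p, G.isNode_lower p]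
    have hA := hN.nodeAt v hv
    rcases hN.kind v hv with ⟨a, b, h, -, -⟩ | ⟨w, t, h, -, h'⟩
    · refine ⟨v, a, b, hv, h, ?_, ?_⟩
      · rw [incident_iff, hA.ins, hA.outs, h] at h₁
        simpa [Node.ins, Node.outs] using h₁
      · rw [incident_iff, hA.ins, hA.outs, h] at h₂
        simpa [Node.ins, Node.outs] using h₂
    · rw [h₃ t h] at h'
      cases h'
  obtain ⟨t, ⟨h₁, h₂, h₃⟩ | ⟨h₁, h₂, ⟨l, hl⟩, h₃, h₄⟩ | ⟨h₁, h₂, ⟨l, hl⟩, h₃, h₄⟩⟩ := h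
  · rcases h₃ with ⟨h, h'⟩ | ⟨k, h, h'⟩
    · refine key (t, some p.2) (.inl ?_) (.inr ?_) (by simp)
      · rw [upper_eq, place_eq_some, if_pos h]
        exact ⟨h₁, rfl⟩
      · rw [lower_eq, place_eq_some, if_pos h]
        exact ⟨h₂, h'⟩
    · refine key (t, some ((G.slice t).left.length + k)) (.inl ?_) (.inr ?_) (by simp)
      · rw [upper_eq, place_eq_some, if_neg (by omega)]
        exact ⟨h₁, by omega⟩
      · rw [lower_eq, place_eq_some, if_neg (by omega)]
        exact ⟨h₂, by omega⟩
  · have hc : G.corner t = none := by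
      unfold corner
      split <;> rename_i h <;> simp [hl] at h <;> rfl
    refine key (t, none) (.inl ?_) (.inl ?_) (by rintro t' ⟨⟩; exact hc)
    · rw [upper_eq, place_eq_none]
      exact ⟨h₁, 0, by simp [hl, Piece.bot], h₃⟩
    · rw [upper_eq, place_eq_none]
      exact ⟨h₂, 1, by simp [hl, Piece.bot], h₄⟩
  · have hc : G.corner t = none := by
      unfold corner
      split <;> rename_i h <;> simp [hl] at h <;> rfl
    refine key (t, none) (.inr ?_) (.inr ?_) (by rintro t' ⟨⟩; exact hc)
    · rw [lower_eq, place_eq_none]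
      exact ⟨h₁, 0, by simp [hl, Piece.top], h₃⟩
    · rw [lower_eq, place_eq_none]
      exact ⟨h₂, 1, by simp [hl, Piece.top], h₄⟩

include hN in
/-- Flows are the conserved labelings of the edges. -/
theorem isFlow_iff_exists (s : G.Point → Bool) :
    IsFlow G.hd G.tl s ↔ ∃ φ, G.Conserved φ ∧ s = fun p => φ (G.edge p) := by
  constructor
  · intro h
    rw [isFlow_iff hN] at h
    have hl : ∀ p p', G.Link p p' → s p = s p' := by
      intro p p' hl
      obtain ⟨v, a, b, hv, h₁, h₂, h₃⟩ := exists_node_of_link hN hl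
      have h₄ := h v hv
      rw [h₁] at h₄
      have h₄ : s a = s b := h₄
      rcases h₂ with rfl | rfl <;> rcases h₃ with rfl | rfl <;> simp [h₄]
    exact ⟨Quot.lift s hl, conserved_of_conserves hN h, rfl⟩
  · rintro ⟨φ, hφ, rfl⟩
    rw [isFlow_iff hN]
    exact conserves_edge hN hφ

include hN in
-- The curves are counted by successive points in the network and by edges sharing a vertex in the
-- state sum. At a conserved node all solid points are equivalent, so passing from points to their
-- edges induces a bijection of classes.
theorem flowCurves_eq_solidCurves {φ : G.Edge → Bool} (hφ : G.Conserved φ) :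
    flowCurves G.hd G.tl (fun p => φ (G.edge p)) = G.solidCurves φ := by
  classical
  have hcons := conserves_edge hN hφ
  let r : {p : G.Point // φ (G.edge p) = true} → {p : G.Point // φ (G.edge p) = true} → Prop :=
    fun p p' => G.hd p.1 = G.tl p'.1
  let r' : {e : G.Edge // φ e = true} → {e : G.Edge // φ e = true} → Prop := fun e e' =>
    ∃ t, ∃ v ∈ G.corner t, e.1 ∈ v.edges ∧ e'.1 ∈ v.edges
  have hF : ∀ p p' : {p : G.Point // φ (G.edge p) = true}, r p p' →
      (Quot.mk r' ⟨G.edge p.1, p.2⟩ : Quot r') = Quot.mk r' ⟨G.edge p'.1, p'.2⟩ := by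
    rintro ⟨p, hp⟩ ⟨p', hp'⟩ h
    have hv := G.isNode_hd p
    have hA := hN.nodeAt _ hv
    have h₁ := (hA.ins p).1 rfl
    have h₂ := (hA.outs p').1 h.symm
    rcases hN.kind _ hv with ⟨a, b, h', h'', -⟩ | ⟨w, t, -, h', h''⟩
    · rw [h'] at h₁ h₂
      simp only [Node.ins, Node.outs, List.mem_singleton] at h₁ h₂
      subst h₁ h₂
      simp only [h'']
    · rw [h'] at h₁ h₂
      refine Quot.sound ⟨t, _, h'', ?_, ?_⟩
      · exact (Corner.mem_edges_map _ _ _).2 ⟨p, .inl h₁, rfl⟩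
      · exact (Corner.mem_edges_map _ _ _).2 ⟨p', .inr h₂, rfl⟩
  let F : Quot r → Quot r' := Quot.lift (fun p => Quot.mk r' ⟨G.edge p.1, p.2⟩) hF
  have hlink : ∀ v, G.IsNode v → ∀ p p' : {p : G.Point // φ (G.edge p) = true},
      (p.1 ∈ (N v).ins ∨ p.1 ∈ (N v).outs) → (p'.1 ∈ (N v).ins ∨ p'.1 ∈ (N v).outs) →
      (Quot.mk r p : Quot r) = Quot.mk r p' := by
    rintro v hv ⟨p, hp⟩ ⟨p', hp'⟩ h₁ h₂
    have hA := hN.nodeAt _ hv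
    have hc := hcons v hv
    rcases h₁ with h₁ | h₁ <;> rcases h₂ with h₂ | h₂
    · simp only [hc.ins_unique p h₁ p' h₂ hp hp']
    · exact Quot.sound (((hA.ins p).2 h₁).trans ((hA.outs p').2 h₂).symm)
    · exact (Quot.sound (r := r) (show r ⟨p', hp'⟩ ⟨p, hp⟩ from
        ((hA.ins p').2 h₂).trans ((hA.outs p).2 h₁).symm)).symm
    · simp only [hc.outs_unique p h₁ p' h₂ hp hp']
  -- The inverse map has to be defined on all edges before it can be restricted to solid ones; edges
  -- with label `0` get the dummy value `none`.
  let g₀ : G.Point → Option (Quot r) := fun p =>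
    if h : φ (G.edge p) = true then some (Quot.mk r ⟨p, h⟩) else none
  have hg₀ : ∀ p p', G.Link p p' → g₀ p = g₀ p' := by
    intro p p' hl
    have he : G.edge p = G.edge p' := Quot.sound hl
    obtain ⟨v, a, b, hv, h₁, h₂, h₃⟩ := exists_node_of_link hN hl
    by_cases h : φ (G.edge p) = true
    · have h' : φ (G.edge p') = true := he ▸ h
      simp only [g₀, dif_pos h, dif_pos h', Option.some.injEq]
      refine hlink v hv _ _ ?_ ?_ <;> rw [h₁] <;> simpa [Node.ins, Node.outs]
    · have h' : ¬ φ (G.edge p') = true := he ▸ h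
      simp only [g₀, dif_neg h, dif_neg h']
  let g₁ : G.Edge → Option (Quot r) := Quot.lift g₀ hg₀
  have hg₁ : ∀ e e' : {e : G.Edge // φ e = true}, r' e e' → g₁ e.1 = g₁ e'.1 := by
    rintro ⟨e, he⟩ ⟨e', he'⟩ ⟨t, v, hv, h₁, h₂⟩
    have ht := G.isNode_none t
    rcases hN.kind _ ht with ⟨a, b, -, -, h'⟩ | ⟨w, t', h₃, h₄, h₅⟩
    · rw [h' t rfl] at hv
      cases hv
    · obtain ⟨rfl, -⟩ := Prod.ext_iff.1 h₃
      dsimp only at h₅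
      obtain rfl : w.map G.edge = v := Option.some.inj (h₅.symm.trans hv)
      rw [Corner.mem_edges_map] at h₁ h₂
      obtain ⟨p, h₁, rfl⟩ := h₁
      obtain ⟨p', h₂, rfl⟩ := h₂
      change g₀ p = g₀ p'
      simp only [g₀, dif_pos he, dif_pos he', Option.some.injEq]
      rw [← h₄] at h₁ h₂
      exact hlink _ ht _ _ h₁ h₂
  let g : Quot r' → Option (Quot r) := Quot.lift (fun e => g₁ e.1) hg₁
  have hgF : ∀ x, g (F x) = some x := by
    intro x
    induction x using Quot.ind with | _ p
    change g₀ p.1 = _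
    simp only [g₀, dif_pos p.2]
  have hbij : Function.Bijective F := by
    constructor
    · intro x y h
      exact Option.some.inj ((hgF x).symm.trans ((congrArg g h).trans (hgF y)))
    · intro x
      induction x using Quot.ind with | _ e
      obtain ⟨e, he⟩ := e
      induction e using Quot.ind with | _ p
      exact ⟨Quot.mk r ⟨p, he⟩, rfl⟩
  exact Nat.card_congr (Equiv.ofBijective F hbij)

end Family

end Diagram

/-! ### The state sum as a cofactor, and its dependence on the initial point -/

theorem zeroWeight_map {E P : Type} (f : P → E) (c : E → ℤ) (w : Corner P) :
    zeroWeight c (some (w.map f)) = zeroWeight (fun p => c (f p)) (some w) := by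
  cases w <;> rfl

theorem sum_ite_eq_sum_map {P : Type} [Fintype P] [DecidableEq P] {l : List P} (hl : l.Nodup)
    (C : P → Prop) [DecidablePred C] (hC : ∀ p, C p ↔ p ∈ l) (f : P → K) :
    ∑ p, (if C p then f p else 0) = (l.map f).sum := by
  rw [← Finset.sum_filter, ← List.sum_toFinset f hl]
  refine Finset.sum_congr ?_ fun _ _ => rfl
  ext p
  simp [hC]

theorem prod_filter_eq_prod_map {P : Type} [Fintype P] [DecidableEq P] {l : List P} (hl : l.Nodup)
    (C : P → Prop) [DecidablePred C] (hC : ∀ p, C p ↔ p ∈ l) (f : P → K) :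
    ∏ p with C p, f p = (l.map f).prod := by
  rw [← List.prod_toFinset f hl]
  refine Finset.prod_congr ?_ fun _ _ => rfl
  ext p
  simp [hC]

namespace Diagram

variable (G : Diagram)

/-- Groups a product over points by nodes. Vertical segments contribute `1`, so only the nodes of
pieces remain. -/
theorem prod_eq_prod_piece (g : G.Point → Fin G.n × Option ℕ) (F : G.Point → K)
    (hF : ∀ p, (g p).2 ≠ none → F p = 1) : ∏ p, F p = ∏ t, ∏ p with g p = (t, none), F p := by
  classical
  rw [← Finset.prod_fiberwise_of_maps_to (g := fun p => (g p).1)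
    (fun p _ => Finset.mem_univ _)]
  refine Finset.prod_congr rfl fun t _ => ?_
  symm
  apply Finset.prod_subset
  · intro p hp
    simp only [Finset.mem_filter, Finset.mem_univ, true_and] at hp ⊢
    rw [hp]
  · intro p hp hp'
    simp only [Finset.mem_filter, Finset.mem_univ, true_and] at hp hp'
    exact hF p fun h => hp' (Prod.ext hp h)

section Family

variable {G} {N : Fin G.n × Option ℕ → Node G.Point} (hN : G.NodeFamily G.mult N)

variable (G) in
/-- The multiplicity of the edge at a point. -/
def pointMult (p : G.Point) : ℤ := G.mult (G.edge p)

/-- The weight of a point as the end of an edge entering a node. -/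
noncomputable def pointIn (N : Fin G.n × Option ℕ → Node G.Point) (p : G.Point) : K :=
  (N (G.hd p)).inWeight G.pointMult p

/-- The weight of a point as the end of an edge leaving a node. -/
noncomputable def pointOut (N : Fin G.n × Option ℕ → Node G.Point) (p : G.Point) : K :=
  (N (G.tl p)).outWeight G.pointMult p

theorem pointMult_pos (hpos : ∀ e : G.Edge, 0 < G.mult e) (p : G.Point) : 0 < G.pointMult p :=
  hpos (G.edge p)

include hN in
theorem NodeFamily.eq_link_of_ne_none {v : Fin G.n × Option ℕ} (hv : G.IsNode v)
    (h : v.2 ≠ none) : ∃ a b, N v = .link a b := by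
  rcases hN.kind v hv with ⟨a, b, h', -, -⟩ | ⟨w, t, h', -, -⟩
  · exact ⟨a, b, h'⟩
  · rw [h'] at h
    exact absurd rfl h

include hN in
-- Each solid point carries its in-weight at the node it enters and its out-weight at the node it
-- leaves; regrouped by nodes, these are the normalized vertex weights.
theorem prod_cornerWeight (hpos : ∀ e : G.Edge, 0 < G.mult e) {φ : G.Edge → Bool}
    (hφ : G.Conserved φ) :
    ∏ t, cornerWeight G.mult φ (G.corner t) = (∏ t, zeroWeight G.mult (G.corner t)) *
      ∏ p, if φ (G.edge p) = true then pointIn N p * pointOut N p else 1 := by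
  have hsplit : ∀ p : G.Point, (if φ (G.edge p) = true then pointIn N p * pointOut N p else 1) =
      (if φ (G.edge p) = true then pointIn N p else 1) *
        (if φ (G.edge p) = true then pointOut N p else 1) := by
    intro p
    split_ifs <;> simp
  rw [Finset.prod_congr rfl fun p _ => hsplit p, Finset.prod_mul_distrib,
    G.prod_eq_prod_piece G.hd, G.prod_eq_prod_piece G.tl, ← Finset.prod_mul_distrib,
    ← Finset.prod_mul_distrib]
  · refine Finset.prod_congr rfl fun t _ => ?_
    have ht := G.isNode_none t
    have hA := hN.nodeAt _ ht
    have h₁ : ∀ p ∈ Finset.univ.filter (fun p => G.hd p = (t, none)),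
        (if φ (G.edge p) = true then pointIn N p else 1) =
          if φ (G.edge p) = true then (N (t, none)).inWeight G.pointMult p else 1 := by
      intro p hp
      rw [pointIn, (Finset.mem_filter.1 hp).2]
    have h₂ : ∀ p ∈ Finset.univ.filter (fun p => G.tl p = (t, none)),
        (if φ (G.edge p) = true then pointOut N p else 1) =
          if φ (G.edge p) = true then (N (t, none)).outWeight G.pointMult p else 1 := by
      intro p hp
      rw [pointOut, (Finset.mem_filter.1 hp).2]
    rw [Finset.prod_congr rfl h₁, Finset.prod_congr rfl h₂,
      prod_filter_eq_prod_map hA.nodup_ins _ hA.ins, prod_filter_eq_prod_map hA.nodup_outs _ hA.outs]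
    have hcons := conserves_edge hN hφ _ ht
    rcases hN.kind _ ht with ⟨a, b, h, -, h'⟩ | ⟨w, t', h₃, h₄, h₅⟩
    · rw [h, h' t rfl]
      simp [cornerWeight, zeroWeight, Node.ins, Node.outs, Node.inWeight, Node.outWeight]
    · obtain ⟨rfl, -⟩ := Prod.ext_iff.1 h₃
      dsimp only at h₅
      rw [h₄] at hcons hA ⊢
      rw [h₅, zeroWeight_map]
      have := Node.cornerWeight_eq G.pointMult hA.nodup_ins hA.nodup_outs (pointMult_pos hpos)
        (fun p => φ (G.edge p)) hcons
      refine Eq.trans ?_ this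
      rw [cornerWeight, cornerWeight, Corner.wt_map]
      rfl
  · intro p hp
    obtain ⟨a, b, h⟩ := hN.eq_link_of_ne_none (G.isNode_tl p) hp
    simp [pointOut, h, Node.outWeight]
  · intro p hp
    obtain ⟨a, b, h⟩ := hN.eq_link_of_ne_none (G.isNode_hd p) hp
    simp [pointIn, h, Node.inWeight]

variable (G) in
open scoped Classical in
/-- The state sum with initial point on the edge `δ`. -/
noncomputable def stateSum (δ : G.Edge) : K :=
  ∑ φ : G.Edge → Bool with G.IsState δ φ, G.sign φ * G.weight φ

include hN in
-- The constant factor is the weight of the zero state. It does not involve the initial point, so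
-- only the network sum has to be compared at two points.
theorem stateSum_eq_netSum (hpos : ∀ e : G.Edge, 0 < G.mult e) (o : G.Point) :
    G.stateSum (G.edge o) = (∏ t, zeroWeight G.mult (G.corner t)) *
      netSum G.hd G.tl (pointIn N) (pointOut N) o := by
  classical
  rw [stateSum, netSum, Finset.mul_sum]
  refine Finset.sum_bij (fun φ _ => fun p => φ (G.edge p)) ?_ ?_ ?_ ?_
  · intro φ hφ
    simp only [Finset.mem_filter, Finset.mem_univ, true_and] at hφ ⊢
    exact ⟨(isFlow_iff_exists hN _).2 ⟨φ, hφ.2, rfl⟩, hφ.1⟩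
  · intro φ _ φ' _ h
    funext e
    induction e using Quot.ind with | _ p
    exact congrFun h p
  · intro s hs
    simp only [Finset.mem_filter, Finset.mem_univ, true_and] at hs
    obtain ⟨φ, hφ, rfl⟩ := (isFlow_iff_exists hN _).1 hs.1
    exact ⟨φ, Finset.mem_filter.2 ⟨Finset.mem_univ _, hs.2, hφ⟩, rfl⟩
  · intro φ hφ
    have hφ : G.Conserved φ := (Finset.mem_filter.1 hφ).2.2
    rw [sign, flowCurves_eq_solidCurves hN hφ, weight_eq, prod_cornerWeight hN hpos hφ]
    ring

end Family

/-- The dependence of the state sum on the initial point. -/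
theorem stateSum_mul_eq (hpos : ∀ e : G.Edge, 0 < G.mult e) (p r : G.Point) :
    G.stateSum (G.edge p) * (br (2 * G.pointMult r) *
      q ^ (2 * (2 * G.heightLeft G.mult r + G.pointMult r))) =
    G.stateSum (G.edge r) * (br (2 * G.pointMult p) *
      q ^ (2 * (2 * G.heightLeft G.mult p + G.pointMult p))) := by
  classical
  obtain ⟨N, hN⟩ := G.exists_nodeFamily G.sums_mult p
  -- The left and the right kernel vector: powers of `q` in the height on the left and on the right
  -- of the edge, the second one weighted by `{2c}`.
  let x : G.Point → K := fun p => q ^ (2 * G.heightLeft G.mult p)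
  let y : G.Point → K := fun p => br (2 * G.pointMult p) *
    q ^ (2 * (G.heightLeft G.mult p + G.pointMult p))
  have hpos' := pointMult_pos hpos
  have key := netSum_mul_eq (hd := G.hd) (tl := G.tl) G.hd_ne_tl ?_ (pointIn N) (pointOut N) x y
    ?_ ?_ ?_ ?_ p r
  · have hxy : ∀ p, br (2 * G.pointMult p) * q ^ (2 * (2 * G.heightLeft G.mult p + G.pointMult p)) =
        x p * y p := by
      intro p
      simp only [x, y]
      rw [mul_left_comm, ← zpow_add₀ q_ne_zero]
      congr 2
      ring
    rw [hxy, hxy, stateSum_eq_netSum hN hpos, stateSum_eq_netSum hN hpos, mul_assoc, mul_assoc, key]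
  · intro p p' r h hne hr r' hr'
    have hA := hN.nodeAt _ (G.isNode_hd p)
    exact Node.eq_of_mem_ins ((hA.ins p).1 rfl) ((hA.ins p').1 h.symm) hne
      ((hA.outs r).1 hr.symm) ((hA.outs r').1 hr'.symm)
  · exact fun p => zpow_ne_zero _ q_ne_zero
  · exact fun p => mul_ne_zero (br_ne_zero (by have := hpos' p; omega)) (zpow_ne_zero _ q_ne_zero)
  · intro p
    have hA := hN.nodeAt _ (G.isNode_hd p)
    rw [sum_ite_eq_sum_map hA.nodup_outs _ hA.outs]
    have : (N (G.hd p)).outs.map (fun r => pointOut N r * x r) =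
        (N (G.hd p)).outs.map fun r => (N (G.hd p)).outWeight G.pointMult r *
          q ^ (2 * G.heightLeft G.mult r) := by
      refine List.map_congr_left fun r hr => ?_
      rw [pointOut, (hA.outs r).2 hr]
    rw [this]
    exact Node.solution_left _ hA.balanced hA.nodup_outs hpos' hA.nodup_ins ((hA.ins p).1 rfl)
  · intro p
    have hA := hN.nodeAt _ (G.isNode_tl p)
    rw [sum_ite_eq_sum_map hA.nodup_ins _ hA.ins]
    have : (N (G.tl p)).ins.map (fun r => pointIn N r * y r) =
        (N (G.tl p)).ins.map fun r => (N (G.tl p)).inWeight G.pointMult r *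
          (br (2 * G.pointMult r) * q ^ (2 * (G.heightLeft G.mult r + G.pointMult r))) := by
      refine List.map_congr_left fun r hr => ?_
      rw [pointIn, (hA.ins r).2 hr]
    rw [this]
    exact Node.solution_right _ hA.balanced hA.nodup_outs hpos' hA.nodup_ins ((hA.outs p).1 rfl)

/-- The direction of an outermost edge at a point `p`, seen with the unbounded region on its
left-hand side. -/
def OuterSide (p : G.Point) (σ : ℤ) : Prop :=
  (G.region ⟨p.1, p.2.castSucc⟩ = G.outerRegion ∧ σ = if (G.strand p).up then 1 else -1) ∨
  (G.region ⟨p.1, p.2.succ⟩ = G.outerRegion ∧ σ = if (G.strand p).up then -1 else 1)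

/-- The unbounded region has height `0`. If it lies on the left of the edge, `h = 0` and `σ = 1`; if
it lies on the right, `h = -f` and `σ = -1`. -/
theorem OuterSide.heightLeft {G : Diagram} {p : G.Point} {σ : ℤ} (h : G.OuterSide p σ)
    {f : G.Edge → ℤ} (hf : G.Sums f) :
    2 * G.heightLeft f p + f (G.edge p) = σ * f (G.edge p) := by
  have h₁ := G.gapSum_succ (G.flux f) p
  rcases h with ⟨h, rfl⟩ | ⟨h, rfl⟩
  · have h₂ := G.gapSum_eq_zero (G.balanced_flux hf) h
    simp only [Fin.val_castSucc] at h₂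
    rw [h₂] at h₁
    unfold Diagram.heightLeft
    rw [h₁, h₂]
    simp only [flux]
    split_ifs <;> ring
  · have h₂ := G.gapSum_eq_zero (G.balanced_flux hf) h
    simp only [Fin.val_succ] at h₂
    rw [h₂] at h₁
    unfold Diagram.heightLeft
    rw [h₂, eq_neg_of_add_eq_zero_left h₁.symm]
    simp only [flux]
    split_ifs <;> ring

end Diagram

/-! ### Closed curves in Morse position -/

/-- The rotation of a minimum whose left end points upward or downward. -/
def cupTurn (d : Bool) : ℤ := if d then 0 else -1

/-- The rotation of a maximum whose left end points upward or downward. -/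
def capTurn (d : Bool) : ℤ := if d then 1 else 0

/-- The rotation number of a simple closed curve whose leftmost strand points upward or
downward. -/
def loopTurn (d : Bool) : ℤ := if d then 1 else -1

/-- The directions of the strands on the bottom line and on the top line of an elementary piece of
a curve, and the rotation of the piece. -/
inductive CurvePiece : List Bool → List Bool → ℤ → Prop
  | empty : CurvePiece [] [] 0
  | pass (d : Bool) : CurvePiece [d] [d] 0
  | cup (d : Bool) : CurvePiece [] [d, !d] (cupTurn d)
  | cap (d : Bool) : CurvePiece [d, !d] [] (capTurn d)

/-- Labels of the strands of an elementary piece of a curve. -/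
inductive LabeledPiece : List (ℕ × Bool) → List (ℕ × Bool) → Prop
  | empty : LabeledPiece [] []
  | pass (x : ℕ × Bool) : LabeledPiece [x] [x]
  | cup (c : ℕ) (d : Bool) : LabeledPiece [] [(c, d), (c, !d)]
  | cap (c : ℕ) (d : Bool) : LabeledPiece [(c, d), (c, !d)] []

/-- Change the labels of strands. -/
def relabel (ρ : ℕ → ℕ) (x : ℕ × Bool) : ℕ × Bool := (ρ x.1, x.2)

theorem LabeledPiece.map {B C : List (ℕ × Bool)} (h : LabeledPiece B C) (ρ : ℕ → ℕ) :
    LabeledPiece (B.map (relabel ρ)) (C.map (relabel ρ)) := by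
  cases h
  exacts [.empty, .pass _, .cup _ _, .cap _ _]

/-- The label of every strand occurs twice, at the ends of disjoint arcs below the line. The number
is the rotation of the arcs. -/
inductive ArcWord : List (ℕ × Bool) → ℤ → Prop
  | nil : ArcWord [] 0
  | insert (A B : List (ℕ × Bool)) (c : ℕ) (d : Bool) (S : ℤ) (h : ArcWord (A ++ B) S)
      (hc : ∀ x ∈ A ++ B, x.1 ≠ c) : ArcWord (A ++ (c, d) :: (c, !d) :: B) (S + cupTurn d)

theorem ArcWord.map {W : List (ℕ × Bool)} {S : ℤ} (h : ArcWord W S) (ρ : ℕ → ℕ)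
    (hρ : ∀ x ∈ W, ∀ y ∈ W, ρ x.1 = ρ y.1 → x.1 = y.1) : ArcWord (W.map (relabel ρ)) S := by
  induction h with
  | nil => exact .nil
  | insert A B c d S h hc ih =>
    rw [List.map_append, List.map_cons, List.map_cons]
    refine .insert _ _ (ρ c) d S ?_ ?_
    · rw [← List.map_append]
      refine ih fun x hx y hy => hρ x ?_ y ?_
      · simp only [List.mem_append, List.mem_cons] at hx ⊢
        tauto
      · simp only [List.mem_append, List.mem_cons] at hy ⊢
        tauto
    · rw [← List.map_append]
      intro x hx
      obtain ⟨y, hy, rfl⟩ := List.mem_map.1 hx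
      intro e
      refine hc y hy (hρ y ?_ (c, d) (by simp) e)
      simp only [List.mem_append, List.mem_cons] at hy ⊢
      tauto

/-- Replace the label `y` by `x`. -/
def merging (y x c : ℕ) : ℕ := if c = y then x else c

theorem map_merging_eq_self {W : List (ℕ × Bool)} {x y : ℕ} (h : ∀ z ∈ W, z.1 ≠ y) :
    W.map (relabel (merging y x)) = W := by
  conv_rhs => rw [← List.map_id W]
  refine List.map_congr_left fun z hz => ?_
  simp [relabel, merging, h z hz]

theorem merging_inj {W : List (ℕ × Bool)} {c y : ℕ} (hc : ∀ z ∈ W, z.1 ≠ c) :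
    ∀ x ∈ W, ∀ z ∈ W, merging y c x.1 = merging y c z.1 → x.1 = z.1 := by
  intro x hx z hz h
  have h₁ := hc x hx
  have h₂ := hc z hz
  unfold merging at h
  split_ifs at h with h₃ h₄ h₄
  · rw [h₃, h₄]
  · exact absurd h.symm h₂
  · exact absurd h h₁
  · exact h

/-- A maximum above two neighboring ends either closes an arc into a loop or joins two arcs. The
turning of an arc below the line depends only on the direction of its left end, so the joined system
is again one built from innermost arcs. -/
theorem ArcWord.cap {W : List (ℕ × Bool)} {S : ℤ} (h : ArcWord W S) :
    ∀ (A B : List (ℕ × Bool)) (x y : ℕ) (d : Bool), W = A ++ (x, d) :: (y, !d) :: B →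
      (x = y ∧ ArcWord (A ++ B) (S - cupTurn d) ∧ ∀ z ∈ A ++ B, z.1 ≠ x) ∨
      (x ≠ y ∧ ArcWord ((A ++ B).map (relabel (merging y x))) (S + capTurn d)) := by
  have hturn : ∀ d, cupTurn d + capTurn (!d) = 0 := by decide
  induction h with
  | nil =>
    intro A B x y d h
    simp at h
  | insert A' B' c e S h hc ih =>
    intro A B x y d heq
    rw [List.append_eq_append_iff] at heq
    -- The maximum is compared with the innermost arc inserted last, `M` being the strands between
    -- their left ends. If `M` is empty, the arc is closed; if `M` has one strand, the maximum
    -- straightens the arc into a neighbor and the two turnings cancel; otherwise they are disjoint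
    -- and the maximum is moved past the insertion by induction.
    rcases heq with ⟨M, rfl, h₂⟩ | ⟨M, rfl, h₂⟩
    · match M with
      | [] =>
        simp only [List.nil_append, List.cons.injEq, Prod.mk.injEq] at h₂
        obtain ⟨⟨rfl, rfl⟩, ⟨rfl, -⟩, rfl⟩ := h₂
        left
        refine ⟨rfl, ?_, ?_⟩
        · rw [List.append_nil, add_sub_cancel_right]
          exact h
        · rw [List.append_nil]
          exact hc
      | [p] =>
        simp only [List.cons_append, List.nil_append, List.cons.injEq, Prod.mk.injEq] at h₂
        obtain ⟨rfl, ⟨rfl, rfl⟩, rfl⟩ := h₂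
        right
        have hy : c ≠ y := fun e' => hc (y, !!e) (by simp) e'.symm
        refine ⟨hy, ?_⟩
        have := h.map (merging y c) (merging_inj hc)
        rw [add_assoc, hturn, add_zero]
        convert this using 1
        simp [relabel, merging]
      | p :: p' :: M =>
        simp only [List.cons_append, List.cons.injEq] at h₂
        obtain ⟨rfl, rfl, rfl⟩ := h₂
        have hx : x ≠ c := hc (x, d) (by simp)
        have hy : y ≠ c := hc (y, !d) (by simp)
        rcases ih (A' ++ M) B x y d (by simp) with ⟨rfl, h₁, h₂⟩ | ⟨hne, h₁⟩
        · left
          refine ⟨rfl, ?_, ?_⟩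
          · have := ArcWord.insert A' (M ++ B) c e _ (by simpa using h₁) (fun z hz => hc z (by
              simp only [List.mem_append, List.mem_cons] at hz ⊢
              tauto))
            rw [sub_add_eq_add_sub] at this
            simpa using this
          · intro z hz
            simp only [List.mem_append, List.mem_cons] at hz h₂
            rcases hz with (h | rfl | rfl | h) | h
            exacts [h₂ z (by tauto), hx.symm, hx.symm, h₂ z (by tauto), h₂ z (by tauto)]
        · right
          refine ⟨hne, ?_⟩
          have := ArcWord.insert (A'.map (relabel (merging y x)))
            ((M ++ B).map (relabel (merging y x))) c e _ (by simpa using h₁) (by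
              rw [← List.map_append]
              intro z hz
              obtain ⟨z', hz', rfl⟩ := List.mem_map.1 hz
              have : z'.1 ≠ c := hc z' (by
                simp only [List.mem_append, List.mem_cons] at hz' ⊢
                tauto)
              simp only [relabel, merging]
              split_ifs
              exacts [hx, this])
          rw [add_right_comm] at this
          simpa [relabel, merging, hy.symm] using this
    · match M with
      | [] =>
        simp only [List.nil_append, List.cons.injEq, Prod.mk.injEq] at h₂
        obtain ⟨⟨rfl, rfl⟩, ⟨rfl, -⟩, rfl⟩ := h₂
        rw [List.append_nil] at h hc
        left
        exact ⟨rfl, by rwa [add_sub_cancel_right], hc⟩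
      | [p] =>
        simp only [List.cons_append, List.nil_append, List.cons.injEq, Prod.mk.injEq] at h₂
        obtain ⟨rfl, ⟨rfl, rfl⟩, rfl⟩ := h₂
        right
        have hx : x ≠ y := hc (x, d) (by simp)
        refine ⟨hx, ?_⟩
        have h₀ : cupTurn (!d) + capTurn d = 0 := by
          have := hturn (!d)
          rwa [Bool.not_not] at this
        rw [add_assoc, h₀, add_zero]
        have := map_merging_eq_self (x := x) hc
        rw [← this] at h
        convert h using 1
        simp [relabel, merging]
      | p :: p' :: M =>
        simp only [List.cons_append, List.cons.injEq] at h₂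
        obtain ⟨rfl, rfl, rfl⟩ := h₂
        have hx : x ≠ c := hc (x, d) (by simp)
        have hy : y ≠ c := hc (y, !d) (by simp)
        rcases ih A (M ++ B') x y d (by simp) with ⟨rfl, h₁, h₂⟩ | ⟨hne, h₁⟩
        · left
          refine ⟨rfl, ?_, ?_⟩
          · have := ArcWord.insert (A ++ M) B' c e _ (by simpa using h₁) (fun z hz => hc z (by
              simp only [List.mem_append, List.mem_cons] at hz ⊢
              tauto))
            rw [sub_add_eq_add_sub] at this
            simpa using this
          · intro z hz
            simp only [List.mem_append, List.mem_cons] at hz h₂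
            rcases hz with h | h | rfl | rfl | h
            exacts [h₂ z (by tauto), h₂ z (by tauto), hx.symm, hx.symm, h₂ z (by tauto)]
        · right
          refine ⟨hne, ?_⟩
          have := ArcWord.insert ((A ++ M).map (relabel (merging y x)))
            (B'.map (relabel (merging y x))) c e _ (by simpa using h₁) (by
              rw [← List.map_append]
              intro z hz
              obtain ⟨z', hz', rfl⟩ := List.mem_map.1 hz
              have : z'.1 ≠ c := hc z' (by
                simp only [List.mem_append, List.mem_cons] at hz' ⊢
                tauto)
              simp only [relabel, merging]
              split_ifs
              exacts [hx, this])
          rw [add_right_comm] at this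
          simpa [relabel, merging, hy.symm] using this

/-- Needed when two arcs are joined: the other end of the first arc is still on the line, so its
label does not get lost. -/
theorem ArcWord.twin {W : List (ℕ × Bool)} {S : ℤ} (h : ArcWord W S) :
    ∀ z ∈ W, ∃ z' ∈ W, z' ≠ z ∧ z'.1 = z.1 := by
  induction h with
  | nil => simp
  | insert A B c d S h hc ih =>
    have key : ∀ z ∈ A ++ B, ∃ z' ∈ A ++ (c, d) :: (c, !d) :: B, z' ≠ z ∧ z'.1 = z.1 := by
      intro z hz
      obtain ⟨z', hz', h'⟩ := ih z hz
      refine ⟨z', ?_, h'⟩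
      simp only [List.mem_append, List.mem_cons] at hz' ⊢
      tauto
    intro z hz
    simp only [List.mem_append, List.mem_cons] at hz
    rcases hz with h | rfl | rfl | h
    · exact key z (by simp [h])
    · exact ⟨(c, !d), by simp, by simp, rfl⟩
    · exact ⟨(c, d), by simp, by simp, rfl⟩
    · exact key z (by simp [h])

/-- The strands of two consecutive lines with their labels. -/
def LabeledStep (a b c : ℕ) (W W' : List (ℕ × Bool)) : Prop :=
  ∃ A B C D, A.length = a ∧ B.length = b ∧ C.length = c ∧ W = A ++ (B ++ D) ∧
    W' = A ++ (C ++ D) ∧ LabeledPiece B C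

theorem LabeledStep.map {a b c : ℕ} {W W' : List (ℕ × Bool)} (h : LabeledStep a b c W W')
    (ρ : ℕ → ℕ) : LabeledStep a b c (W.map (relabel ρ)) (W'.map (relabel ρ)) := by
  obtain ⟨A, B, C, D, hA, hB, hC, rfl, rfl, h⟩ := h
  exact ⟨A.map (relabel ρ), _, _, D.map (relabel ρ), by simpa using hA, by simpa using hB, by simpa using hC,
    by simp, by simp, h.map ρ⟩

/-- The labels of a curve up to a horizontal line, with the list of the components which lie below
the line and the directions of their leftmost strands. -/
structure Labeling (w : ℕ → List Bool) (a b c : ℕ → ℕ) (τ : ℕ → ℤ) (t : ℕ)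
    (L : ℕ → List (ℕ × Bool)) (C : List (ℕ × Bool)) (S : ℤ) : Prop where
  map_snd : ∀ k ≤ t, (L k).map Prod.snd = w k
  step : ∀ k < t, LabeledStep (a k) (b k) (c k) (L k) (L (k + 1))
  arcs : ArcWord (L t) S
  turn : ∑ k ∈ Finset.range t, τ k = S + (C.map fun x => loopTurn x.2).sum
  nodup : (C.map Prod.fst).Nodup
  closed : ∀ x ∈ C, (∃ k ≤ t, (L k).find? (fun z => z.1 == x.1) = some x) ∧ ∀ z ∈ L t, z.1 ≠ x.1
  labels : ∀ k ≤ t, ∀ z ∈ L k, (∃ z' ∈ L t, z'.1 = z.1) ∨ ∃ x ∈ C, x.1 = z.1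

theorem exists_labeling {n : ℕ} {w A B C D : ℕ → List Bool} {τ : ℕ → ℤ} (h₀ : w 0 = [])
    (hw : ∀ k < n, w k = A k ++ (B k ++ D k) ∧ w (k + 1) = A k ++ (C k ++ D k) ∧
      CurvePiece (B k) (C k) (τ k)) : ∀ t ≤ n, ∃ L E S, Labeling w (fun k => (A k).length)
        (fun k => (B k).length) (fun k => (C k).length) τ t L E S := by
  intro t
  induction t with
  | zero =>
    intro _
    refine ⟨fun _ => [], [], 0, ?_, ?_, .nil, ?_, ?_, ?_, ?_⟩ <;> simp [h₀]
  | succ t ih =>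
    intro ht
    obtain ⟨L, E, S, hL⟩ := ih (by omega)
    obtain ⟨h₁, h₂, h₃⟩ := hw t (by omega)
    have h₄ := hL.map_snd t le_rfl
    rw [h₁, List.map_eq_append_iff] at h₄
    obtain ⟨A', R, hLt, hA', hR⟩ := h₄
    rw [List.map_eq_append_iff] at hR
    obtain ⟨B', D', rfl, hB', hD'⟩ := hR
    have hAl : A'.length = (A t).length := by rw [← hA', List.length_map]
    have hBl : B'.length = (B t).length := by rw [← hB', List.length_map]
    -- The common part of all four cases: the old lines are relabeled by `ρ`, which identifies two
    -- labels when arcs are joined and is the identity otherwise, and one line with the new top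
    -- strands `C'` is added.
    have ext : ∀ (C' : List (ℕ × Bool)) (E' : List (ℕ × Bool)) (S' : ℤ) (ρ : ℕ → ℕ),
        C'.map Prod.snd = C t → LabeledPiece (B'.map (relabel ρ)) C' →
        ArcWord (A'.map (relabel ρ) ++ (C' ++ D'.map (relabel ρ))) S' →
        S + (E.map fun x => loopTurn x.2).sum + τ t = S' + (E'.map fun x => loopTurn x.2).sum →
        (E'.map Prod.fst).Nodup →
        (∀ x ∈ E', (∃ k ≤ t, ((L k).map (relabel ρ)).find? (fun z => z.1 == x.1) = some x) ∧
          ∀ z ∈ A'.map (relabel ρ) ++ (C' ++ D'.map (relabel ρ)), z.1 ≠ x.1) →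
        (∀ k ≤ t, ∀ z ∈ L k, (∃ z' ∈ A'.map (relabel ρ) ++ (C' ++ D'.map (relabel ρ)),
          z'.1 = ρ z.1) ∨ ∃ x ∈ E', x.1 = ρ z.1) →
        ∃ L E S, Labeling w (fun k => (A k).length)
          (fun k => (B k).length) (fun k => (C k).length) τ (t + 1) L E S := by
      intro C' E' S' ρ hC' hp harc hturn hnd hcl hlab
      refine ⟨fun k => if k ≤ t then (L k).map (relabel ρ) else
        A'.map (relabel ρ) ++ (C' ++ D'.map (relabel ρ)), E', S', ?_, ?_, ?_, ?_, hnd, ?_, ?_⟩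
      · intro k hk
        split_ifs with h
        · rw [List.map_map, ← hL.map_snd k h]
          rfl
        · obtain rfl : k = t + 1 := by omega
          rw [h₂, ← hA', ← hD', ← hC']
          simp only [List.map_append, List.map_map]
          rfl
      · intro k hk
        rw [if_pos (by omega : k ≤ t)]
        split_ifs with h
        · exact (hL.step k h).map ρ
        · obtain rfl : k = t := by omega
          refine ⟨_, _, _, _, ?_, ?_, ?_, ?_, rfl, hp⟩
          · simpa using hAl
          · simpa using hBl
          · rw [← hC', List.length_map]
          · rw [hLt]
            simp
      · simpa using harc
      · rw [Finset.sum_range_succ, hL.turn, hturn]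
      · intro x hx
        obtain ⟨⟨k, hk, h⟩, h'⟩ := hcl x hx
        refine ⟨⟨k, by omega, ?_⟩, ?_⟩
        · rw [if_pos hk]
          exact h
        · simpa using h'
      · intro k hk z hz
        rw [if_neg (by omega : ¬ t + 1 ≤ t)]
        split_ifs at hz with h
        · obtain ⟨z', hz', rfl⟩ := List.mem_map.1 hz
          exact hlab k h z' hz'
        · exact .inl ⟨z, hz, rfl⟩
    have hid : ∀ W : List (ℕ × Bool), W.map (relabel id) = W := fun W => List.map_id W
    have hloop : ∀ d, cupTurn d + capTurn d = loopTurn d := by decide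
    generalize B t = Bt, C t = Ct, τ t = τt at h₃ hB' ext
    have harc := hL.arcs
    rw [hLt] at harc
    have hclosed := hL.closed
    have hlabels := hL.labels
    rw [hLt] at hclosed hlabels
    cases h₃ with
    | empty =>
      obtain rfl := List.map_eq_nil_iff.1 hB'
      refine ext [] E S id rfl .empty ?_ (by simp) hL.nodup ?_ ?_
      · simpa only [hid] using harc
      · simpa only [hid] using hclosed
      · simpa only [hid, id_eq] using hlabels
    | pass d =>
      refine ext B' E S id hB' ?_ ?_ (by simp) hL.nodup ?_ ?_
      · obtain ⟨z, rfl, -⟩ := List.map_eq_singleton_iff.1 hB'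
        exact .pass _
      · simpa only [hid] using harc
      · simpa only [hid] using hclosed
      · simpa only [hid, id_eq] using hlabels
    | cup d =>
      obtain rfl := List.map_eq_nil_iff.1 hB'
      -- A new minimum gets a label unused on all lines so far, not only on the current one, so that
      -- it differs from the labels of closed components.
      obtain ⟨c, hc⟩ := Infinite.exists_notMem_finset
        ((Finset.range (t + 1)).biUnion fun k => ((L k).map Prod.fst).toFinset)
      have hc : ∀ k ≤ t, ∀ z ∈ L k, z.1 ≠ c := by
        rintro k hk z hz rfl
        refine hc (Finset.mem_biUnion.2 ⟨k, Finset.mem_range.2 (by omega), ?_⟩)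
        rw [List.mem_toFinset]
        exact List.mem_map_of_mem hz
      have hct := hc t le_rfl
      rw [hLt] at hct
      refine ext [(c, d), (c, !d)] E (S + cupTurn d) id rfl (.cup c d) ?_ (by ring) hL.nodup ?_ ?_
      · simp only [hid]
        exact .insert A' D' c d S (by simpa using harc) (by simpa using hct)
      · simp only [hid]
        intro x hx
        obtain ⟨⟨k, hk, h⟩, h'⟩ := hclosed x hx
        refine ⟨⟨k, hk, h⟩, ?_⟩
        have hxc : c ≠ x.1 := (hc k hk x (List.mem_of_find?_eq_some h)).symm
        intro z hz
        simp only [List.nil_append, List.mem_append, List.mem_cons, List.not_mem_nil,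
          or_false] at hz h'
        rcases hz with h | (rfl | rfl) | h
        exacts [h' z (.inl h), hxc, hxc, h' z (.inr h)]
      · simp only [hid]
        intro k hk z hz
        refine (hlabels k hk z hz).imp_left ?_
        rintro ⟨z', hz', h⟩
        refine ⟨z', ?_, h⟩
        simp only [List.nil_append, List.mem_append] at hz' ⊢
        tauto
    | cap d =>
      obtain ⟨z₁, B₁, rfl, hz₁, hB₁⟩ := List.map_eq_cons_iff.1 hB'
      obtain ⟨z₂, rfl, hz₂⟩ := List.map_eq_singleton_iff.1 hB₁
      obtain ⟨x, d'⟩ := z₁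
      obtain ⟨y, d''⟩ := z₂
      dsimp only at hz₁ hz₂
      subst hz₁ hz₂
      have hloop := hloop d'
      rcases harc.cap A' D' x y d' (by simp) with ⟨rfl, h₅, h₆⟩ | ⟨hne, h₅⟩
      · refine ext [] ((x, d') :: E) (S - cupTurn d') id rfl (.cap x d') ?_ ?_ ?_ ?_ ?_
        · simpa only [hid, List.nil_append] using h₅
        · rw [List.map_cons, List.sum_cons, ← hloop]
          ring
        · rw [List.map_cons, List.nodup_cons]
          refine ⟨?_, hL.nodup⟩
          intro hx
          obtain ⟨z, hz, hzx⟩ := List.mem_map.1 hx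
          exact (hclosed z hz).2 (x, d') (by simp) hzx.symm
        · simp only [hid, List.nil_append]
          intro z hz
          rcases List.mem_cons.1 hz with rfl | hz
          -- On the line just below the closing maximum only the two capped strands carry the label,
          -- so the left one, of direction `d'`, is the leftmost.
          · refine ⟨⟨t, le_rfl, ?_⟩, h₆⟩
            rw [hLt, List.find?_append, List.find?_eq_none.2]
            · simp
            · intro z hz
              simpa using h₆ z (by simp [hz])
          · obtain ⟨h₇, h₈⟩ := hclosed z hz
            refine ⟨h₇, fun z' hz' => h₈ z' ?_⟩
            simp only [List.mem_append] at hz' ⊢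
            tauto
        · simp only [hid, List.nil_append]
          intro k hk z hz
          rcases hlabels k hk z hz with ⟨z', hz', h⟩ | ⟨z', hz', h⟩
          · simp only [List.mem_append, List.mem_cons, List.not_mem_nil, or_false] at hz'
            rcases hz' with h' | (rfl | rfl) | h'
            · exact .inl ⟨z', by simp [h'], h⟩
            · exact .inr ⟨(x, d'), by simp, h⟩
            · exact .inr ⟨(x, d'), by simp, h⟩
            · exact .inl ⟨z', by simp [h'], h⟩
          · exact .inr ⟨z', by simp [hz'], h⟩
      · have hρ : ∀ z : ℕ, z ≠ y → merging y x z = z := fun z hz => if_neg hz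
        have hρy : merging y x y = x := if_pos rfl
        have hmem : ∀ z ∈ A' ++ D', relabel (merging y x) z ∈ A'.map (relabel (merging y x)) ++
            ([] ++ D'.map (relabel (merging y x))) := by
          intro z hz
          rw [List.nil_append, ← List.map_append]
          exact List.mem_map_of_mem hz
        refine ext [] E (S + capTurn d') (merging y x) rfl ?_ ?_ (by ring) hL.nodup ?_ ?_
        · simpa [relabel, hρ x hne, hρy] using LabeledPiece.cap x d'
        · simpa using h₅
        · intro z hz
          obtain ⟨⟨k, hk, h⟩, h'⟩ := hclosed z hz
          have hzx : x ≠ z.1 := h' (x, d') (by simp)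
          have hzy : y ≠ z.1 := h' (y, !d') (by simp)
          refine ⟨⟨k, hk, ?_⟩, ?_⟩
          · rw [List.find?_map]
            have : ((fun z' : ℕ × Bool => z'.1 == z.1) ∘ relabel (merging y x)) =
                fun z' => z'.1 == z.1 := by
              funext z'
              simp only [Function.comp, relabel, merging]
              split_ifs with h₆
              · rw [h₆, beq_eq_false_iff_ne.2 hzx, beq_eq_false_iff_ne.2 hzy]
              · rfl
            rw [this, h, Option.map_some]
            simp [relabel, hρ z.1 hzy.symm]
          · intro z' hz'
            rw [List.nil_append, ← List.map_append] at hz'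
            obtain ⟨z'', hz'', rfl⟩ := List.mem_map.1 hz'
            have : z''.1 ≠ z.1 := h' z'' (by
              simp only [List.mem_append] at hz'' ⊢
              tauto)
            simp only [relabel, merging]
            split_ifs
            exacts [hzx, this]
        · have htwin : ∃ z' ∈ A'.map (relabel (merging y x)) ++
              ([] ++ D'.map (relabel (merging y x))), z'.1 = x := by
            -- The twin is neither capped strand: it differs from the first one, and the second one
            -- has the other label `y`.
            obtain ⟨z, hz, hne', hzx⟩ := harc.twin (x, d') (by simp)
            refine ⟨_, hmem z ?_, ?_⟩
            · simp only [List.mem_append, List.mem_cons, List.not_mem_nil, or_false] at hz ⊢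
              rcases hz with h | (h | h) | h
              · exact .inl h
              · exact absurd h hne'
              · rw [h] at hzx
                exact absurd hzx.symm hne
              · exact .inr h
            · simp only [relabel, hzx, hρ x hne]
          intro k hk z hz
          rcases hlabels k hk z hz with ⟨z', hz', h⟩ | ⟨z', hz', h⟩
          · simp only [List.mem_append, List.mem_cons, List.not_mem_nil, or_false] at hz'
            left
            rcases hz' with h' | (rfl | rfl) | h'
            · exact ⟨_, hmem z' (by simp [h']), by rw [relabel, h]⟩
            · dsimp only at h
              rwa [← h, hρ x hne]
            · dsimp only at h
              rwa [← h, hρy]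
            · exact ⟨_, hmem z' (by simp [h']), by rw [relabel, h]⟩
          · right
            refine ⟨z', hz', ?_⟩
            rw [← h, hρ z'.1 ((hclosed z' hz').2 (y, !d') (by simp)).symm]

/-- The labels of a system of closed curves. -/
theorem exists_closed_labeling {n : ℕ} {w A B C D : ℕ → List Bool} {τ : ℕ → ℤ} (h₀ : w 0 = [])
    (h₁ : w n = []) (hw : ∀ k < n, w k = A k ++ (B k ++ D k) ∧ w (k + 1) = A k ++ (C k ++ D k) ∧
      CurvePiece (B k) (C k) (τ k)) :
    ∃ (L : ℕ → List (ℕ × Bool)) (E : List (ℕ × Bool)),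
      (∀ k ≤ n, (L k).map Prod.snd = w k) ∧
      (∀ k < n, LabeledStep (A k).length (B k).length (C k).length (L k) (L (k + 1))) ∧
      ∑ k ∈ Finset.range n, τ k = (E.map fun x => loopTurn x.2).sum ∧ (E.map Prod.fst).Nodup ∧
      (∀ x ∈ E, ∃ k ≤ n, (L k).find? (fun z => z.1 == x.1) = some x) ∧
      ∀ k ≤ n, ∀ z ∈ L k, ∃ x ∈ E, x.1 = z.1 := by
  obtain ⟨L, E, S, hL⟩ := exists_labeling h₀ hw n le_rfl
  have hn : L n = [] := by
    have := hL.map_snd n le_rfl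
    rwa [h₁, List.map_eq_nil_iff] at this
  have hS : S = 0 := by
    have := hL.arcs
    generalize L n = W at this hn
    cases this with
    | nil => rfl
    | insert => simp at hn
  have ht := hL.turn
  rw [hS, zero_add] at ht
  refine ⟨L, E, hL.map_snd, hL.step, ht, hL.nodup, fun x hx => (hL.closed x hx).1, ?_⟩
  intro k hk z hz
  have := hL.labels k hk z hz
  rw [hn] at this
  simpa using this

/-! ### The solid edges of a state as curves in Morse position -/

/-- The directions of the strands with label `1`. -/
def solidWord {E : Type} (s : E → Bool) (M : List (Strand × E)) : List Bool :=
  (M.filter fun x => s x.2).map fun x => x.1.up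

theorem solidWord_append {E : Type} (s : E → Bool) (M M' : List (Strand × E)) :
    solidWord s (M ++ M') = solidWord s M ++ solidWord s M' := by
  simp [solidWord]

set_option linter.unusedSimpArgs false in
-- At a vertex of a state either nothing is solid or two edges are; these form a vertical passage or
-- an extremum, with the turning that `pieceMove` assigns to the labels as numbers of copies.
theorem curvePiece_solidWord {E : Type} {P : Piece} {pb pt : List (Strand × E)}
    {v : Option (Corner E)} (h : PieceLevels P pb pt v) (hP : P.Admissible) (s : E → Bool)
    (hs : ∀ w ∈ v, w.Conserves s) :
    CurvePiece (solidWord s pb) (solidWord s pt)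
      (pieceMove (fun e => (s e).toNat) pb pt).turn := by
  have hcup : ∀ d, CurvePiece [] [d, !d] (Move.turn ⟨1, true, d⟩) := by
    intro d
    have := CurvePiece.cup d
    cases d <;> exact this
  have hcap : ∀ d, CurvePiece [d, !d] [] (Move.turn ⟨1, false, d⟩) := by
    intro d
    have := CurvePiece.cap d
    cases d <;> exact this
  cases h with
  | cup l e =>
    cases he : s e
    · cases hl : l.up <;> simpa [solidWord, he, pieceMove, Move.turn, hl] using CurvePiece.empty
    · simpa [solidWord, he, pieceMove, Strand.rev] using hcup l.up
  | cap l e =>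
    cases he : s e
    · cases hl : l.up <;> simpa [solidWord, he, pieceMove, Move.turn, hl] using CurvePiece.empty
    · simpa [solidWord, he, pieceMove, Strand.rev] using hcap l.up
  | split b l r e₀ e₁ e₂ =>
    obtain ⟨-, h₁, -⟩ := hP
    cases u₀ : b.up <;> cases u₁ : l.up <;> cases u₂ : r.up <;> simp [u₀, u₁, u₂] at h₁ <;>
      cases f₀ : s e₀ <;> cases f₁ : s e₁ <;> cases f₂ : s e₂ <;>
      simp [Corner.ofClockwise, Corner.Conserves, f₀, f₁, f₂, u₀, u₁, u₂] at hs <;>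
      simp [solidWord, f₀, f₁, f₂, u₀, u₁, u₂, pieceMove, vertexMove, Move.turn] <;>
      first
      | exact .empty
      | exact .pass _
      | exact .cup true
      | exact .cup false
  | merge l r b e₀ e₁ e₂ =>
    obtain ⟨-, h₁, -⟩ := hP
    cases u₀ : b.up <;> cases u₁ : l.up <;> cases u₂ : r.up <;> simp [u₀, u₁, u₂] at h₁ <;>
      cases f₀ : s e₀ <;> cases f₁ : s e₁ <;> cases f₂ : s e₂ <;>
      simp [Corner.ofClockwise, Corner.Conserves, f₀, f₁, f₂, u₀, u₁, u₂] at hs <;>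
      simp [solidWord, f₀, f₁, f₂, u₀, u₁, u₂, pieceMove, vertexMove, Move.turn] <;>
      first
      | exact .empty
      | exact .pass _
      | exact .cap true
      | exact .cap false

/-- Insert `none` for the strands with label `0`. -/
def fill : List Bool → List ℕ → List (Option ℕ)
  | true :: p, x :: W => some x :: fill p W
  | _ :: p, W => none :: fill p W
  | [], _ => []

theorem fill_append {p p' : List Bool} {W W' : List ℕ} (h : W.length = (p.filter id).length) :
    fill (p ++ p') (W ++ W') = fill p W ++ fill p' W' := by
  induction p generalizing W with
  | nil =>
    obtain rfl := List.length_eq_zero_iff.1 h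
    rfl
  | cons b p ih =>
    cases b with
    | true =>
      cases W with
      | nil => simp at h
      | cons x W =>
        simp only [List.cons_append, fill]
        rw [ih (by simpa using h)]
    | false =>
      have : ∀ V, fill (false :: (p ++ p')) V = none :: fill (p ++ p') V := fun V => by
        cases V <;> rfl
      have h₂ : ∀ V, fill (false :: p) V = none :: fill p V := fun V => by
        cases V <;> rfl
      rw [List.cons_append, this, h₂, List.cons_append, ih (by simpa using h)]

@[simp] theorem length_fill (p : List Bool) (W : List ℕ) : (fill p W).length = p.length := by
  induction p generalizing W with
  | nil => cases W <;> rfl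
  | cons b p ih => cases b <;> cases W <;> simp [fill, ih]

theorem map_filter_of_fill {E : Type} {s : E → Bool} {Λ : E → Option ℕ} {M : List (Strand × E)}
    {W : List ℕ} (hl : W.length = (M.filter fun x => s x.2).length)
    (h : fill (M.map fun x => s x.2) W = M.map fun x => Λ x.2) :
    (M.filter fun x => s x.2).map (fun x => Λ x.2) = W.map some := by
  induction M generalizing W with
  | nil =>
    obtain rfl := List.length_eq_zero_iff.1 hl
    rfl
  | cons x M ih =>
    cases hx : s x.2 with
    | true =>
      rw [List.filter_cons_of_pos (p := fun x : Strand × E => s x.2) hx] at hl ⊢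
      cases W with
      | nil => simp at hl
      | cons y W =>
        simp only [List.map_cons, hx, fill, List.cons.injEq] at h ⊢
        exact ⟨h.1.symm, ih (by simpa using hl) h.2⟩
    | false =>
      rw [List.filter_cons_of_neg (p := fun x : Strand × E => s x.2) (by simp [hx])] at hl ⊢
      refine ih hl ?_
      have h₂ : ∀ p V, fill (false :: p) V = none :: fill p V := fun p V => by
        cases V <;> rfl
      rw [List.map_cons, hx, h₂, List.map_cons, List.cons.injEq] at h
      exact h.2

theorem PieceLevels.mem_of_mem_edges {E : Type} {P : Piece} {pb pt : List (Strand × E)}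
    {v : Option (Corner E)} (h : PieceLevels P pb pt v) {w : Corner E} (hw : w ∈ v) {e : E}
    (he : e ∈ w.edges) : ∃ x ∈ pb ++ pt, x.2 = e := by
  cases h with
  | cup l e => cases hw
  | cap l e => cases hw
  | split b l r e₀ e₁ e₂ =>
    revert hw
    cases b.up <;> cases l.up <;> cases r.up <;> simp [Corner.ofClockwise] <;> rintro rfl <;>
      simp [Corner.edges] at he <;> rcases he with rfl | rfl | rfl <;> simp
  | merge l r b e₀ e₁ e₂ =>
    revert hw
    cases b.up <;> cases l.up <;> cases r.up <;> simp [Corner.ofClockwise] <;> rintro rfl <;>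
      simp [Corner.edges] at he <;> rcases he with rfl | rfl | rfl <;> simp

theorem LabeledPiece.fst_eq {B C : List (ℕ × Bool)} (h : LabeledPiece B C) :
    ∀ x ∈ B ++ C, ∀ y ∈ B ++ C, x.1 = y.1 := by
  cases h <;> simp

namespace Diagram

variable (G : Diagram)

/-- The edges with label `1` form a connected curve. -/
def IsCurve (s : G.Edge → Bool) : Prop :=
  G.Conserved s ∧ (∃ e, s e = true) ∧
  ∀ (X : Type) (Λ : G.Edge → X),
    (∀ t, ∀ v ∈ G.corner t, ∀ e ∈ v.edges, ∀ e' ∈ v.edges, s e = true → s e' = true → Λ e = Λ e') →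
      ∀ e e', s e = true → s e' = true → Λ e = Λ e'

/-- A labeling of the strands of a curve comes from a labeling of the edges. -/
theorem exists_edge_labeling_of_step (s : G.Edge → Bool) (L : Fin (G.n + 1) → List (ℕ × Bool))
    (hL : ∀ t, (L t).map Prod.snd = solidWord s (G.lev t))
    (hs : ∀ t : Fin G.n, LabeledStep (solidWord s (G.leftLev t)).length
      (solidWord s (G.botLev t)).length (solidWord s (G.topLev t)).length
      (L t.castSucc) (L t.succ)) :
    ∃ Λ : G.Edge → Option ℕ,
      (∀ t, ((G.lev t).filter fun x => s x.2).map (fun x => Λ x.2) =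
        (L t).map fun z => some z.1) ∧
      ∀ t, ∀ v ∈ G.corner t, ∀ e ∈ v.edges, ∀ e' ∈ v.edges, s e = true → s e' = true →
        Λ e = Λ e' := by
  have hlen : ∀ M : List (Strand × G.Edge), (solidWord s M).length =
      ((M.map fun x => s x.2).filter id).length := by
    intro M
    rw [List.filter_map, List.length_map, solidWord, List.length_map]
    rfl
  have hsplit : ∀ t : Fin G.n, ∃ A B C D : List (ℕ × Bool), LabeledPiece B C ∧
      B.length = (solidWord s (G.botLev t)).length ∧
      C.length = (solidWord s (G.topLev t)).length ∧
      fill ((G.lev t.castSucc).map fun x => s x.2) ((L t.castSucc).map Prod.fst) =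
        fill ((G.leftLev t).map fun x => s x.2) (A.map Prod.fst) ++
          (fill ((G.botLev t).map fun x => s x.2) (B.map Prod.fst) ++
            fill ((G.rightLev t).map fun x => s x.2) (D.map Prod.fst)) ∧
      fill ((G.lev t.succ).map fun x => s x.2) ((L t.succ).map Prod.fst) =
        fill ((G.leftLev t).map fun x => s x.2) (A.map Prod.fst) ++
          (fill ((G.topLev t).map fun x => s x.2) (C.map Prod.fst) ++
            fill ((G.rightLev t).map fun x => s x.2) (D.map Prod.fst)) := by
    intro t
    obtain ⟨A, B, C, D, hA, hB, hC, h₁, h₂, h₃⟩ := hs t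
    refine ⟨A, B, C, D, h₃, hB, hC, ?_, ?_⟩
    · rw [h₁, lev_castSucc]
      simp only [List.map_append]
      rw [fill_append (by rw [List.length_map, hA, hlen]),
        fill_append (by rw [List.length_map, hB, hlen])]
    · rw [h₂, lev_succ]
      simp only [List.map_append]
      rw [fill_append (by rw [List.length_map, hA, hlen]),
        fill_append (by rw [List.length_map, hC, hlen])]
  -- The labels live on solid strands only; padding with `none` gives words on all strands, which
  -- can then descend to the edges.
  obtain ⟨Λ, hΛ⟩ := G.exists_edge_labeling
    (fun t => fill ((G.lev t).map fun x => s x.2) ((L t).map Prod.fst)) (by simp) (by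
      intro t
      obtain ⟨A, B, C, D, h₁, h₂, h₃, h₄, h₅⟩ := hsplit t
      refine ⟨_, _, _, _, by simp, by simp, by simp, h₄, h₅, ?_, ?_⟩
      · rintro ⟨l, hl⟩
        have hp := G.pieceLevels t
        rw [hl] at hp
        generalize G.botLev t = pb, G.topLev t = pt, G.corner t = v at hp h₂ h₃ h₄ h₅
        cases hp with
        | cup l e =>
          cases he : s e
          · refine ⟨none, ?_⟩
            generalize C.map Prod.fst = C'
            cases C' <;> simp [he, fill]
          · simp [solidWord, he] at h₂ h₃
            subst h₂
            cases h₁ with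
            | empty => simp at h₃
            | cup c d => exact ⟨some c, by simp [he, fill]⟩
      · rintro ⟨l, hl⟩
        have hp := G.pieceLevels t
        rw [hl] at hp
        generalize G.botLev t = pb, G.topLev t = pt, G.corner t = v at hp h₂ h₃ h₄ h₅
        cases hp with
        | cap l e =>
          cases he : s e
          · refine ⟨none, ?_⟩
            generalize B.map Prod.fst = B'
            cases B' <;> simp [he, fill]
          · simp [solidWord, he] at h₂ h₃
            subst h₃
            cases h₁ with
            | empty => simp at h₂
            | cap c d => exact ⟨some c, by simp [he, fill]⟩)
  have hlen' : ∀ M : List (Strand × G.Edge), (solidWord s M).length =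
      (M.filter fun x => s x.2).length := fun M => by rw [solidWord, List.length_map]
  refine ⟨Λ, ?_, ?_⟩
  · intro t
    rw [map_filter_of_fill (s := s) (Λ := Λ) (W := (L t).map Prod.fst) _ (hΛ t), List.map_map]
    · rfl
    · rw [List.length_map, ← hlen', ← hL t, List.length_map]
  · intro t v hv e he e' he' hse hse'
    obtain ⟨A, B, C, D, h₁, h₂, h₃, h₄, h₅⟩ := hsplit t
    have e₁ := (hΛ t.castSucc).symm.trans h₄
    have e₂ := (hΛ t.succ).symm.trans h₅
    rw [lev_castSucc] at e₁
    rw [lev_succ] at e₂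
    simp only [List.map_append] at e₁ e₂
    have e₁ := (List.append_inj (List.append_inj e₁ (by simp)).2 (by simp)).1
    have e₂ := (List.append_inj (List.append_inj e₂ (by simp)).2 (by simp)).1
    have e₁ := map_filter_of_fill (by rw [List.length_map, h₂, hlen']) e₁.symm
    have e₂ := map_filter_of_fill (by rw [List.length_map, h₃, hlen']) e₂.symm
    have key : ∀ e ∈ v.edges, s e = true → ∃ z ∈ B ++ C, Λ e = some z.1 := by
      intro e he hse
      obtain ⟨x, hx, rfl⟩ := (G.pieceLevels t).mem_of_mem_edges hv he
      have h₆ : Λ x.2 ∈ ((B ++ C).map Prod.fst).map some := by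
        rw [List.map_append, List.map_append, ← e₁, ← e₂, ← List.map_append, ← List.filter_append]
        exact List.mem_map.2 ⟨x, List.mem_filter.2 ⟨hx, hse⟩, rfl⟩
      simp only [List.mem_map] at h₆
      obtain ⟨_, ⟨z, hz, rfl⟩, h⟩ := h₆
      exact ⟨z, hz, h.symm⟩
    obtain ⟨z, hz, h⟩ := key e he hse
    obtain ⟨z', hz', h'⟩ := key e' he' hse'
    rw [h, h', h₁.fst_eq z hz z' hz']

/-- The rotation number of a connected curve. -/
theorem IsCurve.exists_turn_eq {G : Diagram} {s : G.Edge → Bool} (h : G.IsCurve s) :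
    ∃ d, (G.turn fun e => (s e).toNat) = loopTurn d ∧
      ∃ t, (solidWord s (G.lev t)).head? = some d := by
  obtain ⟨hs, ⟨e₀, he₀⟩, hconn⟩ := h
  -- The sweep is indexed by natural numbers; the empty lists beyond the last line are never used.
  let lvl : ℕ → List (Strand × G.Edge) := fun k =>
    if hk : k < G.n + 1 then G.lev ⟨k, hk⟩ else []
  let sl : (Fin G.n → List (Strand × G.Edge)) → ℕ → List (Strand × G.Edge) := fun F k =>
    if hk : k < G.n then F ⟨k, hk⟩ else []
  have hlvl : ∀ t : Fin (G.n + 1), lvl t = G.lev t := fun t => dif_pos t.2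
  have hsl : ∀ F (t : Fin G.n), sl F t = F t := fun F t => dif_pos t.2
  obtain ⟨L, E, hL, hstep, hturn, hnd, hfirst, hlab⟩ := exists_closed_labeling (n := G.n)
    (w := fun k => solidWord s (lvl k)) (A := fun k => solidWord s (sl G.leftLev k))
    (B := fun k => solidWord s (sl G.botLev k)) (C := fun k => solidWord s (sl G.topLev k))
    (D := fun k => solidWord s (sl G.rightLev k))
    (τ := fun k => if hk : k < G.n then (G.move (fun e => (s e).toNat) ⟨k, hk⟩).turn else 0)
    (by
      have := hlvl 0
      rw [lev_zero] at this
      exact congrArg (solidWord s) this)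
    (by
      have := hlvl (Fin.last G.n)
      rw [lev_last] at this
      exact congrArg (solidWord s) this)
    (by
      intro k hk
      have h₁ := hlvl (⟨k, hk⟩ : Fin G.n).castSucc
      have h₂ := hlvl (⟨k, hk⟩ : Fin G.n).succ
      have h₃ := fun F => hsl F ⟨k, hk⟩
      simp only [Fin.val_castSucc, Fin.val_succ] at h₁ h₂ h₃
      simp only [h₁, h₂, h₃, lev_castSucc, lev_succ, solidWord_append, dif_pos hk, true_and]
      exact curvePiece_solidWord (G.pieceLevels _) (G.admissible _) s (hs _))
  obtain ⟨Λ, hΛ, hΛ'⟩ := G.exists_edge_labeling_of_step s (fun t => L t)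
    (fun t => by rw [hL t (by omega), hlvl])
    (fun t => by
      have := hstep t t.2
      rwa [hsl, hsl, hsl] at this)
  -- Labels of solid edges agree at vertices, so connectedness leaves a single label.
  have hconst : ∀ e, s e = true → Λ e = Λ e₀ := fun e he => hconn _ Λ hΛ' e e₀ he he₀
  have hid : ∀ t : Fin (G.n + 1), ∀ z ∈ L t, some z.1 = Λ e₀ := by
    intro t z hz
    have : some z.1 ∈ (L t).map fun z => some z.1 := List.mem_map.2 ⟨z, hz, rfl⟩
    rw [← hΛ t] at this
    obtain ⟨x, hx, hx'⟩ := List.mem_map.1 this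
    rw [← hx', hconst _ (List.mem_filter.1 hx).2]
  have hid' : ∀ x ∈ E, some x.1 = Λ e₀ := by
    intro x hx
    obtain ⟨k, hk, h⟩ := hfirst x hx
    exact hid ⟨k, by omega⟩ x (List.mem_of_find?_eq_some h)
  obtain ⟨t, x, hx, rfl⟩ := G.exists_mem_lev e₀
  obtain ⟨z, hz⟩ : ∃ z, z ∈ L t := by
    have : Λ x.2 ∈ (L t).map fun z => some z.1 := by
      rw [← hΛ t]
      exact List.mem_map.2 ⟨x, List.mem_filter.2 ⟨hx, he₀⟩, rfl⟩
    obtain ⟨z, hz, -⟩ := List.mem_map.1 this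
    exact ⟨z, hz⟩
  obtain ⟨y, hy, -⟩ := hlab t (by omega) z hz
  -- Components have distinct labels, and all labels equal that of `e₀`, so there is just one
  -- component.
  have hE : E = [y] := by
    cases E with
    | nil => cases hy
    | cons y₁ E =>
      cases E with
      | nil =>
        rw [List.mem_singleton] at hy
        rw [hy]
      | cons y₂ E =>
        simp only [List.map_cons, List.nodup_cons, List.mem_cons] at hnd
        exact absurd (.inl (Option.some.inj ((hid' y₁ (by simp)).trans
          (hid' y₂ (by simp)).symm))) hnd.1
  refine ⟨y.2, ?_, ?_⟩
  · rw [hE] at hturn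
    simp only [List.map_cons, List.map_nil, List.sum_cons, List.sum_nil, add_zero] at hturn
    rw [← hturn, turn, Finset.sum_range]
    exact Finset.sum_congr rfl fun t _ => by rw [dif_pos t.2]
  · obtain ⟨k, hk, h⟩ := hfirst y hy
    refine ⟨⟨k, by omega⟩, ?_⟩
    have h₁ := hL k hk
    have h₂ := hlvl ⟨k, by omega⟩
    simp only at h₁ h₂
    rw [h₂] at h₁
    rw [← h₁]
    -- As all strands carry the label of `y`, the first strand with this label is the first solid
    -- strand of the line.
    have h₃ : ∀ z ∈ L k, (z.1 == y.1) = true := fun z hz => by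
      rw [beq_iff_eq]
      exact Option.some.inj ((hid ⟨k, by omega⟩ z hz).trans (hid' y hy).symm)
    cases hLk : L k with
    | nil => rw [hLk] at h; cases h
    | cons z W =>
      rw [hLk] at h h₃
      rw [List.find?_cons_of_pos (p := fun z : ℕ × Bool => z.1 == y.1) (h₃ z (by simp))] at h
      cases h
      rfl

end Diagram

/-! ### Additivity of the turning, and heights beside a connected curve -/

theorem Corner.sums_toNat {E : Type} {s : E → Bool} {w : Corner E} :
    (w.Sums fun e => ((s e).toNat : ℤ)) ↔ w.Conserves s := by
  cases w <;> simp only [Sums, Conserves] <;> omega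

theorem Move.turn_add (m m' : ℕ) (cup up : Bool) :
    Move.turn ⟨m + m', cup, up⟩ = Move.turn ⟨m, cup, up⟩ +
      Move.turn ⟨m', cup, up⟩ := by
  cases cup <;> cases up <;> simp [Move.turn]
  ring

theorem vertexMove_turn_add (cup s l r : Bool) (f₁ f₂ g₁ g₂ : ℕ) :
    (vertexMove cup s l r (f₁ + g₁) (f₂ + g₂)).turn =
      (vertexMove cup s l r f₁ f₂).turn + (vertexMove cup s l r g₁ g₂).turn := by
  unfold vertexMove
  rw [← Move.turn_add]
  congr 2
  split_ifs <;> rfl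

/-- Which edge turns back at a piece depends on the orientations only, so the turning is additive in
the numbers of copies. This lets the total turning be split among disjoint curves. -/
theorem pieceMove_turn_add {E : Type} {P : Piece} {pb pt : List (Strand × E)}
    {v : Option (Corner E)} (h : PieceLevels P pb pt v) (f g : E → ℕ) :
    (pieceMove (fun e => f e + g e) pb pt).turn = (pieceMove f pb pt).turn +
      (pieceMove g pb pt).turn := by
  cases h
  · exact Move.turn_add ..
  · exact Move.turn_add ..
  · exact vertexMove_turn_add ..
  · exact vertexMove_turn_add ..

namespace Diagram

variable (G : Diagram)

theorem turn_add (f g : G.Edge → ℕ) : G.turn (fun e => f e + g e) = G.turn f + G.turn g := by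
  unfold turn
  rw [← Finset.sum_add_distrib]
  exact Finset.sum_congr rfl fun t _ => pieceMove_turn_add (G.pieceLevels t) f g

theorem turn_zero : G.turn (fun _ => 0) = 0 := by
  have := G.turn_add (fun _ => 0) fun _ => 0
  simpa using this

theorem turn_sum {ι : Type} (I : Finset ι) (f : ι → G.Edge → ℕ) :
    G.turn (fun e => ∑ i ∈ I, f i e) = ∑ i ∈ I, G.turn (f i) := by
  classical
  induction I using Finset.induction_on with
  | empty => simpa using G.turn_zero
  | insert a I ha ih =>
    simp only [Finset.sum_insert ha]
    rw [turn_add, ih]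

/-- The height of the region to the left of an edge. -/
theorem exists_edgeHeight {f : G.Edge → ℤ} (hf : G.Sums f) :
    ∃ H : G.Edge → ℤ, (∀ p, H (G.edge p) = G.heightLeft f p) ∧
      ∀ t, ∀ w ∈ G.corner t, (Node.vertex w).Balanced f H := by
  -- A family of nodes needs a point as default value, so the diagram without points is treated
  -- apart.
  rcases isEmpty_or_nonempty G.Point with hE | ⟨⟨o⟩⟩
  · refine ⟨fun _ => 0, fun p => isEmptyElim p, fun t w _ => ?_⟩
    obtain ⟨e⟩ : Nonempty G.Edge := by
      cases w with
      | odd inn _ _ => exact ⟨inn⟩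
      | even out _ _ => exact ⟨out⟩
    induction e using Quot.ind with | _ p
    exact isEmptyElim p
  · obtain ⟨N, hN⟩ := G.exists_nodeFamily hf o
    have hlink : ∀ p p', G.Link p p' → G.heightLeft f p = G.heightLeft f p' := by
      intro p p' hl
      obtain ⟨v, a, b, hv, h, h₁, h₂⟩ := exists_node_of_link hN hl
      have := (hN.nodeAt v hv).balanced
      rw [h] at this
      rcases h₁ with rfl | rfl <;> rcases h₂ with rfl | rfl <;> simp [this.2]
    refine ⟨Quot.lift (G.heightLeft f) hlink, fun p => rfl, fun t w hw => ?_⟩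
    have ht := G.isNode_none t
    rcases hN.kind _ ht with ⟨a, b, -, -, h'⟩ | ⟨w', t', h₁, h₂, h₃⟩
    · rw [h' t rfl] at hw
      cases hw
    · obtain ⟨rfl, -⟩ := Prod.ext_iff.1 h₁
      dsimp only at h₃
      obtain rfl : w'.map G.edge = w := Option.some.inj (h₃.symm.trans hw)
      have := (hN.nodeAt _ ht).balanced
      rw [h₂] at this
      cases w' <;> exact this

/-- The height of the region to the left of the leftmost strand of a curve on a line. -/
theorem heightLeft_of_leftmost {s : G.Edge → Bool} {p : G.Point} (hp : s (G.edge p) = true)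
    (hl : ∀ i : Fin (G.level p.1).length, i < p.2 → s (G.edge ⟨p.1, i⟩) = false) :
    G.heightLeft (fun e => ((s e).toNat : ℤ)) p = if (G.strand p).up then 0 else -1 := by
  have h₁ := G.gapSum_succ (G.flux fun e => ((s e).toNat : ℤ)) p
  have h₂ : G.gapSum (G.flux fun e => ((s e).toNat : ℤ)) p.1 p.2 = 0 := by
    rw [gapSum]
    apply List.sum_eq_zero
    intro x hx
    obtain ⟨y, hy, rfl⟩ := List.mem_map.1 hx
    obtain ⟨i, hi, rfl⟩ := List.getElem_of_mem hy
    have hi' : i < p.2 := by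
      rw [List.length_take] at hi
      omega
    have := hl ⟨i, by omega⟩ hi'
    rw [List.getElem_take]
    simp only [lev, List.getElem_ofFn, flux, this]
    simp
  rw [heightLeft, h₁, h₂, flux, hp]
  cases (G.strand p).up <;> simp

/-- The height of the region to the left of a connected curve, and the rotation number of the
curve. -/
theorem IsCurve.exists_height {G : Diagram} {s : G.Edge → Bool} (h : G.IsCurve s) :
    ∃ H : ℤ, (∀ p, s (G.edge p) = true → G.heightLeft (fun e => ((s e).toNat : ℤ)) p = H) ∧
      (G.turn fun e => (s e).toNat) = 2 * H + 1 := by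
  obtain ⟨H, hH, hb⟩ := G.exists_edgeHeight (f := fun e => ((s e).toNat : ℤ))
    fun t w hw => Corner.sums_toNat.2 (h.1 t w hw)
  -- Heights on the left of two solid edges at a vertex could differ only by the value on the edge
  -- between them, which is the third one and has label `0`.
  have hconst := h.2.2 ℤ H (by
    intro t v hv e he e' he' hs hs'
    have h₁ := hb t v hv
    have h₂ := h.1 t v hv
    cases v with
    | odd inn outL outR =>
      obtain ⟨-, h₃, h₄⟩ := h₁
      simp only [Corner.Conserves] at h₂
      simp only [Corner.edges, List.mem_cons, List.not_mem_nil, or_false] at he he'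
      have k₁ : s inn = true → s outL = true → H inn = H outL := fun _ _ => h₃
      have k₂ : s inn = true → s outR = true → H inn = H outR := by
        intro ha hc
        have : s outL = false := by
          cases hb : s outL
          · rfl
          · simp [ha, hb, hc] at h₂
        simp [h₃, h₄, this]
      have k₃ : s outL = true → s outR = true → H outL = H outR := by
        intro hb hc
        cases ha : s inn <;> simp [ha, hb, hc] at h₂
      rcases he with rfl | rfl | rfl <;> rcases he' with rfl | rfl | rfl <;>
        first
        | rfl
        | exact k₁ hs hs'
        | exact (k₁ hs' hs).symm
        | exact k₂ hs hs'
        | exact (k₂ hs' hs).symm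
        | exact k₃ hs hs'
        | exact (k₃ hs' hs).symm
    | even out inL inR =>
      obtain ⟨-, h₃, h₄⟩ := h₁
      simp only [Corner.Conserves] at h₂
      simp only [Corner.edges, List.mem_cons, List.not_mem_nil, or_false] at he he'
      have k₁ : s out = true → s inL = true → H out = H inL := fun _ _ => h₃
      have k₂ : s out = true → s inR = true → H out = H inR := by
        intro ha hc
        have : s inL = false := by
          cases hb : s inL
          · rfl
          · simp [ha, hb, hc] at h₂
        simp [h₃, h₄, this]
      have k₃ : s inL = true → s inR = true → H inL = H inR := by
        intro hb hc
        cases ha : s out <;> simp [ha, hb, hc] at h₂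
      rcases he with rfl | rfl | rfl <;> rcases he' with rfl | rfl | rfl <;>
        first
        | rfl
        | exact k₁ hs hs'
        | exact (k₁ hs' hs).symm
        | exact k₂ hs hs'
        | exact (k₂ hs' hs).symm
        | exact k₃ hs hs'
        | exact (k₃ hs' hs).symm)
  obtain ⟨d, hd, t, ht⟩ := h.exists_turn_eq
  rw [solidWord, List.head?_map, List.head?_filter, Option.map_eq_some_iff] at ht
  obtain ⟨x, hx, hxd⟩ := ht
  obtain ⟨hs, i, hi, hxi, hmin⟩ := List.find?_eq_some_iff_getElem.1 hx
  rw [length_lev] at hi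
  let p : G.Point := ⟨t, i, hi⟩
  have hp : x = (G.strand p, G.edge p) := by
    rw [← hxi]
    simp [lev, p]
  rw [hp] at hs hxd
  have hleft := G.heightLeft_of_leftmost (p := p) hs (by
    intro j hj
    have := hmin j hj
    simpa [lev] using this)
  refine ⟨G.heightLeft (fun e => ((s e).toNat : ℤ)) p, ?_, ?_⟩
  · intro p' hp'
    rw [← hH, ← hH]
    exact hconst _ _ hp' hs
  · rw [hd, hleft, ← hxd]
    simp only [loopTurn]
    split_ifs <;> rfl

end Diagram

namespace Diagram

variable {G : Diagram}

/-! ### The curves formed by the parallel copies of the edges -/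

open scoped Classical in
/-- The indicator function of the copies of an edge on a curve. -/
noncomputable def onCurve (C : G.Curve) (e : G.Edge) (k : ℕ) : ℤ :=
  if h : k < (G.mult e).toNat then if (Quot.mk _ ⟨e, k, h⟩ : G.Curve) = C then 1 else 0 else 0

/-- The number of copies of an edge on a curve. -/
noncomputable def copies (C : G.Curve) (e : G.Edge) : ℤ :=
  ∑ k ∈ Finset.range (G.mult e).toNat, onCurve C e k

theorem onCurve_nonneg (C : G.Curve) (e : G.Edge) (k : ℕ) : 0 ≤ onCurve C e k := by
  unfold onCurve
  split_ifs <;> simp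

theorem onCurve_eq_one {C : G.Curve} {e : G.Edge} {m : Fin (G.mult e).toNat}
    (h : (Quot.mk _ ⟨e, m⟩ : G.Curve) = C) : onCurve C e m = 1 := by
  rw [onCurve, dif_pos m.2, if_pos h]

theorem onCurve_congr (C : G.Curve) {e e' : G.Edge} {k k' : ℕ} (h : k < (G.mult e).toNat)
    (h' : k' < (G.mult e').toNat)
    (hl : G.CopyLink ⟨e, k, h⟩ ⟨e', k', h'⟩ ∨ G.CopyLink ⟨e', k', h'⟩ ⟨e, k, h⟩) :
    onCurve C e k = onCurve C e' k' := by
  have : (Quot.mk _ ⟨e, k, h⟩ : G.Curve) = Quot.mk _ ⟨e', k', h'⟩ := by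
    rcases hl with hl | hl
    exacts [Quot.sound hl, (Quot.sound hl).symm]
  rw [onCurve, onCurve, dif_pos h, dif_pos h', this]

section Corner

variable (hpos : ∀ e : G.Edge, 0 < G.mult e) (C : G.Curve) {t : Fin G.n}

theorem onCurve_odd {inn outL outR : G.Edge} (h : .odd inn outL outR ∈ G.corner t)
    (hm : (G.mult inn).toNat = (G.mult outL).toNat + (G.mult outR).toNat) :
    (∀ k < (G.mult outL).toNat, onCurve C inn k = onCurve C outL k) ∧
    ∀ k < (G.mult outR).toNat, onCurve C inn ((G.mult outL).toNat + k) = onCurve C outR k := by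
  constructor
  · intro k hk
    exact onCurve_congr C (by omega) hk (.inl ⟨t, _, h, rfl, .inl ⟨rfl, rfl⟩⟩)
  · intro k hk
    exact onCurve_congr C (by omega) hk (.inl ⟨t, _, h, rfl, .inr ⟨rfl, rfl⟩⟩)

theorem onCurve_even {out inL inR : G.Edge} (h : .even out inL inR ∈ G.corner t)
    (hm : (G.mult out).toNat = (G.mult inL).toNat + (G.mult inR).toNat) :
    (∀ k < (G.mult inL).toNat, onCurve C out k = onCurve C inL k) ∧
    ∀ k < (G.mult inR).toNat, onCurve C out ((G.mult inL).toNat + k) = onCurve C inR k := by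
  constructor
  · intro k hk
    exact onCurve_congr C (by omega) hk (.inr ⟨t, _, h, rfl, .inl ⟨rfl, rfl⟩⟩)
  · intro k hk
    exact onCurve_congr C (by omega) hk (.inr ⟨t, _, h, rfl, .inr ⟨rfl, rfl⟩⟩)

include hpos in
theorem toNat_mult_odd {inn outL outR : G.Edge} (h : .odd inn outL outR ∈ G.corner t) :
    (G.mult inn).toNat = (G.mult outL).toNat + (G.mult outR).toNat := by
  have : G.mult inn = G.mult outL + G.mult outR := G.sums_mult t _ h
  have := hpos outL
  have := hpos outR
  omega

include hpos in
theorem toNat_mult_even {out inL inR : G.Edge} (h : .even out inL inR ∈ G.corner t) :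
    (G.mult out).toNat = (G.mult inL).toNat + (G.mult inR).toNat := by
  have : G.mult out = G.mult inL + G.mult inR := G.sums_mult t _ h
  have := hpos inL
  have := hpos inR
  omega

include hpos in
-- At a vertex the copies of the single edge are continued first by those of the left and then by
-- those of the right edge, and continuing stays on the same curve.
theorem sums_copies : G.Sums (copies C) := by
  intro t w hw
  cases w with
  | odd inn outL outR =>
    have hm := toNat_mult_odd hpos hw
    obtain ⟨h₁, h₂⟩ := onCurve_odd C hw hm
    simp only [Corner.Sums, copies]
    rw [hm, Finset.sum_range_add]
    congr 1
    · exact Finset.sum_congr rfl fun k hk => h₁ k (Finset.mem_range.1 hk)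
    · exact Finset.sum_congr rfl fun k hk => h₂ k (Finset.mem_range.1 hk)
  | even out inL inR =>
    have hm := toNat_mult_even hpos hw
    obtain ⟨h₁, h₂⟩ := onCurve_even C hw hm
    simp only [Corner.Sums, copies]
    rw [hm, Finset.sum_range_add]
    congr 1
    · exact Finset.sum_congr rfl fun k hk => h₁ k (Finset.mem_range.1 hk)
    · exact Finset.sum_congr rfl fun k hk => h₂ k (Finset.mem_range.1 hk)

include hpos in
/-- Two copies of an edge on the same curve have the same height. -/
theorem height_eq_of_mk_eq {H : G.Edge → ℤ}
    (hH : ∀ t, ∀ w ∈ G.corner t, (Node.vertex w).Balanced (copies C) H) {x y : G.Copy}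
    (h : (Quot.mk _ x : G.Curve) = Quot.mk _ y) :
    H x.1 + ∑ k ∈ Finset.range x.2, onCurve C x.1 k =
      H y.1 + ∑ k ∈ Finset.range y.2, onCurve C y.1 k := by
  -- For a copy on `C`, the quantity is the height of the region immediately to its left among all
  -- copies on `C`: the height on the left of the edge plus the number of copies on `C` crossed
  -- inside it. It is invariant under continuation at vertices.
  refine congrArg (Quot.lift (fun x : G.Copy => H x.1 + ∑ k ∈ Finset.range x.2, onCurve C x.1 k)
    ?_) h
  rintro ⟨e, m⟩ ⟨e', m'⟩ ⟨t, w, hw, hl⟩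
  dsimp only at hl ⊢
  have hb := hH t w hw
  cases w with
  | odd inn outL outR =>
    have hm := toNat_mult_odd hpos hw
    obtain ⟨h₁, h₂⟩ := onCurve_odd C hw hm
    obtain ⟨-, h₃, h₄⟩ := hb
    obtain ⟨rfl, ⟨rfl, hk⟩ | ⟨rfl, hk⟩⟩ := hl
    · rw [h₃, hk]
      congr 1
      exact Finset.sum_congr rfl fun k hk => h₁ k (by have := Finset.mem_range.1 hk; omega)
    · rw [h₃, h₄, hk, Finset.sum_range_add, copies, add_assoc]
      congr 2
      · exact Finset.sum_congr rfl fun k hk => h₁ k (Finset.mem_range.1 hk)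
      · exact Finset.sum_congr rfl fun k hk => h₂ k (by have := Finset.mem_range.1 hk; omega)
  | even out inL inR =>
    have hm := toNat_mult_even hpos hw
    obtain ⟨h₁, h₂⟩ := onCurve_even C hw hm
    obtain ⟨-, h₃, h₄⟩ := hb
    obtain ⟨rfl, ⟨rfl, hk⟩ | ⟨rfl, hk⟩⟩ := hl
    · rw [h₃, hk]
      congr 1
      exact Finset.sum_congr rfl fun k hk => (h₁ k (by have := Finset.mem_range.1 hk; omega)).symm
    · rw [h₃, h₄, hk, Finset.sum_range_add, copies, add_assoc]
      congr 2
      · exact Finset.sum_congr rfl fun k hk => (h₁ k (Finset.mem_range.1 hk)).symm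
      · exact Finset.sum_congr rfl fun k hk =>
          (h₂ k (by have := Finset.mem_range.1 hk; omega)).symm

open scoped Classical in
include hpos in
/-- A curve contains at most one copy of every edge. -/
theorem copies_eq (e : G.Edge) : copies C e = ((decide (C.Passes e)).toNat : ℤ) := by
  obtain ⟨H, -, hH⟩ := G.exists_edgeHeight (sums_copies hpos C)
  by_cases hC : C.Passes e
  · obtain ⟨m, hm⟩ := id hC
    rw [copies, Finset.sum_eq_single (m : ℕ), onCurve_eq_one hm]
    · simp [hC]
    · intro k hk hne
      by_contra h
      have hk := Finset.mem_range.1 hk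
      have hk' : (Quot.mk _ ⟨e, k, hk⟩ : G.Curve) = C := by
        by_contra h'
        exact h (by rw [onCurve, dif_pos hk, if_neg h'])
      have h₁ := height_eq_of_mk_eq hpos C hH (hk'.trans hm.symm)
      simp only [add_right_inj] at h₁
      -- Going from copy `k` to copy `k'` crosses copy `k` itself, which raises the height by at
      -- least `1`; two copies on the same curve would have equal heights.
      have key : ∀ k k' : ℕ, k < k' → onCurve C e k = 1 →
          ∑ i ∈ Finset.range k, onCurve C e i ≠ ∑ i ∈ Finset.range k', onCurve C e i := by
        intro k k' hlt h₂ h₃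
        have h₄ : ∑ i ∈ Finset.range (k + 1), onCurve C e i ≤
            ∑ i ∈ Finset.range k', onCurve C e i :=
          Finset.sum_le_sum_of_subset_of_nonneg (Finset.range_subset_range.2 hlt)
            fun i _ _ => onCurve_nonneg C e i
        rw [Finset.sum_range_succ, h₂] at h₄
        omega
      rcases lt_or_gt_of_ne hne with hlt | hlt
      · exact key k m hlt (onCurve_eq_one (m := ⟨k, hk⟩) hk') h₁
      · exact key m k hlt (onCurve_eq_one hm) h₁.symm
    · intro h
      exact absurd (Finset.mem_range.2 m.2) h
  · rw [copies, Finset.sum_eq_zero]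
    · simp [hC]
    · intro k hk
      rw [onCurve, dif_pos (Finset.mem_range.1 hk), if_neg]
      exact fun h => hC ⟨_, h⟩

open scoped Classical in
include hpos in
-- As each edge has at most one copy on the curve, its numbers of copies form a labeling, which is
-- conserved by `sums_copies`. Connectedness is inherited from the continuation of copies.
theorem isCurve_passes : G.IsCurve fun e => decide (C.Passes e) := by
  refine ⟨?_, ?_, ?_⟩
  · intro t w hw
    have := sums_copies hpos C t w hw
    rw [funext (copies_eq hpos C)] at this
    exact Corner.sums_toNat.1 this
  · induction C using Quot.ind with | _ x
    exact ⟨x.1, by simp only [decide_eq_true_eq]; exact ⟨x.2, rfl⟩⟩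
  · intro X Λ hΛ e e' he he'
    simp only [decide_eq_true_eq] at he he' hΛ
    obtain ⟨m, hm⟩ := he
    obtain ⟨m', hm'⟩ := he'
    let F : G.Copy → Option X := fun x =>
      if (Quot.mk _ x : G.Curve) = C then some (Λ x.1) else none
    have hF : ∀ x y, G.CopyLink x y → F x = F y := by
      intro x y hl
      have hxy : (Quot.mk _ x : G.Curve) = Quot.mk _ y := Quot.sound hl
      obtain ⟨t, w, hw, hl⟩ := hl
      by_cases hx : (Quot.mk _ x : G.Curve) = C
      · have hy := hxy.symm.trans hx
        simp only [F, if_pos hx, if_pos hy, Option.some.injEq]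
        refine hΛ t w hw _ ?_ _ ?_ ⟨x.2, hx⟩ ⟨y.2, hy⟩
        · cases w with
          | odd inn outL outR => simp [Corner.edges, hl.1]
          | even out inL inR => rcases hl.2 with h | h <;> simp [Corner.edges, h.1]
        · cases w with
          | odd inn outL outR => rcases hl.2 with h | h <;> simp [Corner.edges, h.1]
          | even out inL inR => simp [Corner.edges, hl.1]
      · have hy : ¬ (Quot.mk _ y : G.Curve) = C := hxy ▸ hx
        simp only [F, if_neg hx, if_neg hy]
    have := congrArg (Quot.lift F hF) (hm.trans hm'.symm)
    simp only [F, if_pos hm, if_pos hm', Option.some.injEq] at this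
    exact this

end Corner

theorem sum_copies (hpos : ∀ e : G.Edge, 0 < G.mult e) (e : G.Edge) :
    ∑ C : G.Curve, copies C e = G.mult e := by
  unfold copies
  rw [Finset.sum_comm]
  have : ∀ k ∈ Finset.range (G.mult e).toNat, ∑ C : G.Curve, onCurve C e k = 1 := by
    intro k hk
    have hk := Finset.mem_range.1 hk
    let C₀ : G.Curve := Quot.mk _ ⟨e, k, hk⟩
    rw [Finset.sum_eq_single C₀]
    · exact onCurve_eq_one (m := ⟨k, hk⟩) rfl
    · intro C _ hC
      rw [onCurve, dif_pos hk]; exact if_neg fun h => hC h.symm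
    · simp
  rw [Finset.sum_congr rfl this]
  simp [(hpos e).le]

open scoped Classical in
/-- The height of the region to the left of a curve determines its rotation number. -/
theorem exists_height_rotation (hpos : ∀ e : G.Edge, 0 < G.mult e) (C : G.Curve) :
    ∃ H : ℤ, (∀ p, C.Passes (G.edge p) → G.heightLeft (copies C) p = H) ∧
      C.rotation = 2 * H + 1 ∧
      (G.turn fun e => (decide (C.Passes e)).toNat) = C.rotation := by
  have hC := isCurve_passes hpos C
  obtain ⟨H, hH, hturn⟩ := hC.exists_height
  have hc : copies C = fun e => ((decide (C.Passes e)).toNat : ℤ) := funext (copies_eq hpos C)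
  simp only [decide_eq_true_eq] at hH
  have hrot : C.rotation = 2 * H + 1 := by
    -- The direction of the leftmost strand is the same on every line met by the curve, because it
    -- determines the constant `H`; hence the existential definition of `Clockwise` is unambiguous.
    have key : ∀ p : G.Point, C.Passes (G.edge p) →
        (∀ i : Fin (G.level p.1).length, C.Passes (G.edge ⟨p.1, i⟩) → p.2 ≤ i) →
        H = if (G.strand p).up then 0 else -1 := by
      intro p hp hmin
      rw [← hH p hp]
      refine G.heightLeft_of_leftmost (s := fun e => decide (C.Passes e)) (by simpa using hp) ?_
      intro i hi
      rw [decide_eq_false_iff_not]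
      exact fun h => absurd (hmin i h) (not_le.2 hi)
    unfold Curve.rotation
    split_ifs with h
    · obtain ⟨p, hp, hmin, hup⟩ := h
      rw [key p hp hmin, hup]
      rfl
    · obtain ⟨e, he⟩ := hC.2.1
      simp only [decide_eq_true_eq] at he
      induction e using Quot.ind with | _ p
      obtain ⟨i, hi, hmin⟩ := Set.exists_min_image
        {i : Fin (G.level p.1).length | C.Passes (G.edge ⟨p.1, i⟩)} id (Set.toFinite _) ⟨p.2, he⟩
      have h₁ : ¬ (G.strand ⟨p.1, i⟩).up = true := fun hup => h ⟨⟨p.1, i⟩, hi, hmin, hup⟩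
      rw [key ⟨p.1, i⟩ hi hmin, if_neg h₁]
      rfl
  refine ⟨H, ?_, hrot, ?_⟩
  · rw [hc]
    exact hH
  · rw [hturn, hrot]

/-- The total rotation of the parallel copies of the edges. -/
theorem turn_mult_eq (hpos : ∀ e : G.Edge, 0 < G.mult e) :
    (G.turn fun e => (G.mult e).toNat) = ∑ C : G.Curve, C.rotation := by
  classical
  -- The copies of an edge are distributed among the curves, at most one on each; additivity of the
  -- turning does the rest.
  have h : (fun e => (G.mult e).toNat) =
      fun e => ∑ C : G.Curve, (decide (C.Passes e)).toNat := by
    funext e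
    have := sum_copies hpos e
    rw [Finset.sum_congr rfl fun C _ => copies_eq hpos C e] at this
    rw [← this]
    norm_cast
  rw [h, turn_sum]
  refine Finset.sum_congr rfl fun C _ => ?_
  obtain ⟨H, -, -, h⟩ := exists_height_rotation hpos C
  convert h

/-- The rotation of the curves disjoint from an outermost edge. -/
theorem rot_eq (hpos : ∀ e : G.Edge, 0 < G.mult e) {p : G.Point} {σ : ℤ} (hp : G.OuterSide p σ) :
    G.rot (G.edge p) = (G.turn fun e => (G.mult e).toNat) - σ * G.mult (G.edge p) := by
  classical
  -- Beside an outermost edge `2 H + 1 = σ` for the height `H` defined by the curve alone, and `2 H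
  -- + 1` is the rotation number.
  have h₁ : ∀ C : G.Curve, C.Passes (G.edge p) → C.rotation = σ := by
    intro C hC
    obtain ⟨H, h₁, h₂, -⟩ := exists_height_rotation hpos C
    have h₃ := hp.heightLeft (sums_copies hpos C)
    rw [h₁ p hC, copies_eq hpos C, decide_eq_true hC] at h₃
    simp only [Bool.toNat_true, Nat.cast_one, mul_one] at h₃
    rw [h₂, h₃]
  have h₂ : ∑ C : G.Curve with C.Passes (G.edge p), C.rotation = σ * G.mult (G.edge p) := by
    rw [← sum_copies hpos, Finset.mul_sum, Finset.sum_filter]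
    refine Finset.sum_congr rfl fun C _ => ?_
    rw [copies_eq hpos C]
    split_ifs with h
    · rw [h₁ C h, decide_eq_true h]
      simp
    · rw [decide_eq_false h]
      simp
  rw [turn_mult_eq hpos, ← h₂, eq_sub_iff_add_eq, rot, add_comm]
  convert Finset.sum_filter_add_sum_filter_not Finset.univ (fun C : G.Curve => C.Passes (G.edge p))
    fun C => C.rotation

end Diagram

/-! ### Signs of states, the value at the cut, and the comparison -/

namespace Diagram

variable {G : Diagram}

theorem neg_one_zpow_sum {ι : Type} (I : Finset ι) (h : ι → ℤ) :
    (-1 : K) ^ (∑ i ∈ I, h i) = ∏ i ∈ I, (-1 : K) ^ h i := by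
  classical
  induction I using Finset.induction_on with
  | empty => simp
  | insert a I ha ih => rw [Finset.sum_insert ha, Finset.prod_insert ha, zpow_add₀ (by simp), ih]

/-- The sign of a state is given by the total rotation of its solid curves. -/
theorem neg_one_zpow_turn {φ : G.Edge → Bool} (hφ : G.Conserved φ) :
    (-1 : K) ^ (G.turn fun e => (φ e).toNat) = G.sign φ := by
  classical
  let r : {e : G.Edge // φ e = true} → {e : G.Edge // φ e = true} → Prop := fun e e' =>
    ∃ t, ∃ v ∈ G.corner t, e.1 ∈ v.edges ∧ e'.1 ∈ v.edges
  let I := Quot r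
  have : Finite I := inferInstanceAs (Finite (Quot r))
  let _ : Fintype I := Fintype.ofFinite I
  -- The indicator function of the `i`-th solid curve.
  let s : I → G.Edge → Bool := fun i e => decide (∃ h : φ e = true, (Quot.mk r ⟨e, h⟩ : I) = i)
  have hs : ∀ i e, s i e = true ↔ ∃ h : φ e = true, (Quot.mk r ⟨e, h⟩ : I) = i := fun i e =>
    decide_eq_true_iff
  have hcurve : ∀ i, G.IsCurve (s i) := by
    intro i
    refine ⟨?_, ?_, ?_⟩
    · intro t w hw
      have hc := hφ t w hw
      -- All solid edges at a vertex lie on one component, so near a vertex the component is either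
      -- absent or the whole state.
      have key : (∀ e ∈ w.edges, s i e = false) ∨ ∀ e ∈ w.edges, s i e = φ e := by
        by_cases h : ∃ e ∈ w.edges, s i e = true
        · right
          obtain ⟨e, he, hse⟩ := h
          obtain ⟨h, hi⟩ := (hs i e).1 hse
          intro e' he'
          cases h' : φ e' with
          | false =>
            by_contra h''
            rw [Bool.not_eq_false, hs] at h''
            obtain ⟨h'', -⟩ := h''
            exact Bool.false_ne_true (h'.symm.trans h'')
          | true =>
            rw [hs]
            refine ⟨h', ?_⟩
            rw [← hi]
            exact Quot.sound ⟨t, w, hw, he', he⟩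
        · left
          intro e he
          by_contra h'
          exact h ⟨e, he, by simpa using h'⟩
      rcases key with key | key
      · cases w <;> simp only [Corner.edges, List.mem_cons, List.not_mem_nil, or_false,
          forall_eq_or_imp, forall_eq] at key <;> simp [Corner.Conserves, key]
      · cases w <;> simp only [Corner.edges, List.mem_cons, List.not_mem_nil, or_false,
          forall_eq_or_imp, forall_eq] at key <;>
          simpa only [Corner.Conserves, key.1, key.2.1, key.2.2] using hc
    · induction i using Quot.ind with | _ e
      exact ⟨e.1, (hs _ _).2 ⟨e.2, rfl⟩⟩
    · intro X Λ hΛ e e' he he'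
      obtain ⟨h, hi⟩ := (hs i e).1 he
      obtain ⟨h', hi'⟩ := (hs i e').1 he'
      let F : {e : G.Edge // φ e = true} → Option X := fun e =>
        if (Quot.mk r e : I) = i then some (Λ e.1) else none
      have hF : ∀ x y, r x y → F x = F y := by
        intro x y hxy
        have hq : (Quot.mk r x : I) = Quot.mk r y := Quot.sound hxy
        obtain ⟨t, w, hw, hx, hy⟩ := hxy
        by_cases hxi : (Quot.mk r x : I) = i
        · have hyi := hq.symm.trans hxi
          simp only [F, if_pos hxi, if_pos hyi, Option.some.injEq]
          exact hΛ t w hw _ hx _ hy ((hs _ _).2 ⟨x.2, hxi⟩) ((hs _ _).2 ⟨y.2, hyi⟩)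
        · have hyi : ¬ (Quot.mk r y : I) = i := hq ▸ hxi
          simp only [F, if_neg hxi, if_neg hyi]
      have := congrArg (Quot.lift F hF) (hi.trans hi'.symm)
      simp only [F, if_pos hi, if_pos hi', Option.some.injEq] at this
      exact this
  have hsum : (fun e => (φ e).toNat) = fun e => ∑ i : I, (s i e).toNat := by
    funext e
    cases h : φ e with
    | false =>
      symm
      refine Finset.sum_eq_zero fun i _ => ?_
      have : s i e = false := by
        by_contra h'
        rw [Bool.not_eq_false, hs] at h'
        obtain ⟨h', -⟩ := h'
        exact Bool.false_ne_true (h.symm.trans h')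
      rw [this]
      rfl
    | true =>
      let i₀ : I := Quot.mk r ⟨e, h⟩
      rw [Finset.sum_eq_single i₀]
      · rw [(hs i₀ e).2 ⟨h, rfl⟩]
      · intro i _ hi
        have : s i e = false := by
          by_contra h'
          rw [Bool.not_eq_false, hs] at h'
          obtain ⟨_, h'⟩ := h'
          exact hi h'.symm
        rw [this]
        rfl
      · intro h
        exact absurd (Finset.mem_univ _) h
  rw [hsum, turn_sum, neg_one_zpow_sum]
  -- The turning of a connected curve is `2 H + 1`, so its parity gives one sign per solid curve.
  have hodd : ∀ i : I, (-1 : K) ^ (G.turn fun e => (s i e).toNat) = -1 := by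
    intro i
    obtain ⟨H, -, h⟩ := (hcurve i).exists_height
    rw [h]
    exact Odd.neg_one_zpow ⟨H, rfl⟩
  rw [Finset.prod_congr rfl fun i _ => hodd i, Finset.prod_const, Finset.card_univ, sign,
    ← Nat.card_eq_fintype_card]
  rfl

/-- The interval on the far left of a line belongs to the unbounded region. -/
theorem region_left_eq (t : Fin (G.n + 1)) : G.region ⟨t, 0⟩ = G.outerRegion := by
  induction t using Fin.induction with
  | zero => rfl
  | succ t ih =>
    rw [← ih]
    exact (Quot.sound ⟨t, rfl, rfl, .inl ⟨Nat.zero_le _, rfl⟩⟩).symm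

theorem IsOutermost.exists_outerSide {δ : G.Edge} (h : G.IsOutermost δ) :
    ∃ p σ, G.edge p = δ ∧ G.OuterSide p σ := by
  obtain ⟨p, hp, h | h⟩ := h
  · exact ⟨p, _, hp, .inl ⟨h, rfl⟩⟩
  · exact ⟨p, _, hp, .inr ⟨h, rfl⟩⟩

/-- The polynomial as a state sum with initial point at the cut. -/
theorem alexander_eq (hpos : ∀ e : G.Edge, 0 < G.mult e) (t : Fin (G.n + 1))
    (ht : G.level t ≠ []) : ∃ p σ, G.OuterSide p σ ∧ G.alexander t ht =
      q ^ (2 * ((G.turn fun e => (G.mult e).toNat) - σ * G.mult (G.edge p))) /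
        br (2 * G.mult (G.edge p)) * G.stateSum (G.edge p) := by
  classical
  let o : G.Point := ⟨t, 0, List.length_pos_iff.2 ht⟩
  refine ⟨o, if (G.strand o).up then 1 else -1, .inl ⟨region_left_eq t, rfl⟩, ?_⟩
  have hhead : (G.level t).head ht = G.strand o := by
    rw [← List.getElem_zero_eq_head]
    rfl
  have hmult : (G.strand o).mult = G.mult (G.edge o) := rfl
  rw [alexander, G.morphism_cut t ht o rfl rfl, hhead, G.sum_prod_entry hpos, hmult]
  have hsum : ∑ φ : G.Edge → Bool with G.IsState (G.edge o) φ,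
      (-1) ^ (G.turn fun e => (φ e).toNat) * G.weight φ = G.stateSum (G.edge o) := by
    rw [stateSum]
    refine Finset.sum_congr (by congr) fun φ hφ => ?_
    rw [neg_one_zpow_turn (Finset.mem_filter.1 hφ).2.2]
  -- The cut is made with the unbounded region to its left, so the factor from the bends is `q ^ (-2
  -- σ c)` for the `σ` of the cut point.
  have hexp : (if (G.strand o).up = true then q ^ (-2 * G.mult (G.edge o))
      else q ^ (2 * G.mult (G.edge o))) =
      q ^ (-(2 * ((if (G.strand o).up then 1 else -1) * G.mult (G.edge o)))) := by
    split_ifs <;> congr 1 <;> ring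
  rw [hsum, hexp, mul_sub, sub_eq_add_neg, add_comm, zpow_add₀ q_ne_zero]
  ring

end Diagram

end ViroAlexander

open ViroAlexander in
theorem mainTheorem5 (G : Diagram) (hpos : ∀ e : G.Edge, 0 < G.mult e)
    (t : Fin (G.n + 1)) (ht : G.level t ≠ [])
    (δ : G.Edge) (hδ : G.IsOutermost δ) :
    G.alexander t ht =
      q ^ (2 * G.rot δ) / (q ^ (2 * G.mult δ) - q ^ (-(2 * G.mult δ))) *
        ∑ᶠ s : {s : G.Edge → Bool // G.IsState δ s}, G.sign s.1 * G.weight s.1 := by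
  classical
  obtain ⟨o, σ₀, ho, hG⟩ := Diagram.alexander_eq hpos t ht
  obtain ⟨p, σ, rfl, hp⟩ := hδ.exists_outerSide
  have hsum : ∑ᶠ s : {s : G.Edge → Bool // G.IsState (G.edge p) s}, G.sign s.1 * G.weight s.1 =
      G.stateSum (G.edge p) := by
    rw [finsum_eq_sum_of_fintype, Diagram.stateSum]
    exact (Finset.sum_subtype _ (by simp) fun s => G.sign s * G.weight s).symm
  -- The state sums at the initial point and at the cut are compared; on outermost edges the
  -- exponents `2 h + c` become `σ c`.
  have key := G.stateSum_mul_eq hpos p o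
  simp only [Diagram.pointMult] at key
  rw [ho.heightLeft G.sums_mult, hp.heightLeft G.sums_mult] at key
  have hb : ∀ p : G.Point, br (2 * G.mult (G.edge p)) ≠ 0 := fun p =>
    br_ne_zero (by have := hpos (G.edge p); omega)
  have hq := fun k : ℤ => zpow_ne_zero k q_ne_zero
  change _ = q ^ (2 * G.rot (G.edge p)) / br (2 * G.mult (G.edge p)) * _
  rw [hsum, hG, Diagram.rot_eq hpos hp, mul_sub, mul_sub, zpow_sub₀ q_ne_zero,
    zpow_sub₀ q_ne_zero]
  have h₁ := hb o
  have h₂ := hb p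
  have h₃ := hq (2 * (σ₀ * G.mult (G.edge o)))
  have h₄ := hq (2 * (σ * G.mult (G.edge p)))
  rw [div_div, div_div, div_mul_eq_mul_div, div_mul_eq_mul_div,
    div_eq_div_iff (mul_ne_zero h₃ h₁) (mul_ne_zero h₄ h₂)]
  -- After splitting `Rot` into the total turning and `-σ c`, both sides share the power of `q` in
  -- the total turning, and what remains is `key`.
  linear_combination (-q ^ (2 * G.turn fun e => (G.mult e).toNat)) * key
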